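/- Let $0<s<1$, $G_s=\{z\in\mathbb C: s<|z|<1\}$, $\partial G_s=s\mathbb T\cup\mathbb T$, and $q_0=-\log s$. For bounded analytic $g$ on $G_s$, $|g|$ on $\partial G_s$ denotes the modulus of the (a.e. existing) radial boundary values, and $L^\infty$ norms on subsets of $\partial G_s$ are essential suprema with respect to arc length. Let $\mathcal B_{1,\infty}$ be the set of analytic $f$ on $G_s$ such that $f,f'$ are bounded and $$\|f\|_{H^{1,\infty}(G_s)}=\max_{j=0,1}\bigl(\|f^{(j)}\|_{L^\infty(s\mathbb T)}+\|f^{(j)}\|_{L^\infty(\mathbb T)}\bigr)\le 1 .$$ For a nonempty connected relatively open set $I\subset\partial G_s$ (so $I\subset r\mathbb T$ with $r=s$ or $r=1$; a full circle is allowed), let $2\pi\lambda$ be the angular length of $I$, so $0<\lambda\le1$, and let $\|f\|_{L^1(I)}=\frac1{2\pi\lambda}\int_{\{\theta\in[0,2\pi)\,:\,re^{i\theta}\in I\}}|f(re^{i\theta})|\,d\theta$. Put $$C_s=\inf_{|t|\le\pi}\frac1{2q_0}\sum_{j\in\mathbb Z}\frac1{1+\cosh\left(\frac{\pi}{q_0}(t+2\pi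 j)\right)},\qquad \lambda_0=\min\left(1,\frac{2\lambda C_s}{(1+2s)q_0}\right).$$ Let $\mathcal I=(s,1)$ and let $C_\infty(\mathcal I,2)$ be the least constant $C\ge 0$ such that $\|g'\|_{L^\infty(\mathcal I)}\le C\,\|g\|_{W^{2,\infty}(\mathcal I)}^{1/2}\|g\|_{L^\infty(\mathcal I)}^{1/2}$ for all complex-valued $g\in W^{2,\infty}(\mathcal I)$, where $\|g\|_{W^{2,\infty}(\mathcal I)}=\max_{0\le i\le2}\|g^{(i)}\|_{L^\infty(\mathcal I)}$ (weak derivatives). (1) Let $I$ be as above and let $f\in\mathcal B_{1,\infty}$ be not identically zero with $\|f\|_{L^1(I)}<e^{-q_0/(\lambda C_s)}$. Then $$\|f\|_{L^\infty(\partial G_s)}\le\frac{C_\infty(\mathcal I,2)^2/\left(1-\frac1{2e}\right)}{\bigl|\lambda_0\log\|f\|_{L^1(I)}\bigr|},$$ whether $\|f\|_{L^\infty(\partial G_s)}$ is read as the essential supremum of $|f|$ over $\partial G_s$ or as $\|f\|_{L^\infty(s\mathbb T)}+\|f\|_{L^\infty(\mathbb T)}$. (2) For $I=\mathbb T$, the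 functions $f_n=u_n/\|u_n\|_{H^{1,\infty}(G_s)}$ with $u_n(z)=z^{-n}$, $n\ge1$, belong to $\mathcal B_{1,\infty}$, and for either reading of $\|\cdot\|_{L^\infty(\partial G_s)}$ the limit $\lim_{n\to\infty}\|f_n\|_{L^\infty(\partial G_s)}\,\bigl|\log\|f_n\|_{L^1(\mathbb T)}\bigr|$ exists and is at least $s|\log s|$. -/

import Mathlib

namespace AnnulusHardy

open MeasureTheory Filter Topology Set
open scoped ENNReal

noncomputable section

/-- The annulus `G_s = {z : s < |z| < 1}`. -/
def annulus (s : ℝ) : Set ℂ := {z | s < ‖z‖ ∧ ‖z‖ < 1}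

/-- The circle `r𝕋` centred at the origin. -/
def circ (r : ℝ) : Set ℂ := Metric.sphere (0 : ℂ) r

/-- The boundary `∂G_s = s𝕋 ∪ 𝕋`. -/
def bdry (s : ℝ) : Set ℂ := circ s ∪ circ 1

/-- Arc length on `r𝕋`, normalized to total mass one: the image of `dθ / (2π)` on `(0, 2π]`
under `θ ↦ r e^{iθ}`. -/
def circMeasure (r : ℝ) : Measure ℂ :=
  (ENNReal.ofReal (2 * Real.pi))⁻¹ •
    (volume.restrict (Ioc (0 : ℝ) (2 * Real.pi))).map (circleMap 0 r)

/-- The measure on `∂G_s` for which each of the two circles has mass one. -/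
def bdryMeasure (s : ℝ) : Measure ℂ := circMeasure s + circMeasure 1

/-- The modulus `|f(ζ)|` of the boundary value of `f` at `ζ ∈ ∂G_s`: the upper limit of
`|f(ρ ζ/|ζ|)|` as `ρ → |ζ|` with `s < ρ < 1`. For a bounded analytic `f` on `G_s` the radial
limit of `f` exists at almost every `ζ` (Fatou), and this is its modulus there. -/
def bdryModulus (s : ℝ) (f : ℂ → ℂ) (ζ : ℂ) : ℝ≥0∞ :=
  limsup (fun ρ : ℝ => ‖f ((ρ : ℂ) * (ζ / (‖ζ‖ : ℂ)))‖ₑ) (𝓝[Ioo s 1] ‖ζ‖)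

/-- `‖f‖_{L^∞(E)}` for `E ⊆ ∂G_s`: essential supremum over `E` of the boundary values of `f`. -/
def linfNorm (s : ℝ) (E : Set ℂ) (f : ℂ → ℂ) : ℝ :=
  (essSup (bdryModulus s f) ((bdryMeasure s).restrict E)).toReal

/-- `H^{k,∞}(G_s)`: the functions analytic on `G_s` that are bounded there together with their
complex derivatives up to order `k`. -/
def MemHardySobolev (k : ℕ) (s : ℝ) (f : ℂ → ℂ) : Prop :=
  DifferentiableOn ℂ f (annulus s) ∧
    ∀ j ≤ k, ∃ M : ℝ, ∀ z ∈ annulus s, ‖iteratedDeriv j f z‖ ≤ M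

/-- `‖f‖_{H^{k,∞}(G_s)} = max_{0 ≤ j ≤ k} (‖f^{(j)}‖_{L^∞(s𝕋)} + ‖f^{(j)}‖_{L^∞(𝕋)})`. -/
def hardySobolevNorm (k : ℕ) (s : ℝ) (f : ℂ → ℂ) : ℝ :=
  ⨆ j : Fin (k + 1),
    (linfNorm s (circ s) (iteratedDeriv j f) + linfNorm s (circ 1) (iteratedDeriv j f))

/-- The closed unit ball of `H^{k,∞}(G_s)`. -/
def unitBall (k : ℕ) (s : ℝ) : Set (ℂ → ℂ) :=
  {f | MemHardySobolev k s f ∧ hardySobolevNorm k s f ≤ 1}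

/-- `I` is a nonempty connected (relatively) open subset of `∂G_s`. -/
def IsBdryArc (s : ℝ) (I : Set ℂ) : Prop :=
  IsConnected I ∧ ∃ U : Set ℂ, IsOpen U ∧ I = U ∩ bdry s

/-- `λ`: the angular length of `I`, divided by `2π`. -/
def arcFraction (s : ℝ) (I : Set ℂ) : ℝ := (bdryMeasure s I).toReal

/-- `‖f‖_{L¹(I)} = (1 / (2πλ)) ∫_I |f| dθ`, the mean of `|f|` over `I`. -/
def l1Norm (s : ℝ) (I : Set ℂ) (f : ℂ → ℂ) : ℝ :=
  (arcFraction s I)⁻¹ * (∫⁻ ζ in I, bdryModulus s f ζ ∂(bdryMeasure s)).toReal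

/-- `q₀ = - log s`. -/
def q0 (s : ℝ) : ℝ := -Real.log s

/-- `C_s = inf_{|t| ≤ π} (1 / (2 q₀)) ∑_{j ∈ ℤ} 1 / (1 + cosh ((π / q₀) (t + 2πj)))`. -/
def kernelConst (s : ℝ) : ℝ :=
  ⨅ t : Icc (-Real.pi) Real.pi,
    1 / (2 * q0 s) *
      ∑' j : ℤ, 1 / (1 + Real.cosh (Real.pi / q0 s * ((t : ℝ) + 2 * Real.pi * (j : ℝ))))

/-- `λ₀ = min (1, 2 λ C_s / ((1 + 2s) q₀))`. -/
def lambda0 (s : ℝ) (I : Set ℂ) : ℝ :=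
  min 1 (2 * arcFraction s I * kernelConst s / ((1 + 2 * s) * q0 s))

/-- `g'` is the weak derivative of `g` on the interval `(a, b)`. -/
def HasWeakDerivOn (a b : ℝ) (g g' : ℝ → ℂ) : Prop :=
  ∀ φ : ℝ → ℝ, ContDiff ℝ (⊤ : ℕ∞) φ → HasCompactSupport φ → tsupport φ ⊆ Ioo a b →
    ∫ x in Ioo a b, deriv φ x • g x = -∫ x in Ioo a b, φ x • g' x

/-- `G 0 ∈ W^{j,∞}(a, b)`, and `G i` is its weak derivative of order `i` for `i ≤ j`. -/
def IsSobolevJet (a b : ℝ) (j : ℕ) (G : ℕ → ℝ → ℂ) : Prop :=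
  (∀ i ≤ j, MemLp (G i) ⊤ (volume.restrict (Ioo a b))) ∧
    ∀ i < j, HasWeakDerivOn a b (G i) (G (i + 1))

/-- The norm of `L^∞(a, b)`. -/
def supNormOn (a b : ℝ) (g : ℝ → ℂ) : ℝ :=
  (eLpNorm g ⊤ (volume.restrict (Ioo a b))).toReal

/-- The norm `max_{0 ≤ i ≤ j} ‖g^{(i)}‖_{L^∞(a, b)}` of `W^{j,∞}(a, b)`. -/
def sobolevNorm (a b : ℝ) (j : ℕ) (G : ℕ → ℝ → ℂ) : ℝ :=
  ⨆ i : Fin (j + 1), supNormOn a b (G i)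

/-- `C_∞((a, b), j)`: the least `C ≥ 0` such that
`‖g'‖_∞ ≤ C ‖g‖_{W^{j,∞}}^{1/j} ‖g‖_∞^{1-1/j}` for all `g ∈ W^{j,∞}(a, b)`. -/
def hllConst (a b : ℝ) (j : ℕ) : ℝ :=
  sInf {C : ℝ | 0 ≤ C ∧ ∀ G : ℕ → ℝ → ℂ, IsSobolevJet a b j G →
    supNormOn a b (G 1) ≤
      C * sobolevNorm a b j G ^ (1 / (j : ℝ)) * supNormOn a b (G 0) ^ (1 - 1 / (j : ℝ))}

/-- The right-hand side `(C_∞((s, 1), 2)² / (1 - 1/(2e))) / |λ₀ log ‖f‖_{L¹(I)}|`. -/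
def logBound (s : ℝ) (I : Set ℂ) (f : ℂ → ℂ) : ℝ :=
  (hllConst s 1 2 ^ 2 / (1 - 1 / (2 * Real.exp 1))) /
    |lambda0 s I * Real.log (l1Norm s I f)|

end

end AnnulusHardy

namespace AnnulusHardy

open MeasureTheory Filter Topology Set
open scoped ENNReal

/-! ### The periodized kernel -/

/-! The estimate is a two-constants argument combined with a Lipschitz bound. Put `ε = l1Norm s I
f`, let `m` be the larger of the sup norms of `f` on the two circles, and pull `f` back by the
exponential to a `2πi`-periodic function on the strip `-q₀ < Re w < 0`. This function extends
continuously to the closed strip because `f'` is bounded.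

Mapping the disc onto the strip turns Jensen's formula into a bound for `log |f|` at an interior
point by an average over the two edges. With `a = π(-log ρ)/q₀`, the harmonic measure seen from
radius `ρ` has density proportional to `sin a / (cosh u ∓ cos a)`, which is at least `sin a / (1 +
cosh u)`. Periodizing this minorant produces `kernelConst` (`kernelConst_mul_lintegral_le_log`).
Convexity of `-log` on the arc brings in the `L¹` mean (`sin_mul_log_div_le`), so that at distance
at least `d` from both circles `|f| ≤ m exp(-6 λ₀ d log(m/ε))` (`norm_le_mul_exp`).

On the annulus `|f'| ≤ 1` (`norm_deriv_le_of_bdryModulus_le`), so moving inward by `d` from the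
boundary costs at most `d`, and `m ≤ m exp(-6 λ₀ d log(m/ε)) + d` for every `d ≤ (1 - s)/2`.
Choosing `d` comparable to `min(m, 1 - s)` yields `2m |λ₀ log ε| ≤ 2/(1 - s)`
(`two_mul_mul_abs_log_le`, `linfNorm_add_mul_abs_log_le`).

The constant `hllConst` enters only through the lower bound `2/(1 - s) ≤ hllConst²`, obtained by
testing on an affine function (`two_div_le_hllConst_sq`). Since `hllConst` is an infimum, this also
requires some admissible constant to exist, which is the Landau-type inequality
`exists_hardyLandauLittlewood`.

For the second claim all norms of `z⁻ⁿ` are explicit, because the modulus is constant on each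
circle; the limit equals `s |log s|` for both readings of the boundary norm. -/

lemma q0_pos {s : ℝ} (hs0 : 0 < s) (hs1 : s < 1) : 0 < q0 s :=
  neg_pos.mpr (Real.log_neg hs0 hs1)

lemma inv_one_add_cosh_pos (x : ℝ) : 0 < 1 / (1 + Real.cosh x) := by
  have := Real.cosh_pos x
  positivity

/-- Quadratic decay is enough for summability. It follows from `cosh x = 1 + 2 sinh²(x/2)` and
`|sinh y| ≥ |y|`. -/
lemma inv_one_add_cosh_le (x : ℝ) : 1 / (1 + Real.cosh x) ≤ 2 / (1 + x ^ 2) := by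
  have h : 1 + x ^ 2 / 2 ≤ Real.cosh x := by
    have h1 := Real.cosh_two_mul (x / 2)
    have h2 := Real.cosh_sq (x / 2)
    have h3 : (x / 2) ^ 2 ≤ Real.sinh (x / 2) ^ 2 := by
      rw [← sq_abs, ← sq_abs (Real.sinh _), Real.abs_sinh]
      exact pow_le_pow_left₀ (abs_nonneg _) (Real.self_le_sinh_iff.mpr (abs_nonneg _)) 2
    rw [show 2 * (x / 2) = x by ring] at h1
    nlinarith
  rw [div_le_div_iff₀ (by have := Real.cosh_pos x; positivity) (by positivity)]
  nlinarith

lemma summable_kernel {q : ℝ} (hq : 0 < q) (t : ℝ) :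
    Summable fun j : ℤ => 1 / (1 + Real.cosh (Real.pi / q * (t + 2 * Real.pi * (j : ℝ)))) := by
  set b : ℝ := Real.pi / q * (2 * Real.pi)
  have hb : 0 < b := by positivity
  set a : ℝ := Real.pi / q * t
  have key : Summable fun j : ℤ => 2 / (b ^ 2) * (1 / |(j : ℝ) + a / b| ^ (2 : ℝ)) :=
    (Real.summable_one_div_int_add_rpow (a / b) 2).mpr (by norm_num) |>.mul_left _
  refine Summable.of_norm_bounded_eventually key ?_
  -- If some `j` has `j + a/b = 0`, the majorant there is `1/0 = 0` while the term is `1/2`; the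
  -- comparison is therefore made off a finite set.
  have hfin : {j : ℤ | (j : ℝ) + a / b = 0}.Finite := by
    refine Set.Subsingleton.finite fun i hi j hj => ?_
    simp only [mem_ofPred_eq] at hi hj
    exact_mod_cast (by linarith : (i : ℝ) = j)
  filter_upwards [hfin.compl_mem_cofinite] with j hj
  have hj : (j : ℝ) + a / b ≠ 0 := hj
  rw [Real.norm_of_nonneg (inv_one_add_cosh_pos _).le]
  have e : Real.pi / q * (t + 2 * Real.pi * (j : ℝ)) = b * ((j : ℝ) + a / b) := by
    field_simp
    simp only [a, b]
    field_simp
    ring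
  rw [e]
  refine (inv_one_add_cosh_le _).trans ?_
  rw [div_mul_div_comm, mul_one, Real.rpow_two, sq_abs, ← mul_pow]
  have : 0 < (b * ((j : ℝ) + a / b)) ^ 2 := by positivity
  gcongr
  linarith

lemma kernelSum_nonneg {q : ℝ} (t : ℝ) :
    0 ≤ ∑' j : ℤ, 1 / (1 + Real.cosh (Real.pi / q * (t + 2 * Real.pi * (j : ℝ)))) :=
  tsum_nonneg fun _ => (inv_one_add_cosh_pos _).le

/-- The periodized sum is `2π`-periodic in `t`: reducing `t` into `(-π, π]` only shifts the
summation index, so the infimum over one period bounds the sum everywhere. -/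
lemma kernelConst_le {s : ℝ} (hs0 : 0 < s) (hs1 : s < 1) (t : ℝ) :
    kernelConst s ≤ 1 / (2 * q0 s) *
      ∑' j : ℤ, 1 / (1 + Real.cosh (Real.pi / q0 s * (t + 2 * Real.pi * (j : ℝ)))) := by
  have hq := q0_pos hs0 hs1
  have hp : (0 : ℝ) < 2 * Real.pi := by positivity
  set τ := toIocMod hp (-Real.pi) t with hτ
  have hmem : τ ∈ Icc (-Real.pi) Real.pi := by
    have := toIocMod_mem_Ioc hp (-Real.pi) t
    exact ⟨this.1.le, by linarith [this.2]⟩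
  have hbd : BddBelow (range fun t : Icc (-Real.pi) Real.pi => 1 / (2 * q0 s) *
      ∑' j : ℤ, 1 / (1 + Real.cosh (Real.pi / q0 s * ((t : ℝ) + 2 * Real.pi * (j : ℝ))))) :=
    ⟨0, by rintro _ ⟨t, rfl⟩; exact mul_nonneg (by positivity) (kernelSum_nonneg _)⟩
  refine (ciInf_le hbd ⟨τ, hmem⟩).trans (le_of_eq ?_)
  congr 1
  rw [← (Equiv.addRight (toIocDiv hp (-Real.pi) t)).tsum_eq]
  congr 1
  ext j
  have : τ = t - toIocDiv hp (-Real.pi) t * (2 * Real.pi) := by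
    rw [hτ, toIocMod, zsmul_eq_mul]
  simp only [Equiv.coe_addRight, Int.cast_add, this]
  ring_nf

/-- The term `j = 0` alone is bounded below on `|t| ≤ π` by its value at the endpoint, since `cosh`
increases with `|x|`. -/
lemma kernelConst_pos {s : ℝ} (hs0 : 0 < s) (hs1 : s < 1) : 0 < kernelConst s := by
  have hq := q0_pos hs0 hs1
  have hne : Nonempty (Icc (-Real.pi) Real.pi) := ⟨⟨0, by constructor <;> linarith [Real.pi_pos]⟩⟩
  refine lt_of_lt_of_le (b := 1 / (2 * q0 s) * (1 / (1 + Real.cosh (Real.pi / q0 s * Real.pi))))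
    (mul_pos (by positivity) (inv_one_add_cosh_pos _)) (le_ciInf fun t => ?_)
  refine mul_le_mul_of_nonneg_left ?_ (by positivity)
  refine le_trans ?_ ((summable_kernel hq (t : ℝ)).le_tsum 0 fun j _ => (inv_one_add_cosh_pos _).le)
  have : Real.cosh (Real.pi / q0 s * ((t : ℝ) + 2 * Real.pi * ((0 : ℤ) : ℝ))) ≤
      Real.cosh (Real.pi / q0 s * Real.pi) := by
    rw [Real.cosh_le_cosh]
    simp only [Int.cast_zero, mul_zero, add_zero, abs_mul, abs_of_pos Real.pi_pos]
    have := abs_le.mpr t.2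
    gcongr
  have h0 := Real.cosh_pos (Real.pi / q0 s * ((t : ℝ) + 2 * Real.pi * ((0 : ℤ) : ℝ)))
  exact one_div_le_one_div_of_le (by positivity) (by linarith)

lemma lintegral_eq_tsum_Ioc {p : ℝ} (hp : 0 < p) (g : ℝ → ℝ≥0∞) :
    ∫⁻ t, g t = ∑' j : ℤ, ∫⁻ t in Ioc 0 p, g (t + j * p) := by
  rw [← setLIntegral_univ, ← iUnion_Ioc_add_zsmul hp 0,
    lintegral_iUnion (fun _ => measurableSet_Ioc) (pairwise_disjoint_Ioc_add_zsmul 0 p)]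
  congr 1
  ext j
  have h := (measurePreserving_add_right (volume : Measure ℝ) (j * p)).setLIntegral_comp_preimage_emb
    (measurableEmbedding_addRight _) g (Ioc (0 + j • p) (0 + (j + 1) • p))
  rw [← h]
  congr 2
  ext t
  simp only [mem_preimage, mem_Ioc, zsmul_eq_mul, Int.cast_add, Int.cast_one]
  constructor <;> rintro ⟨h1, h2⟩ <;> constructor <;> linarith

/-- Substitute `t = θ + (q₀/π) u` and fold the line modulo `2π`. By periodicity `Ψ` factors out of
the sum over translates, and what remains is the periodized kernel, which is at least `2 q₀ C_s`;
the Jacobian `π/q₀` turns this into `2π C_s`. -/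
lemma ofReal_kernelConst_mul_lintegral_le {s : ℝ} (hs0 : 0 < s) (hs1 : s < 1) {Ψ : ℝ → ℝ≥0∞}
    (hΨ : Measurable Ψ) (hper : Function.Periodic Ψ (2 * Real.pi)) (θ : ℝ) :
    ENNReal.ofReal (2 * Real.pi * kernelConst s) * ∫⁻ t in Ioc 0 (2 * Real.pi), Ψ t ≤
      ∫⁻ u, ENNReal.ofReal (1 / (1 + Real.cosh u)) * Ψ (θ + q0 s / Real.pi * u) := by
  have hq := q0_pos hs0 hs1
  have hpi := Real.pi_pos
  have hp : (0 : ℝ) < 2 * Real.pi := by positivity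
  set k : ℝ → ℝ := fun t => 1 / (1 + Real.cosh (Real.pi / q0 s * (t - θ)))
  have hk : Measurable k := by
    refine Continuous.measurable ?_
    refine continuous_const.div (by fun_prop) fun t => ?_
    have := Real.cosh_pos (Real.pi / q0 s * (t - θ))
    positivity
  have hsub : ∫⁻ t, ENNReal.ofReal (k t) * Ψ t = ENNReal.ofReal (q0 s / Real.pi) *
      ∫⁻ u, ENNReal.ofReal (1 / (1 + Real.cosh u)) * Ψ (θ + q0 s / Real.pi * u) := by
    have h := lintegral_image_eq_lintegral_abs_deriv_mul (s := univ)
      (f := fun u => θ + q0 s / Real.pi * u) (f' := fun _ => q0 s / Real.pi) MeasurableSet.univ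
      (fun u _ => by
        simpa using (hasDerivAt_id' u).const_mul (q0 s / Real.pi))
      (fun u _ v _ h => by
        have h : q0 s / Real.pi * u = q0 s / Real.pi * v := by simpa using h
        exact mul_left_cancel₀ (by positivity) h)
      (fun t => ENNReal.ofReal (k t) * Ψ t)
    have himg : (fun u => θ + q0 s / Real.pi * u) '' univ = univ := by
      rw [image_univ, range_eq_univ]
      intro t
      refine ⟨Real.pi / q0 s * (t - θ), ?_⟩
      field_simp
      ring
    rw [himg, setLIntegral_univ, setLIntegral_univ, abs_of_pos (by positivity),
      lintegral_const_mul'] at h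
    · rw [h]
      congr 2
      ext u
      congr 4
      simp only [k]
      congr 3
      field_simp
      ring
    · exact ENNReal.ofReal_ne_top
  have hge : ENNReal.ofReal (2 * q0 s * kernelConst s) * ∫⁻ t in Ioc 0 (2 * Real.pi), Ψ t ≤
      ∫⁻ t, ENNReal.ofReal (k t) * Ψ t := by
    rw [lintegral_eq_tsum_Ioc hp, ← lintegral_tsum (fun j => by fun_prop),
      ← lintegral_const_mul _ hΨ]
    refine lintegral_mono fun t => ?_
    have e : ∀ j : ℤ, Ψ (t + j * (2 * Real.pi)) = Ψ t := fun j => hper.int_mul j t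
    simp only [e]
    rw [ENNReal.tsum_mul_right]
    gcongr
    have hs := summable_kernel hq (t - θ)
    have e2 : ∀ j : ℤ, k (t + j * (2 * Real.pi)) =
        1 / (1 + Real.cosh (Real.pi / q0 s * (t - θ + 2 * Real.pi * (j : ℝ)))) := by
      intro j
      simp only [k]
      ring_nf
    simp only [e2]
    rw [← ENNReal.ofReal_tsum_of_nonneg (fun j => (inv_one_add_cosh_pos _).le) hs]
    refine ENNReal.ofReal_le_ofReal ?_
    have h := kernelConst_le hs0 hs1 (t - θ)
    rw [one_div, inv_mul_eq_div, le_div_iff₀ (by positivity)] at h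
    linarith
  have h3 : ENNReal.ofReal (2 * Real.pi * kernelConst s) =
      ENNReal.ofReal (Real.pi / q0 s) * ENNReal.ofReal (2 * q0 s * kernelConst s) := by
    rw [← ENNReal.ofReal_mul (by positivity)]
    congr 1
    field_simp
  rw [h3, mul_assoc]
  refine (mul_le_mul_right (hge.trans_eq hsub) _).trans_eq ?_
  rw [← mul_assoc, ← ENNReal.ofReal_mul (by positivity)]
  have : Real.pi / q0 s * (q0 s / Real.pi) = 1 := by field_simp
  rw [this, ENNReal.ofReal_one, one_mul]

/-! ### An elementary self-improving inequality -/

/-- If `d ≤ m/2`, the hypothesis `H` forces the exponential to be at least `1/2`, hence `6 l d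
log(m/ε) ≤ log 2`. Taking `d = min(m, ℓ)/2` controls `2 m l log(m/ε)` by `0.5/ℓ`. Replacing
`log(m/ε)` by `-log ε` costs `2 l m (-log m) ≤ 1`, which fits in the remaining `1.5/ℓ`. -/
lemma two_mul_mul_abs_log_le {ℓ m l ε : ℝ} (hℓ0 : 0 < ℓ) (hℓ1 : ℓ ≤ 1) (hl0 : 0 ≤ l) (hl1 : l ≤ 1)
    (hm0 : 0 < m) (hm1 : m ≤ 1) (hε0 : 0 < ε) (hεm : ε ≤ m)
    (H : ∀ d, 0 < d → d ≤ ℓ / 2 → m ≤ m * Real.exp (-(6 * l * d * Real.log (m / ε))) + d) :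
    2 * m * |l * Real.log ε| ≤ 2 / ℓ := by
  have hlog : 0 ≤ Real.log (m / ε) := Real.log_nonneg ((one_le_div hε0).mpr hεm)
  have hlogε : Real.log ε ≤ 0 := Real.log_nonpos hε0.le (hεm.trans hm1)
  have hsplit : -Real.log ε = Real.log (m / ε) - Real.log m := by
    rw [Real.log_div hm0.ne' hε0.ne']; ring
  -- From `log √m ≥ 1 - 1/√m` one gets `-m log m ≤ 2√m - 2m`, and this is at most `1/2` by
  -- completing the square.
  have hmlog : m * -Real.log m ≤ 1 / 2 := by
    have h1 : Real.log m = 2 * Real.log (√m) := by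
      rw [Real.log_sqrt hm0.le]; ring
    have h2 : 1 - (√m)⁻¹ ≤ Real.log (√m) := Real.one_sub_inv_le_log_of_pos (Real.sqrt_pos.mpr hm0)
    have h3 : m * (√m)⁻¹ = √m := by
      rw [← div_eq_mul_inv, Real.div_sqrt]
    have h4 := Real.sq_sqrt hm0.le
    nlinarith [sq_nonneg (√m - 1 / 2)]
  have hlog2 := Real.log_two_lt_d9
  have half : ∀ d, 0 < d → d ≤ ℓ / 2 → d ≤ m / 2 → 6 * l * d * Real.log (m / ε) ≤ 0.7 := by
    intro d hd0 hd1 hd2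
    have h := H d hd0 hd1
    have h1 : 1 / 2 ≤ Real.exp (-(6 * l * d * Real.log (m / ε))) := by
      by_contra hcon
      push Not at hcon
      nlinarith
    have h2 : 6 * l * d * Real.log (m / ε) ≤ Real.log 2 := by
      rw [Real.le_log_iff_exp_le (by norm_num)]
      rw [Real.exp_neg] at h1
      have := Real.exp_pos (6 * l * d * Real.log (m / ε))
      rw [div_le_iff₀ (by norm_num), inv_mul_eq_div, le_div_iff₀ this] at h1
      linarith
    linarith
  rw [abs_mul, abs_of_nonneg hl0, abs_of_nonpos hlogε, hsplit]
  have hmain : 2 * m * (l * Real.log (m / ε)) ≤ 0.5 / ℓ := by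
    rw [le_div_iff₀ hℓ0]
    have hll : 0 ≤ l * Real.log (m / ε) := mul_nonneg hl0 hlog
    rcases le_total m ℓ with h | h
    · have := half (m / 2) (by positivity) (by linarith) le_rfl
      nlinarith
    · have := half (ℓ / 2) (by positivity) le_rfl (by linarith)
      nlinarith
  have h5 : 1.5 / ℓ ≥ 1.5 := by
    rw [ge_iff_le, le_div_iff₀ hℓ0]; nlinarith
  have h6 : 2 / ℓ = 0.5 / ℓ + 1.5 / ℓ := by rw [← add_div]; norm_num
  have h7 : l * (m * -Real.log m) ≤ 1 / 2 := by
    have : 0 ≤ m * -Real.log m := mul_nonneg hm0.le (neg_nonneg.mpr (Real.log_nonpos hm0.le hm1))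
    nlinarith
  rw [h6]
  nlinarith

/-! ### The conformal map of the disc onto a strip -/

/-- The Möbius map of the unit disc onto the right half-plane with `0 ↦ -i e^{ia}`. -/
noncomputable def halfPlaneMap (a : ℝ) (ζ : ℂ) : ℂ :=
  -Complex.I * ((Real.cos a + Real.sin a * Complex.I) - (Real.cos a - Real.sin a * Complex.I) * ζ) /
    (1 - ζ)

/-- The conformal map of the unit disc onto `{-q < Re w < 0}` with `0 ↦ -qa/π + iθ`. -/
noncomputable def stripMap (q a θ : ℝ) (ζ : ℂ) : ℂ :=
  -(q / 2) + θ * Complex.I + Complex.I * ((q / Real.pi : ℝ) * Complex.log (halfPlaneMap a ζ))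

lemma one_sub_ne_zero_of_norm_lt {ζ : ℂ} (hζ : ‖ζ‖ < 1) : 1 - ζ ≠ 0 := by
  intro h
  rw [← sub_eq_zero.mp h] at hζ
  simp at hζ

/-- This is a multiple of the Poisson kernel of the disc with pole at `1`; its sign shows that the
image lies in the right half-plane. -/
lemma halfPlaneMap_re (a : ℝ) {ζ : ℂ} (hζ : 1 - ζ ≠ 0) :
    (halfPlaneMap a ζ).re = Real.sin a * (1 - Complex.normSq ζ) / Complex.normSq (1 - ζ) := by
  have h0 : Complex.normSq (1 - ζ) ≠ 0 := by simpa using hζ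
  rw [halfPlaneMap, Complex.div_re]
  generalize Real.sin a = σ
  generalize Real.cos a = c
  field_simp
  simp [Complex.normSq_apply]
  ring

lemma halfPlaneMap_re_pos {a : ℝ} (ha0 : 0 < a) (ha1 : a < Real.pi) {ζ : ℂ} (hζ : ‖ζ‖ < 1) :
    0 < (halfPlaneMap a ζ).re := by
  have h := one_sub_ne_zero_of_norm_lt hζ
  rw [halfPlaneMap_re a h]
  have h1 := Real.sin_pos_of_pos_of_lt_pi ha0 ha1
  have h2 : Complex.normSq ζ < 1 := by
    rw [Complex.normSq_eq_norm_sq]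
    nlinarith [norm_nonneg ζ]
  have h3 : 0 < Complex.normSq (1 - ζ) := Complex.normSq_pos.mpr h
  exact div_pos (mul_pos h1 (by linarith)) h3

lemma differentiableAt_halfPlaneMap (a : ℝ) {ζ : ℂ} (hζ : 1 - ζ ≠ 0) :
    DifferentiableAt ℂ (halfPlaneMap a) ζ := by
  unfold halfPlaneMap
  fun_prop (disch := assumption)

lemma differentiableAt_stripMap {q a θ : ℝ} {ζ : ℂ} (hζ : 1 - ζ ≠ 0)
    (h : halfPlaneMap a ζ ∈ Complex.slitPlane) : DifferentiableAt ℂ (stripMap q a θ) ζ := by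
  have := (differentiableAt_halfPlaneMap a hζ).clog h
  unfold stripMap
  fun_prop

lemma stripMap_re (q a θ : ℝ) (ζ : ℂ) :
    (stripMap q a θ ζ).re = -(q / 2) - q / Real.pi * (halfPlaneMap a ζ).arg := by
  simp [stripMap, Complex.log_im, Complex.mul_re]
  norm_cast

lemma stripMap_re_mem {q a θ : ℝ} (hq : 0 < q) (ha0 : 0 < a) (ha1 : a < Real.pi) {ζ : ℂ}
    (hζ : ‖ζ‖ < 1) : (stripMap q a θ ζ).re ∈ Ioo (-q) 0 := by
  have h := Complex.abs_arg_lt_pi_div_two_iff.mpr (Or.inl (halfPlaneMap_re_pos ha0 ha1 hζ))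
  rw [abs_lt] at h
  rw [stripMap_re]
  have hpi := Real.pi_pos
  have e : q / 2 = q / Real.pi * (Real.pi / 2) := by field_simp
  have hqp : 0 < q / Real.pi := by positivity
  constructor <;> nlinarith

lemma stripMap_zero {q a θ : ℝ} (ha0 : 0 < a) (ha1 : a < Real.pi) :
    stripMap q a θ 0 = ((-(q * a / Real.pi) : ℝ) : ℂ) + θ * Complex.I := by
  have hpi := Real.pi_ne_zero
  have h1 : halfPlaneMap a 0 = Complex.exp (((a - Real.pi / 2 : ℝ) : ℂ) * Complex.I) := by
    rw [Complex.exp_mul_I, ← Complex.ofReal_cos, ← Complex.ofReal_sin, Real.cos_sub_pi_div_two,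
      Real.sin_sub_pi_div_two]
    simp only [halfPlaneMap, Complex.ofReal_neg]
    ring_nf
    simp
  have h2 : Complex.log (halfPlaneMap a 0) = ((a - Real.pi / 2 : ℝ) : ℂ) * Complex.I := by
    rw [h1, Complex.log_exp]
    · simp; linarith
    · simp; linarith
  rw [stripMap, h2]
  have : Complex.I * (((q / Real.pi : ℝ) : ℂ) * (((a - Real.pi / 2 : ℝ) : ℂ) * Complex.I)) =
      -(((q / Real.pi : ℝ) : ℂ) * ((a - Real.pi / 2 : ℝ) : ℂ)) := by
    ring_nf
    simp
  rw [this, ← Complex.ofReal_mul,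
    show q / Real.pi * (a - Real.pi / 2) = q * a / Real.pi - q / 2 by field_simp]
  push_cast
  ring

/-- The point of the unit circle that `halfPlaneMap a` sends to `-i x`, as an angle. -/
noncomputable def boundaryAngle (a x : ℝ) : ℝ :=
  Real.pi + 2 * Real.arctan ((x - Real.cos a) / Real.sin a)

lemma ofReal_mul_I_sub_one_ne_zero (v : ℝ) : (v : ℂ) * Complex.I - 1 ≠ 0 := by
  intro h
  have := congrArg Complex.re h
  simp at this

/-- Tangent half-angle substitution: with `v = tan φ`, the point `e^{i(π + 2φ)}` equals `-(1 +
iv)/(1 - iv)`. -/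
lemma circleMap_boundaryAngle (a x : ℝ) :
    circleMap 0 1 (boundaryAngle a x) =
      (1 + ((x - Real.cos a) / Real.sin a : ℝ) * Complex.I) /
        (((x - Real.cos a) / Real.sin a : ℝ) * Complex.I - 1) := by
  rw [boundaryAngle]
  generalize (x - Real.cos a) / Real.sin a = v
  obtain ⟨φ, hφ⟩ : ∃ φ, φ = Real.arctan v := ⟨_, rfl⟩
  rw [← hφ]
  have hc : 0 < Real.cos φ := hφ ▸ Real.cos_arctan_pos v
  have hsv : Real.sin φ = v * Real.cos φ := by
    have := Real.tan_mul_cos hc.ne'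
    rw [hφ, Real.tan_arctan] at this
    rw [hφ]; exact this.symm
  have hcs := Real.sin_sq_add_cos_sq φ
  have h1 : circleMap 0 1 (Real.pi + 2 * φ) =
      -(Real.cos (2 * φ) + Real.sin (2 * φ) * Complex.I) := by
    rw [circleMap]
    push_cast
    rw [zero_add, one_mul, add_mul, Complex.exp_add, Complex.exp_pi_mul_I, Complex.exp_mul_I]
    simp
  have h2 := ofReal_mul_I_sub_one_ne_zero v
  rw [h1, eq_div_iff h2, Real.cos_two_mul, Real.sin_two_mul, hsv]
  rw [hsv] at hcs
  have hcs' : Real.cos φ ^ 2 * (1 + v ^ 2) = 1 := by linarith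
  generalize Real.cos φ = c at hcs'
  apply Complex.ext
  · simp [pow_two]
    linear_combination (2 : ℝ) * hcs'
  · simp [pow_two]
    ring

lemma one_sub_circleMap_boundaryAngle_ne_zero (a x : ℝ) :
    1 - circleMap 0 1 (boundaryAngle a x) ≠ 0 := by
  rw [circleMap_boundaryAngle]
  generalize (x - Real.cos a) / Real.sin a = v
  have h2 := ofReal_mul_I_sub_one_ne_zero v
  rw [sub_ne_zero, ne_eq, eq_div_iff h2]
  intro h
  have := congrArg Complex.re h
  simp at this
  norm_num at this

lemma halfPlaneMap_boundaryAngle {a : ℝ} (ha : Real.sin a ≠ 0) (x : ℝ) :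
    halfPlaneMap a (circleMap 0 1 (boundaryAngle a x)) = -(x * Complex.I) := by
  have h0 := one_sub_circleMap_boundaryAngle_ne_zero a x
  rw [halfPlaneMap, div_eq_iff h0]
  rw [circleMap_boundaryAngle]
  obtain ⟨v, hv⟩ : ∃ v, v = (x - Real.cos a) / Real.sin a := ⟨_, rfl⟩
  have hx : x = v * Real.sin a + Real.cos a := by
    rw [hv]; field_simp; ring
  have h2 := ofReal_mul_I_sub_one_ne_zero v
  rw [← hv, hx, one_sub_div h2, mul_div_assoc', mul_div_assoc', sub_div' h2, mul_div_assoc']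
  congr 1
  generalize Real.sin a = σ
  generalize Real.cos a = c
  apply Complex.ext
  · simp
  · simp
    ring

lemma halfPlaneMap_boundaryAngle_mem_slitPlane {a : ℝ} (ha : Real.sin a ≠ 0) {x : ℝ} (hx : x ≠ 0) :
    halfPlaneMap a (circleMap 0 1 (boundaryAngle a x)) ∈ Complex.slitPlane := by
  rw [halfPlaneMap_boundaryAngle ha]
  right
  simpa using hx

/-- The point `-i eᵘ` has logarithm `u - iπ/2`, which lands on the edge `Re w = 0` at height `θ +
qu/π`. The opposite half-line, with logarithm `u + iπ/2`, gives the edge `Re w = -q`. -/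
lemma stripMap_boundaryAngle_exp {q a θ : ℝ} (ha : Real.sin a ≠ 0) (u : ℝ) :
    stripMap q a θ (circleMap 0 1 (boundaryAngle a (Real.exp u))) =
      ((θ + q / Real.pi * u : ℝ) : ℂ) * Complex.I := by
  rw [stripMap, halfPlaneMap_boundaryAngle ha]
  have h : -(((Real.exp u : ℝ) : ℂ) * Complex.I) =
      ((Real.exp u : ℝ) : ℂ) * -Complex.I := by ring
  rw [h, Complex.log_ofReal_mul (Real.exp_pos u) (by simp), Real.log_exp, Complex.log_neg_I]
  have hpi : (Real.pi : ℂ) ≠ 0 := by exact_mod_cast Real.pi_ne_zero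
  push_cast
  field_simp
  ring_nf
  simp

lemma stripMap_boundaryAngle_neg_exp {q a θ : ℝ} (ha : Real.sin a ≠ 0) (u : ℝ) :
    stripMap q a θ (circleMap 0 1 (boundaryAngle a (-Real.exp u))) =
      ((-q : ℝ) : ℂ) + ((θ + q / Real.pi * u : ℝ) : ℂ) * Complex.I := by
  rw [stripMap, halfPlaneMap_boundaryAngle ha]
  have h : -(((-Real.exp u : ℝ) : ℂ) * Complex.I) =
      ((Real.exp u : ℝ) : ℂ) * Complex.I := by push_cast; ring
  rw [h, Complex.log_ofReal_mul (Real.exp_pos u) (by simp), Real.log_exp, Complex.log_I]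
  have hpi : (Real.pi : ℂ) ≠ 0 := by exact_mod_cast Real.pi_ne_zero
  push_cast
  field_simp
  ring_nf
  simp
  ring

lemma boundaryAngle_mem_Ioo (a x : ℝ) : boundaryAngle a x ∈ Ioo 0 (2 * Real.pi) := by
  have h1 := Real.neg_pi_div_two_lt_arctan ((x - Real.cos a) / Real.sin a)
  have h2 := Real.arctan_lt_pi_div_two ((x - Real.cos a) / Real.sin a)
  constructor <;> unfold boundaryAngle <;> linarith

lemma boundaryAngle_injective {a : ℝ} (ha : Real.sin a ≠ 0) :
    Function.Injective (boundaryAngle a) := by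
  intro x y h
  have h : Real.arctan ((x - Real.cos a) / Real.sin a) =
      Real.arctan ((y - Real.cos a) / Real.sin a) := by
    unfold boundaryAngle at h; linarith
  have := Real.arctan_injective h
  field_simp at this
  linarith

lemma exists_boundaryAngle_eq {a : ℝ} (ha : Real.sin a ≠ 0) {α : ℝ}
    (hα : α ∈ Ioo 0 (2 * Real.pi)) : ∃ x, boundaryAngle a x = α := by
  refine ⟨Real.tan ((α - Real.pi) / 2) * Real.sin a + Real.cos a, ?_⟩
  have : (Real.tan ((α - Real.pi) / 2) * Real.sin a + Real.cos a - Real.cos a) / Real.sin a =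
      Real.tan ((α - Real.pi) / 2) := by field_simp; ring
  rw [boundaryAngle, this, Real.arctan_tan (by linarith [hα.1]) (by linarith [hα.2])]
  ring

lemma hasDerivAt_boundaryAngle {a : ℝ} (ha : Real.sin a ≠ 0) (x : ℝ) :
    HasDerivAt (boundaryAngle a) (2 * Real.sin a / (x ^ 2 - 2 * x * Real.cos a + 1)) x := by
  have h1 : HasDerivAt (fun x : ℝ => (x - Real.cos a) / Real.sin a) (1 / Real.sin a) x :=
    ((hasDerivAt_id x).sub_const _).div_const _
  have h2 := (h1.arctan.const_mul 2).const_add Real.pi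
  refine h2.congr_deriv ?_
  have hcs := Real.sin_sq_add_cos_sq a
  have e : 1 + ((x - Real.cos a) / Real.sin a) ^ 2 =
      (x ^ 2 - 2 * x * Real.cos a + 1) / Real.sin a ^ 2 := by
    field_simp
    nlinarith
  have hpos : 0 < x ^ 2 - 2 * x * Real.cos a + 1 := by
    have : 0 < Real.sin a ^ 2 := by positivity
    nlinarith [sq_nonneg (x - Real.cos a)]
  rw [e]
  field_simp

/-- The substitution `x = ±eᵘ` splits the circle into the preimages of the two edges. There `dα =
sin a / (cosh u ∓ cos a) du`, and `∓cos a ≤ 1` replaces this density by one that depends on `a` only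
through the factor `sin a`. -/
lemma lintegral_boundaryAngle_ge {a : ℝ} (ha : 0 < Real.sin a) (g : ℝ → ℝ≥0∞) :
    ENNReal.ofReal (Real.sin a) *
        ((∫⁻ u, ENNReal.ofReal (1 / (1 + Real.cosh u)) * g (boundaryAngle a (Real.exp u))) +
          ∫⁻ u, ENNReal.ofReal (1 / (1 + Real.cosh u)) * g (boundaryAngle a (-Real.exp u))) ≤
      ∫⁻ α in Ioo 0 (2 * Real.pi), g α := by
  have branch : ∀ σ : ℝ, σ ^ 2 = 1 →
      ENNReal.ofReal (Real.sin a) *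
        (∫⁻ u, ENNReal.ofReal (1 / (1 + Real.cosh u)) * g (boundaryAngle a (σ * Real.exp u))) ≤
      ∫⁻ α in (fun u => boundaryAngle a (σ * Real.exp u)) '' univ, g α := by
    intro σ hσ
    have hσ0 : σ ≠ 0 := by rintro rfl; norm_num at hσ
    have hd : ∀ u : ℝ, HasDerivAt (fun u => boundaryAngle a (σ * Real.exp u))
        (2 * Real.sin a / ((σ * Real.exp u) ^ 2 - 2 * (σ * Real.exp u) * Real.cos a + 1) *
          (σ * Real.exp u)) u := fun u =>
      HasDerivAt.comp (h₂ := boundaryAngle a) (h := fun u => σ * Real.exp u) u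
        (hasDerivAt_boundaryAngle ha.ne' (σ * Real.exp u))
        ((Real.hasDerivAt_exp u).const_mul σ)
    have hinj : InjOn (fun u => boundaryAngle a (σ * Real.exp u)) univ := by
      intro u _ v _ h
      have := boundaryAngle_injective ha.ne' h
      exact Real.exp_injective (mul_left_cancel₀ hσ0 this)
    rw [lintegral_image_eq_lintegral_abs_deriv_mul MeasurableSet.univ
      (fun u _ => (hd u).hasDerivWithinAt) hinj, setLIntegral_univ,
      ← lintegral_const_mul' _ _ ENNReal.ofReal_ne_top]
    refine lintegral_mono fun u => ?_
    rw [← mul_assoc, ← ENNReal.ofReal_mul ha.le]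
    refine mul_le_mul_left (ENNReal.ofReal_le_ofReal ?_) _
    have hE := Real.exp_pos u
    have hEn : Real.exp u * Real.exp (-u) = 1 := by rw [← Real.exp_add]; simp
    have habs : |σ| = 1 := by
      rw [← Real.sqrt_sq_eq_abs, hσ, Real.sqrt_one]
    have hcos := Real.cos_le_one a
    have hcos' := Real.neg_one_le_cos a
    have hsc := Real.sin_sq_add_cos_sq a
    have hσc : -(σ * Real.cos a) ≤ 1 := by
      have : |σ * Real.cos a| ≤ 1 := by rw [abs_mul, habs, one_mul]; exact Real.abs_cos_le_one a
      linarith [(abs_le.mp this).1]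
    have hden : 0 < (σ * Real.exp u) ^ 2 - 2 * (σ * Real.exp u) * Real.cos a + 1 := by
      have : 0 < Real.sin a ^ 2 := by positivity
      nlinarith [sq_nonneg (σ * Real.exp u - Real.cos a)]
    rw [abs_mul, abs_mul, habs, abs_of_pos hE, abs_of_pos (by positivity), mul_one_div, one_mul,
      Real.cosh_eq, div_mul_eq_mul_div,
      div_le_div_iff₀ (by have := Real.exp_pos (-u); positivity) hden, mul_pow, hσ, mul_assoc,
      mul_assoc]
    refine mul_le_mul_of_nonneg_left (a := Real.sin a) ?_ ha.le |>.trans_eq (by ring :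
      Real.sin a * (2 * (Real.exp u * (1 + (Real.exp u + Real.exp (-u)) / 2))) = _)
    nlinarith
  have h1 := branch 1 (by norm_num)
  have h2 := branch (-1) (by norm_num)
  simp only [one_mul, neg_one_mul] at h1 h2
  rw [mul_add]
  refine (add_le_add h1 h2).trans ?_
  have hmeas : MeasurableSet ((fun u => boundaryAngle a (-Real.exp u)) '' univ) := by
    refine MeasurableSet.univ.image_of_continuousOn_injOn (fun u _ => ?_) fun u _ v _ h => ?_
    · refine ContinuousAt.continuousWithinAt ?_
      have h := (hasDerivAt_boundaryAngle ha.ne' (-Real.exp u)).continuousAt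
      exact ContinuousAt.comp (f := fun u : ℝ => -Real.exp u) h (by fun_prop)
    · exact Real.exp_injective (neg_injective (boundaryAngle_injective ha.ne' h))
  have hdisj : Disjoint ((fun u => boundaryAngle a (Real.exp u)) '' univ)
      ((fun u => boundaryAngle a (-Real.exp u)) '' univ) := by
    rw [Set.disjoint_left]
    rintro _ ⟨u, _, rfl⟩ ⟨v, _, hv⟩
    have := boundaryAngle_injective ha.ne' hv
    linarith [Real.exp_pos u, Real.exp_pos v]
  rw [← lintegral_union hmeas hdisj]
  refine lintegral_mono_set ?_
  rintro _ (⟨u, _, rfl⟩ | ⟨u, _, rfl⟩) <;> exact boundaryAngle_mem_Ioo _ _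

/-! ### Jensen's inequality on a strip -/

/-- In Jensen's formula the zeros of an analytic function contribute nonnegatively, so dropping them
leaves the sub-mean-value property of `log |G|`. The shift by `δ` removes the logarithmic
singularities. -/
lemma log_norm_center_le_circleAverage {G : ℂ → ℂ} (hG : DifferentiableOn ℂ G (Metric.ball 0 1))
    (h0 : G 0 ≠ 0) {δ : ℝ} (hδ : 0 < δ) {R : ℝ} (hR0 : 0 < R) (hR1 : R < 1) :
    2 * Real.pi * Real.log ‖G 0‖ ≤
      ∫ α in (0 : ℝ)..(2 * Real.pi), Real.log (‖G (circleMap 0 R α)‖ + δ) := by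
  have hpi := Real.pi_pos
  -- After rescaling, the shift becomes `1`. Then `log |g| ≤ log(|g| + 1)` also holds at zeros under
  -- the convention `log 0 = 0`, whereas `log 0 ≤ log δ` would fail for `δ < 1`.
  set g : ℂ → ℂ := fun z => G z / (δ : ℂ) with hg
  have hsub : Metric.closedBall (0 : ℂ) |R| ⊆ Metric.ball 0 1 := by
    rw [abs_of_pos hR0]; exact Metric.closedBall_subset_ball hR1
  have hgd : DifferentiableOn ℂ g (Metric.ball 0 1) := hG.div_const _
  have hgan : AnalyticOnNhd ℂ g (Metric.closedBall 0 |R|) :=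
    (hgd.analyticOnNhd Metric.isOpen_ball).mono hsub
  have hδ' : (δ : ℂ) ≠ 0 := by exact_mod_cast hδ.ne'
  have hg0 : g 0 ≠ 0 := div_ne_zero h0 hδ'
  have hJ := hgan.circleAverage_log_norm hR0.ne' hg0
  have hnn : 0 ≤ ∑ᶠ u, (MeromorphicOn.divisor g (Metric.closedBall 0 |R|) u : ℝ) *
      Real.log (R * ‖0 - u‖⁻¹) := by
    refine finsum_nonneg fun u => ?_
    by_cases hu : u ∈ Metric.closedBall (0 : ℂ) |R|
    · refine mul_nonneg ?_ ?_
      · exact_mod_cast (MeromorphicOn.AnalyticOnNhd.divisor_nonneg hgan) u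
      · rcases eq_or_ne u 0 with rfl | hu0
        · simp
        · refine Real.log_nonneg ?_
          rw [zero_sub, norm_neg, ← div_eq_mul_inv, one_le_div (norm_pos_iff.mpr hu0)]
          simpa [abs_of_pos hR0] using hu
    · rw [Function.locallyFinsuppWithin.apply_eq_zero_of_notMem _ hu]
      simp
  have hmem : ∀ α, circleMap 0 R α ∈ Metric.ball (0 : ℂ) 1 := fun α => by
    simp [abs_of_pos hR0, hR1]
  have hcont : Continuous fun α => ‖g (circleMap 0 R α)‖ :=
    (hgd.continuousOn.comp_continuous (continuous_circleMap 0 R) hmem).norm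
  have hle : Real.circleAverage (fun z => Real.log ‖g z‖) 0 R ≤
      Real.circleAverage (fun z => Real.log (‖g z‖ + 1)) 0 R := by
    refine Real.circleAverage_mono ?_ ?_ fun z _ => ?_
    · exact MeromorphicOn.circleIntegrable_log_norm
        (hgan.mono Metric.sphere_subset_closedBall).meromorphicOn
    · refine Continuous.intervalIntegrable ?_ _ _
      exact (hcont.add continuous_const).log fun α =>
        (add_pos_of_nonneg_of_pos (norm_nonneg _) one_pos).ne'
    · rcases (norm_nonneg (g z)).eq_or_lt with h | h
      · rw [← h]; simp
      · exact Real.log_le_log h (by linarith)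
  have h1 : Real.log ‖g 0‖ ≤ Real.circleAverage (fun z => Real.log (‖g z‖ + 1)) 0 R := by
    refine le_trans ?_ hle
    change _ ≤ Real.circleAverage (Real.log ‖g ·‖) 0 R
    rw [hJ]
    linarith
  have hlogδ : ∀ x : ℝ, 0 ≤ x → Real.log (x / δ + 1) = Real.log (x + δ) - Real.log δ := by
    intro x hx
    rw [← Real.log_div (by positivity) hδ.ne']
    congr 1
    field_simp
  have hgn : ∀ z, ‖g z‖ = ‖G z‖ / δ := fun z => by
    simp [hg, abs_of_pos hδ]
  have hcont' : Continuous fun α => ‖G (circleMap 0 R α)‖ :=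
    (hG.continuousOn.comp_continuous (continuous_circleMap 0 R) hmem).norm
  rw [Real.circleAverage] at h1
  simp only [hgn, hlogδ _ (norm_nonneg _)] at h1
  have hint : IntervalIntegrable (fun α => Real.log (‖G (circleMap 0 R α)‖ + δ)) volume 0
      (2 * Real.pi) :=
    ((hcont'.add continuous_const).log fun α =>
      (add_pos_of_nonneg_of_pos (norm_nonneg _) hδ).ne').intervalIntegrable _ _
  rw [intervalIntegral.integral_sub hint (by simp),
    intervalIntegral.integral_const, Real.log_div (norm_ne_zero_iff.mpr h0) hδ.ne', smul_eq_mul,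
    smul_eq_mul, inv_mul_eq_div, le_div_iff₀ (by positivity)] at h1
  linarith

/-- Dominated convergence as the radius tends to `1`: with `δ > 0` the integrands stay between `log
δ` and `log(M + δ)`. -/
lemma log_norm_center_le_integral_boundary {G : ℂ → ℂ} {b : ℝ → ℝ} {M : ℝ}
    (hG : DifferentiableOn ℂ G (Metric.ball 0 1)) (hM : ∀ z ∈ Metric.ball (0 : ℂ) 1, ‖G z‖ ≤ M)
    (h0 : G 0 ≠ 0) {δ : ℝ} (hδ : 0 < δ)
    (hb : ∀ᵐ α : ℝ, α ∈ uIoc 0 (2 * Real.pi) →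
      Tendsto (fun R : ℝ => ‖G (circleMap 0 R α)‖) (𝓝[<] 1) (𝓝 (b α)))
    (hb0 : ∀ α, 0 ≤ b α) :
    2 * Real.pi * Real.log ‖G 0‖ ≤ ∫ α in (0 : ℝ)..(2 * Real.pi), Real.log (b α + δ) := by
  have hM0 : 0 ≤ M := (norm_nonneg _).trans (hM 0 (by simp))
  have hev : ∀ᶠ R : ℝ in 𝓝[<] 1, 0 < R ∧ R < 1 := by
    filter_upwards [Ioo_mem_nhdsLT (show (0 : ℝ) < 1 by norm_num)] with R hR using hR
  have hmem : ∀ R : ℝ, 0 < R → R < 1 → ∀ α, circleMap 0 R α ∈ Metric.ball (0 : ℂ) 1 :=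
    fun R h0 h1 α => by simp [abs_of_pos h0, h1]
  have hlim : Tendsto
      (fun R : ℝ => ∫ α in (0 : ℝ)..(2 * Real.pi), Real.log (‖G (circleMap 0 R α)‖ + δ)) (𝓝[<] 1)
      (𝓝 (∫ α in (0 : ℝ)..(2 * Real.pi), Real.log (b α + δ))) := by
    refine intervalIntegral.tendsto_integral_filter_of_dominated_convergence
      (fun _ => max |Real.log δ| |Real.log (M + δ)|) ?_ ?_ (by simp) ?_
    · filter_upwards [hev] with R hR
      refine (Continuous.log ?_ fun α => by positivity).aestronglyMeasurable
      exact (hG.continuousOn.comp_continuous (continuous_circleMap 0 R)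
        (hmem R hR.1 hR.2)).norm.add continuous_const
    · filter_upwards [hev] with R hR
      refine Eventually.of_forall fun α _ => ?_
      refine abs_le_max_abs_abs (Real.log_le_log hδ (by linarith [norm_nonneg (G (circleMap 0 R α))]))
        (Real.log_le_log (by positivity) (by linarith [hM _ (hmem R hR.1 hR.2 α)]))
    · filter_upwards [hb] with α hα hmem
      exact ((hα hmem).add_const δ).log (by have := hb0 α; positivity)
  refine ge_of_tendsto hlim ?_
  filter_upwards [hev] with R hR
  exact log_norm_center_le_circleAverage hG h0 hδ hR.1 hR.2

lemma measurable_stripMap (q a θ : ℝ) : Measurable (stripMap q a θ) := by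
  unfold stripMap halfPlaneMap
  fun_prop

/-- Jensen's inequality for `F ∘ stripMap`. Since `|F| ≤ m` on the edges, the integrand is
nonnegative almost everywhere and the estimate can be stated with a lower Lebesgue integral, ready
for minorizing the density. -/
lemma lintegral_log_div_le_of_strip {q a θ m M δ : ℝ} {F : ℂ → ℂ} (hq : 0 < q) (ha0 : 0 < a)
    (ha1 : a < Real.pi) (hδ : 0 < δ) (hFc : Continuous F)
    (hFd : DifferentiableOn ℂ F {w | w.re ∈ Ioo (-q) 0})
    (hM : ∀ w : ℂ, w.re ∈ Ioo (-q) 0 → ‖F w‖ ≤ M)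
    (hm0 : ∀ t : ℝ, ‖F (t * Complex.I)‖ ≤ m)
    (hm1 : ∀ t : ℝ, ‖F (((-q : ℝ) : ℂ) + t * Complex.I)‖ ≤ m)
    (hne : F (((-(q * a / Real.pi) : ℝ) : ℂ) + θ * Complex.I) ≠ 0) :
    ∫⁻ α in Ioo 0 (2 * Real.pi),
        ENNReal.ofReal (Real.log ((m + δ) / (‖F (stripMap q a θ (circleMap 0 1 α))‖ + δ))) ≤
      ENNReal.ofReal (2 * Real.pi *
        Real.log ((m + δ) / ‖F (((-(q * a / Real.pi) : ℝ) : ℂ) + θ * Complex.I)‖)) := by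
  have hpi := Real.pi_pos
  have hsin : Real.sin a ≠ 0 := (Real.sin_pos_of_pos_of_lt_pi ha0 ha1).ne'
  set b : ℝ → ℝ := fun α => ‖F (stripMap q a θ (circleMap 0 1 α))‖ with hb
  have hm : 0 ≤ m := (norm_nonneg _).trans (hm0 0)
  have hbmeas : Measurable b :=
    (hFc.measurable.comp ((measurable_stripMap q a θ).comp (continuous_circleMap 0 1).measurable)).norm
  -- The two excluded angles correspond to `0` and `∞` on the boundary of the half-plane, that is,
  -- to the two infinite ends of the strip.
  have hnull : ∀ᵐ α : ℝ, α ≠ boundaryAngle a 0 ∧ α ≠ 2 * Real.pi := by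
    filter_upwards [compl_mem_ae_iff.mpr (measure_singleton (boundaryAngle a 0)),
      compl_mem_ae_iff.mpr (measure_singleton (2 * Real.pi))] with α h1 h2
    exact ⟨h1, h2⟩
  have hrep : ∀ α : ℝ, α ≠ boundaryAngle a 0 → α ∈ Ioo 0 (2 * Real.pi) →
      ∃ x, x ≠ 0 ∧ boundaryAngle a x = α := by
    intro α h1 h2
    obtain ⟨x, rfl⟩ := exists_boundaryAngle_eq hsin h2
    exact ⟨x, fun h => h1 (by rw [h]), rfl⟩
  have hbm : ∀ α : ℝ, α ≠ boundaryAngle a 0 → α ∈ Ioo 0 (2 * Real.pi) → b α ≤ m := by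
    intro α h1 h2
    obtain ⟨x, hx, rfl⟩ := hrep α h1 h2
    simp only [hb]
    rcases hx.lt_or_gt with h | h
    · have e : x = -Real.exp (Real.log (-x)) := by rw [Real.exp_log (by linarith)]; ring
      rw [e, stripMap_boundaryAngle_neg_exp hsin]
      exact hm1 _
    · have e : x = Real.exp (Real.log x) := by rw [Real.exp_log h]
      rw [e, stripMap_boundaryAngle_exp hsin]
      exact hm0 _
  have hmaps : ∀ ζ ∈ Metric.ball (0 : ℂ) 1, (stripMap q a θ ζ).re ∈ Ioo (-q) 0 := fun ζ hζ =>
    stripMap_re_mem hq ha0 ha1 (by simpa using hζ)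
  have hJ := log_norm_center_le_integral_boundary (G := fun ζ => F (stripMap q a θ ζ)) (b := b)
    (M := M) (δ := δ) ?_ (fun ζ hζ => hM _ (hmaps ζ hζ)) ?_ hδ ?_ (fun _ => norm_nonneg _)
  · simp only [stripMap_zero ha0 ha1] at hJ
    set n := ‖F (((-(q * a / Real.pi) : ℝ) : ℂ) + θ * Complex.I)‖ with hn
    have hn0 : 0 < n := norm_pos_iff.mpr hne
    have hlogint : IntegrableOn (fun α => Real.log (b α + δ)) (Ioc 0 (2 * Real.pi)) := by
      refine Measure.integrableOn_of_bounded (M := max |Real.log δ| |Real.log (m + δ)|)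
        measure_Ioc_lt_top.ne
        (Real.measurable_log.comp (hbmeas.add_const δ)).aestronglyMeasurable ?_
      rw [ae_restrict_iff' measurableSet_Ioc]
      filter_upwards [hnull] with α hα hα'
      have h1 := hbm α hα.1 ⟨hα'.1, lt_of_le_of_ne hα'.2 hα.2⟩
      have h0 : 0 ≤ b α := norm_nonneg _
      exact abs_le_max_abs_abs (Real.log_le_log hδ (by linarith))
        (Real.log_le_log (by positivity) (by linarith))
    rw [intervalIntegral.integral_of_le (by positivity)] at hJ
    have hΨ : ∀ α, Real.log ((m + δ) / (b α + δ)) = Real.log (m + δ) - Real.log (b α + δ) := by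
      intro α
      have h0 : 0 ≤ b α := norm_nonneg _
      rw [Real.log_div (by positivity) (by positivity)]
    have hΨint : IntegrableOn (fun α => Real.log ((m + δ) / (b α + δ))) (Ioc 0 (2 * Real.pi)) := by
      simp only [hΨ]
      exact Integrable.sub (by simp) hlogint
    rw [setLIntegral_congr Ioo_ae_eq_Ioc, ← ofReal_integral_eq_lintegral_ofReal hΨint]
    · refine ENNReal.ofReal_le_ofReal ?_
      change ∫ α in Ioc 0 (2 * Real.pi), Real.log ((m + δ) / (b α + δ)) ≤ _
      simp only [hΨ]
      rw [integral_sub (by simp) hlogint, Real.log_div (by positivity) hn0.ne']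
      simp [hpi.le]
      nlinarith
    · rw [EventuallyLE, ae_restrict_iff' measurableSet_Ioc]
      filter_upwards [hnull] with α hα hα'
      have h1 := hbm α hα.1 ⟨hα'.1, lt_of_le_of_ne hα'.2 hα.2⟩
      have h0 : 0 ≤ b α := norm_nonneg _
      exact Real.log_nonneg ((one_le_div (by positivity)).mpr (by linarith))
  · refine hFd.comp (fun ζ hζ => ?_) hmaps
    have hζ' : ‖ζ‖ < 1 := by simpa using hζ
    exact (differentiableAt_stripMap (one_sub_ne_zero_of_norm_lt hζ')
      (Or.inl (halfPlaneMap_re_pos ha0 ha1 hζ'))).differentiableWithinAt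
  · simp only [stripMap_zero ha0 ha1]
    exact hne
  · filter_upwards [hnull] with α hα hα'
    rw [uIoc_of_le (by positivity)] at hα'
    obtain ⟨x, hx, rfl⟩ := hrep α hα.1 ⟨hα'.1, lt_of_le_of_ne hα'.2 hα.2⟩
    have hc : ContinuousAt (stripMap q a θ) (circleMap 0 1 (boundaryAngle a x)) :=
      (differentiableAt_stripMap (one_sub_circleMap_boundaryAngle_ne_zero a x)
        (halfPlaneMap_boundaryAngle_mem_slitPlane hsin hx)).continuousAt
    have hR : Tendsto (fun R : ℝ => circleMap 0 R (boundaryAngle a x)) (𝓝[<] 1)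
        (𝓝 (circleMap 0 1 (boundaryAngle a x))) := by
      have : Continuous fun R : ℝ => circleMap 0 R (boundaryAngle a x) := by
        unfold circleMap; fun_prop
      exact (this.tendsto 1).mono_left nhdsWithin_le_nhds
    exact ((hFc.continuousAt.comp hc).tendsto.comp hR).norm

/-- The two-constants estimate for the strip `{-q₀ < Re w < 0}` and `2πi`-periodic boundary data,
with the explicit kernel constant. -/
lemma kernelConst_mul_lintegral_le_log {s a θ m M δ : ℝ} {F : ℂ → ℂ} (hs0 : 0 < s) (hs1 : s < 1)
    (ha0 : 0 < a) (ha1 : a < Real.pi) (hδ : 0 < δ) (hFc : Continuous F)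
    (hFd : DifferentiableOn ℂ F {w | w.re ∈ Ioo (-q0 s) 0})
    (hM : ∀ w : ℂ, w.re ∈ Ioo (-q0 s) 0 → ‖F w‖ ≤ M)
    (hm0 : ∀ t : ℝ, ‖F (t * Complex.I)‖ ≤ m)
    (hm1 : ∀ t : ℝ, ‖F (((-q0 s : ℝ) : ℂ) + t * Complex.I)‖ ≤ m)
    (hper0 : Function.Periodic (fun t : ℝ => F (t * Complex.I)) (2 * Real.pi))
    (hper1 : Function.Periodic (fun t : ℝ => F (((-q0 s : ℝ) : ℂ) + t * Complex.I)) (2 * Real.pi))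
    (hne : F (((-(q0 s * a / Real.pi) : ℝ) : ℂ) + θ * Complex.I) ≠ 0) :
    ENNReal.ofReal (Real.sin a * (2 * Real.pi * kernelConst s)) *
        ((∫⁻ t in Ioc 0 (2 * Real.pi),
            ENNReal.ofReal (Real.log ((m + δ) / (‖F (t * Complex.I)‖ + δ)))) +
          ∫⁻ t in Ioc 0 (2 * Real.pi), ENNReal.ofReal
            (Real.log ((m + δ) / (‖F (((-q0 s : ℝ) : ℂ) + t * Complex.I)‖ + δ)))) ≤
      ENNReal.ofReal (2 * Real.pi *
        Real.log ((m + δ) / ‖F (((-(q0 s * a / Real.pi) : ℝ) : ℂ) + θ * Complex.I)‖)) := by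
  have hq := q0_pos hs0 hs1
  have hsin := Real.sin_pos_of_pos_of_lt_pi ha0 ha1
  refine le_trans ?_ (lintegral_log_div_le_of_strip hq ha0 ha1 hδ hFc hFd hM hm0 hm1 hne)
  refine le_trans ?_ (lintegral_boundaryAngle_ge hsin _)
  simp only [stripMap_boundaryAngle_exp hsin.ne', stripMap_boundaryAngle_neg_exp hsin.ne']
  rw [ENNReal.ofReal_mul hsin.le, mul_assoc]
  refine mul_le_mul_right ?_ _
  rw [mul_add]
  refine add_le_add ?_ ?_
  · refine ofReal_kernelConst_mul_lintegral_le hs0 hs1 (Ψ := fun t : ℝ =>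
      ENNReal.ofReal (Real.log ((m + δ) / (‖F (t * Complex.I)‖ + δ)))) ?_ ?_ θ
    · have := hFc.measurable
      fun_prop
    · intro t
      have := hper0 t
      simp only at this ⊢
      rw [this]
  · refine ofReal_kernelConst_mul_lintegral_le hs0 hs1 (Ψ := fun t : ℝ => ENNReal.ofReal
      (Real.log ((m + δ) / (‖F (((-q0 s : ℝ) : ℂ) + t * Complex.I)‖ + δ)))) ?_ ?_ θ
    · have := hFc.measurable
      fun_prop
    · intro t
      have := hper1 t
      simp only at this ⊢
      rw [this]

/-! ### Boundary values -/

lemma isOpen_annulus (s : ℝ) : IsOpen (annulus s) :=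
  (isOpen_lt continuous_const continuous_norm).inter (isOpen_lt continuous_norm continuous_const)

lemma exp_mem_annulus {s : ℝ} (hs0 : 0 < s) {w : ℂ} (hw : w.re ∈ Ioo (-q0 s) 0) :
    Complex.exp w ∈ annulus s := by
  rw [q0, neg_neg] at hw
  rw [annulus, mem_ofPred_eq, Complex.norm_exp]
  exact ⟨(Real.log_lt_iff_lt_exp hs0).mp hw.1, Real.exp_lt_one_iff.mpr hw.2⟩

lemma circleMap_mem_annulus {s : ℝ} (hs0 : 0 < s) {ρ : ℝ} (hρ : ρ ∈ Ioo s 1) (t : ℝ) :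
    circleMap 0 ρ t ∈ annulus s := by
  rw [annulus, mem_ofPred_eq, norm_circleMap_zero, abs_of_pos (hs0.trans hρ.1)]
  exact hρ

lemma circleMap_eq_exp {ρ : ℝ} (hρ : 0 < ρ) (t : ℝ) :
    circleMap 0 ρ t = Complex.exp (((Real.log ρ : ℝ) : ℂ) + t * Complex.I) := by
  rw [Complex.exp_add, ← Complex.ofReal_exp, Real.exp_log hρ, circleMap, zero_add]

lemma circleMap_exp (x t : ℝ) :
    circleMap 0 (Real.exp x) t = Complex.exp ((x : ℂ) + t * Complex.I) := by
  rw [circleMap_eq_exp (Real.exp_pos x), Real.log_exp]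

lemma log_mem_Ioo {s : ℝ} (hs0 : 0 < s) {ρ : ℝ} (hρ : ρ ∈ Ioo s 1) :
    Real.log ρ ∈ Ioo (-q0 s) 0 := by
  rw [q0, neg_neg]
  exact ⟨Real.log_lt_log hs0 hρ.1, Real.log_neg (hs0.trans hρ.1) hρ.2⟩

/-- A bounded analytic function with bounded derivative, pulled back to the strip by the
exponential, extends continuously. -/
lemma exists_continuous_eq_comp_exp {s : ℝ} (hs0 : 0 < s) {f : ℂ → ℂ}
    (hf : MemHardySobolev 1 s f) :
    ∃ F : ℂ → ℂ, Continuous F ∧ ∀ w : ℂ, w.re ∈ Ioo (-q0 s) 0 → F w = f (Complex.exp w) := by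
  obtain ⟨M, hM⟩ := hf.2 1 le_rfl
  set S : Set ℂ := {w | w.re ∈ Ioo (-q0 s) 0} with hS
  have hconv : Convex ℝ S := (convex_Ioo (-q0 s) 0).is_linear_preimage Complex.reLm.isLinear
  -- The strip, unlike the annulus, is convex, so a derivative bound gives a global Lipschitz
  -- constant; `|e^w| ≤ 1` there keeps it at `M`.
  have hlip : LipschitzOnWith (Real.toNNReal M) (fun w => f (Complex.exp w)) S := by
    refine hconv.lipschitzOnWith_of_nnnorm_hasDerivWithin_le
      (f' := fun w => deriv f (Complex.exp w) * Complex.exp w) (fun w hw => ?_) fun w hw => ?_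
    · have hd : DifferentiableAt ℂ f (Complex.exp w) :=
        hf.1.differentiableAt ((isOpen_annulus s).mem_nhds (exp_mem_annulus hs0 hw))
      exact (HasDerivAt.comp w hd.hasDerivAt (Complex.hasDerivAt_exp w)).hasDerivWithinAt
    · have h1 := hM _ (exp_mem_annulus hs0 hw)
      rw [iteratedDeriv_one] at h1
      have h2 : ‖Complex.exp w‖ ≤ 1 := (exp_mem_annulus hs0 hw).2.le
      rw [← NNReal.coe_le_coe, coe_nnnorm, Real.coe_toNNReal _ ((norm_nonneg _).trans h1), norm_mul]
      nlinarith [norm_nonneg (deriv f (Complex.exp w)), norm_nonneg (Complex.exp w)]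
  obtain ⟨F, hF1, hF2⟩ := hlip.extend_finite_dimension
  exact ⟨F, hF1.continuous, fun w hw => (hF2 hw).symm⟩

section Extension

variable {s : ℝ} {f F : ℂ → ℂ}

lemma differentiableOn_strip (hs0 : 0 < s) (hf : DifferentiableOn ℂ f (annulus s))
    (hF : ∀ w : ℂ, w.re ∈ Ioo (-q0 s) 0 → F w = f (Complex.exp w)) :
    DifferentiableOn ℂ F {w | w.re ∈ Ioo (-q0 s) 0} :=
  (hf.comp Complex.differentiable_exp.differentiableOn fun _ hw => exp_mem_annulus hs0 hw).congr hF

/-- Density of the open strip in the closed one: closed conditions on `F` known inside, such as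
periodicity and norm bounds, pass to the edges. -/
lemma mem_of_isClosed_of_strip (hs0 : 0 < s) (hs1 : s < 1) {C : Set ℂ} (hC : IsClosed C)
    (h : ∀ w : ℂ, w.re ∈ Ioo (-q0 s) 0 → w ∈ C) {w : ℂ} (hw : w.re ∈ Icc (-q0 s) 0) : w ∈ C := by
  have hq := q0_pos hs0 hs1
  refine closure_minimal (s := Complex.re ⁻¹' Ioo (-q0 s) 0) h hC ?_
  rw [Complex.closure_preimage_re, closure_Ioo (by linarith)]
  exact hw

lemma extension_periodic (hs0 : 0 < s) (hs1 : s < 1) (hFc : Continuous F)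
    (hF : ∀ w : ℂ, w.re ∈ Ioo (-q0 s) 0 → F w = f (Complex.exp w)) {x : ℝ}
    (hx : x ∈ Icc (-q0 s) 0) :
    Function.Periodic (fun t : ℝ => F ((x : ℂ) + t * Complex.I)) (2 * Real.pi) := by
  intro t
  have hC : IsClosed {w : ℂ | F (w + 2 * Real.pi * Complex.I) = F w} :=
    isClosed_eq (by fun_prop) hFc
  have := mem_of_isClosed_of_strip hs0 hs1 hC (w := (x : ℂ) + t * Complex.I) (fun w hw => ?_)
    (by simpa using hx)
  · simp only [mem_ofPred_eq] at this
    beta_reduce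
    rw [← this]
    push_cast
    ring_nf
  · simp only [mem_ofPred_eq]
    rw [hF w hw, hF _ (by simpa using hw), Complex.exp_periodic w]

lemma norm_extension_le (hs0 : 0 < s) (hs1 : s < 1) (hFc : Continuous F)
    (hF : ∀ w : ℂ, w.re ∈ Ioo (-q0 s) 0 → F w = f (Complex.exp w)) {M : ℝ}
    (hM : ∀ z ∈ annulus s, ‖f z‖ ≤ M) {w : ℂ} (hw : w.re ∈ Icc (-q0 s) 0) : ‖F w‖ ≤ M :=
  mem_of_isClosed_of_strip hs0 hs1 (C := {w | ‖F w‖ ≤ M})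
    (isClosed_le hFc.norm continuous_const)
    (fun w hw => by rw [mem_ofPred_eq, hF w hw]; exact hM _ (exp_mem_annulus hs0 hw)) hw

lemma log_mem_Icc (hs0 : 0 < s) {r : ℝ} (hr : r ∈ Icc s 1) : Real.log r ∈ Icc (-q0 s) 0 := by
  rw [q0, neg_neg]
  exact ⟨Real.log_le_log hs0 hr.1, Real.log_nonpos (hs0.le.trans hr.1) hr.2⟩

lemma nhdsWithin_Ioo_neBot (hs1 : s < 1) {r : ℝ} (hr : r ∈ Icc s 1) : (𝓝[Ioo s 1] r).NeBot := by
  rw [← mem_closure_iff_nhdsWithin_neBot, closure_Ioo hs1.ne]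
  exact hr

lemma bdryModulus_circleMap (g : ℂ → ℂ) {r : ℝ} (hr : 0 < r) (t : ℝ) :
    bdryModulus s g (circleMap 0 r t) =
      limsup (fun ρ : ℝ => ‖g (circleMap 0 ρ t)‖ₑ) (𝓝[Ioo s 1] r) := by
  have hr' : (r : ℂ) ≠ 0 := by exact_mod_cast hr.ne'
  rw [bdryModulus, norm_circleMap_zero, abs_of_pos hr]
  have : ∀ ρ : ℝ, (ρ : ℂ) * (circleMap 0 r t / (r : ℂ)) = circleMap 0 ρ t := by
    intro ρ
    simp only [circleMap, zero_add]
    field_simp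
  simp only [this]

/-- Continuity of the extension makes the upper limit an actual limit at every boundary point. -/
lemma bdryModulus_eq_enorm (hs0 : 0 < s) (hs1 : s < 1) (hFc : Continuous F)
    (hF : ∀ w : ℂ, w.re ∈ Ioo (-q0 s) 0 → F w = f (Complex.exp w)) {r : ℝ} (hr : r ∈ Icc s 1)
    (t : ℝ) :
    bdryModulus s f (circleMap 0 r t) = ‖F (((Real.log r : ℝ) : ℂ) + t * Complex.I)‖ₑ := by
  have hr0 : 0 < r := hs0.trans_le hr.1
  have := nhdsWithin_Ioo_neBot hs1 hr
  rw [bdryModulus_circleMap f hr0]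
  refine Tendsto.limsup_eq ?_
  have h1 : Tendsto (fun ρ : ℝ => ‖F (((Real.log ρ : ℝ) : ℂ) + t * Complex.I)‖ₑ) (𝓝[Ioo s 1] r)
      (𝓝 ‖F (((Real.log r : ℝ) : ℂ) + t * Complex.I)‖ₑ) := by
    refine Tendsto.mono_left ?_ nhdsWithin_le_nhds
    have : ContinuousAt (fun ρ : ℝ => (((Real.log ρ : ℝ) : ℂ) + t * Complex.I)) r := by
      have := Real.continuousAt_log hr0.ne'
      fun_prop
    exact (continuous_enorm.comp hFc).continuousAt.comp this
  refine h1.congr' ?_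
  filter_upwards [self_mem_nhdsWithin] with ρ hρ
  rw [hF _ (by simpa using log_mem_Ioo hs0 hρ), circleMap_eq_exp (hs0.trans hρ.1)]

end Extension

/-! ### Essential suprema on the boundary circles -/

lemma ae_of_ae_restrict_Ioc_of_periodic {p : ℝ → Prop} {T : ℝ} (hT : 0 < T)
    (hper : ∀ t, p (t + T) ↔ p t) (h : ∀ᵐ t ∂(volume.restrict (Ioc 0 T)), p t) :
    ∀ᵐ t, p t := by
  have hint : ∀ (j : ℤ) t, p (t + j * T) ↔ p t := fun j t => by
    have : Function.Periodic p T := fun t => propext (hper t)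
    exact iff_of_eq (this.int_mul j t)
  rw [← Measure.restrict_univ (μ := (volume : Measure ℝ)), ← iUnion_Ioc_add_zsmul hT 0,
    ae_restrict_iUnion_iff]
  intro j
  rw [ae_restrict_iff' measurableSet_Ioc] at h ⊢
  have h' := (measurePreserving_sub_right (volume : Measure ℝ) (j * T)).quasiMeasurePreserving.ae h
  filter_upwards [h'] with t ht hmem
  rw [← hint j, sub_add_cancel] at ht
  refine ht ?_
  simp only [mem_Ioc, zsmul_eq_mul, Int.cast_add, Int.cast_one] at hmem ⊢
  constructor <;> linarith [hmem.1, hmem.2]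

lemma measurableSet_circ (r : ℝ) : MeasurableSet (circ r) := Metric.isClosed_sphere.measurableSet

lemma circ_subset_bdry {s r : ℝ} (hr : r = s ∨ r = 1) : circ r ⊆ bdry s := by
  rcases hr with rfl | rfl
  · exact subset_union_left
  · exact subset_union_right

lemma norm_of_mem_circ {r : ℝ} {ζ : ℂ} (hζ : ζ ∈ circ r) : ‖ζ‖ = r := by
  simpa [circ] using hζ

lemma norm_mem_Icc_of_mem_bdry {s : ℝ} (hs1 : s < 1) {ζ : ℂ} (hζ : ζ ∈ bdry s) :
    ‖ζ‖ ∈ Icc s 1 := by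
  rcases hζ with h | h <;> rw [norm_of_mem_circ h]
  · exact ⟨le_rfl, hs1.le⟩
  · exact ⟨hs1.le, le_rfl⟩

lemma circleMap_arg_eq {ζ : ℂ} : circleMap 0 ‖ζ‖ ζ.arg = ζ := by
  rw [circleMap, zero_add, Complex.norm_mul_exp_arg_mul_I]

lemma bdryModulus_le {s : ℝ} (hs0 : 0 < s) (hs1 : s < 1) {g : ℂ → ℂ} {M : ℝ}
    (hM : ∀ z ∈ annulus s, ‖g z‖ ≤ M) {ζ : ℂ} (hζ : ζ ∈ bdry s) :
    bdryModulus s g ζ ≤ ENNReal.ofReal M := by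
  have hζ' := norm_mem_Icc_of_mem_bdry hs1 hζ
  have := nhdsWithin_Ioo_neBot hs1 hζ'
  rw [← circleMap_arg_eq (ζ := ζ), bdryModulus_circleMap g (hs0.trans_le hζ'.1)]
  refine limsup_le_of_le (by isBoundedDefault) ?_
  filter_upwards [self_mem_nhdsWithin] with ρ hρ
  rw [← ofReal_norm]
  exact ENNReal.ofReal_le_ofReal (hM _ (circleMap_mem_annulus hs0 hρ _))

lemma essSup_bdryModulus_ne_top {s : ℝ} (hs0 : 0 < s) (hs1 : s < 1) {g : ℂ → ℂ} {M : ℝ}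
    (hM : ∀ z ∈ annulus s, ‖g z‖ ≤ M) {E : Set ℂ} (hE : E ⊆ bdry s) (hEm : MeasurableSet E) :
    essSup (bdryModulus s g) ((bdryMeasure s).restrict E) ≠ ⊤ := by
  refine ne_top_of_le_ne_top ENNReal.ofReal_ne_top (b := ENNReal.ofReal M) ?_
  refine essSup_le_of_ae_le _ ?_
  filter_upwards [ae_restrict_mem hEm] with ζ hζ
  exact bdryModulus_le hs0 hs1 hM (hE hζ)

lemma ae_circMeasure_iff {r : ℝ} {p : ℂ → Prop} (hp : MeasurableSet {ζ | p ζ}) :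
    (∀ᵐ ζ ∂(circMeasure r), p ζ) ↔
      ∀ᵐ t ∂(volume.restrict (Ioc 0 (2 * Real.pi))), p (circleMap 0 r t) := by
  rw [circMeasure, Measure.ae_ennreal_smul_measure_iff (by simp [ENNReal.mul_eq_top]),
    ae_map_iff (continuous_circleMap 0 r).aemeasurable hp]

lemma ae_of_ae_circMeasure {r : ℝ} {p : ℂ → Prop} (h : ∀ᵐ ζ ∂(circMeasure r), p ζ) :
    ∀ᵐ t ∂(volume.restrict (Ioc 0 (2 * Real.pi))), p (circleMap 0 r t) := by
  rw [circMeasure, Measure.ae_ennreal_smul_measure_iff (by simp [ENNReal.mul_eq_top])] at h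
  exact ae_of_ae_map (continuous_circleMap 0 r).aemeasurable h

lemma ae_circMeasure_mem {r : ℝ} (hr : 0 ≤ r) : ∀ᵐ ζ ∂(circMeasure r), ζ ∈ circ r := by
  rw [ae_circMeasure_iff (p := fun ζ => ζ ∈ circ r) (measurableSet_circ r)]
  exact Eventually.of_forall fun t => circleMap_mem_sphere 0 hr t

lemma ae_circMeasure_of_ae_bdryMeasure_restrict {s r : ℝ} (hs0 : 0 < s) (hr : r = s ∨ r = 1)
    {p : ℂ → Prop} (h : ∀ᵐ ζ ∂((bdryMeasure s).restrict (circ r)), p ζ) :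
    ∀ᵐ ζ ∂(circMeasure r), p ζ := by
  have hr0 : 0 ≤ r := by rcases hr with rfl | rfl <;> linarith
  rw [ae_restrict_iff' (measurableSet_circ r), bdryMeasure, ae_add_measure_iff] at h
  have h' : ∀ᵐ ζ ∂(circMeasure r), ζ ∈ circ r → p ζ := by
    rcases hr with rfl | rfl
    · exact h.1
    · exact h.2
  filter_upwards [h', ae_circMeasure_mem hr0] with ζ h1 h2 using h1 h2

lemma ae_bdryModulus_circleMap_le {s : ℝ} (hs0 : 0 < s) (hs1 : s < 1) {g : ℂ → ℂ} {M : ℝ}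
    (hM : ∀ z ∈ annulus s, ‖g z‖ ≤ M) {r : ℝ} (hr : r = s ∨ r = 1) :
    ∀ᵐ t : ℝ, bdryModulus s g (circleMap 0 r t) ≤ ENNReal.ofReal (linfNorm s (circ r) g) := by
  refine ae_of_ae_restrict_Ioc_of_periodic (T := 2 * Real.pi) (by positivity)
    (fun t => by rw [periodic_circleMap 0 r t]) ?_
  refine ae_of_ae_circMeasure (p := fun ζ =>
    bdryModulus s g ζ ≤ ENNReal.ofReal (linfNorm s (circ r) g)) ?_
  refine ae_circMeasure_of_ae_bdryMeasure_restrict hs0 hr ?_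
  filter_upwards [ae_le_essSup (f := bdryModulus s g) (μ := (bdryMeasure s).restrict (circ r))]
    with ζ hζ
  rwa [linfNorm, ENNReal.ofReal_toReal
    (essSup_bdryModulus_ne_top hs0 hs1 hM (circ_subset_bdry hr) (measurableSet_circ r))]

lemma linfNorm_nonneg (s : ℝ) (E : Set ℂ) (f : ℂ → ℂ) : 0 ≤ linfNorm s E f :=
  ENNReal.toReal_nonneg

/-- The essential bound holds on a set of full measure, which is dense; continuity of `F` extends it
to every boundary point. -/
lemma norm_extension_boundary_le {s : ℝ} (hs0 : 0 < s) (hs1 : s < 1) {f F : ℂ → ℂ}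
    (hFc : Continuous F) (hF : ∀ w : ℂ, w.re ∈ Ioo (-q0 s) 0 → F w = f (Complex.exp w)) {M : ℝ}
    (hM : ∀ z ∈ annulus s, ‖f z‖ ≤ M) {r : ℝ} (hr : r = s ∨ r = 1) (t : ℝ) :
    ‖F (((Real.log r : ℝ) : ℂ) + t * Complex.I)‖ ≤ linfNorm s (circ r) f := by
  have hr' : r ∈ Icc s 1 := by rcases hr with rfl | rfl <;> simp [hs1.le]
  have h := ae_bdryModulus_circleMap_le hs0 hs1 hM hr
  have hd : Dense {t : ℝ | bdryModulus s f (circleMap 0 r t) ≤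
      ENNReal.ofReal (linfNorm s (circ r) f)} := Measure.dense_of_ae h
  have hclosed : IsClosed {t : ℝ | ‖F (((Real.log r : ℝ) : ℂ) + t * Complex.I)‖ ≤
      linfNorm s (circ r) f} := isClosed_le (by fun_prop) continuous_const
  have hsub : {t : ℝ | bdryModulus s f (circleMap 0 r t) ≤
      ENNReal.ofReal (linfNorm s (circ r) f)} ⊆ {t : ℝ |
        ‖F (((Real.log r : ℝ) : ℂ) + t * Complex.I)‖ ≤ linfNorm s (circ r) f} := by
    intro t ht
    simp only [mem_ofPred_eq] at ht ⊢
    rw [bdryModulus_eq_enorm hs0 hs1 hFc hF hr', ← ofReal_norm,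
      ENNReal.ofReal_le_ofReal_iff (linfNorm_nonneg _ _ _)] at ht
    exact ht
  have := hclosed.closure_subset_iff.mpr hsub
  rw [hd.closure_eq] at this
  exact this (mem_univ t)

lemma linfNorm_le_of_forall {s : ℝ} {E : Set ℂ} (hE : MeasurableSet E) {f : ℂ → ℂ} {C : ℝ}
    (hC : 0 ≤ C) (h : ∀ ζ ∈ E, bdryModulus s f ζ ≤ ENNReal.ofReal C) : linfNorm s E f ≤ C := by
  refine ENNReal.toReal_le_of_le_ofReal hC (essSup_le_of_ae_le _ ?_)
  filter_upwards [ae_restrict_mem hE] with ζ hζ using h ζ hζ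

/-! ### The maximum principle for the derivative -/

section Derivative

variable {s : ℝ} {f F : ℂ → ℂ}

lemma hasDerivAt_comp_exp_vertical (hs0 : 0 < s) (hf : DifferentiableOn ℂ f (annulus s)) {x : ℝ}
    (hx : x ∈ Ioo (-q0 s) 0) (t : ℝ) :
    HasDerivAt (fun τ : ℝ => f (Complex.exp ((x : ℂ) + τ * Complex.I)))
      (deriv f (Complex.exp ((x : ℂ) + t * Complex.I)) *
        (Complex.exp ((x : ℂ) + t * Complex.I) * Complex.I)) t := by
  have hd : DifferentiableAt ℂ f (Complex.exp ((x : ℂ) + t * Complex.I)) :=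
    hf.differentiableAt ((isOpen_annulus s).mem_nhds (exp_mem_annulus hs0 (by simpa using hx)))
  have h1 : HasDerivAt (fun τ : ℝ => (x : ℂ) + τ * Complex.I) Complex.I t := by
    simpa using ((Complex.ofRealCLM.hasDerivAt (x := t)).mul_const Complex.I).const_add (x : ℂ)
  exact HasDerivAt.comp_of_eq t hd.hasDerivAt h1.cexp rfl

lemma continuous_deriv_comp_circleMap (hs0 : 0 < s) (hf : DifferentiableOn ℂ f (annulus s)) {ρ : ℝ}
    (hρ : ρ ∈ Ioo s 1) : Continuous fun t => deriv f (circleMap 0 ρ t) :=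
  (hf.deriv (isOpen_annulus s)).continuousOn.comp_continuous (continuous_circleMap 0 ρ)
    (circleMap_mem_annulus hs0 hρ)

lemma exp_mem_Ioo (hs0 : 0 < s) {x : ℝ} (hx : x ∈ Ioo (-q0 s) 0) : Real.exp x ∈ Ioo s 1 := by
  have := exp_mem_annulus hs0 (w := (x : ℂ)) (by simpa using hx)
  rw [annulus, mem_ofPred_eq, Complex.norm_exp] at this
  simpa using this

/-- On a vertical line `|e^w|` is constant, so the factor `e^{-w}` exactly cancels the chain-rule
factor in the fundamental theorem of calculus. -/
lemma enorm_extension_sub_le_lintegral (hs0 : 0 < s) (hf : DifferentiableOn ℂ f (annulus s))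
    (hF : ∀ w : ℂ, w.re ∈ Ioo (-q0 s) 0 → F w = f (Complex.exp w)) {x : ℝ}
    (hx : x ∈ Ioo (-q0 s) 0) (t : ℝ) {η : ℝ} (hη : 0 ≤ η) :
    ‖(F ((x : ℂ) + t * Complex.I + η * Complex.I) - F ((x : ℂ) + t * Complex.I)) *
        Complex.exp (-((x : ℂ) + t * Complex.I))‖ₑ ≤
      ∫⁻ τ in Ioc t (t + η), ‖deriv f (circleMap 0 (Real.exp x) τ)‖ₑ := by
  have hcont : Continuous fun τ : ℝ => deriv f (Complex.exp ((x : ℂ) + τ * Complex.I)) *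
        (Complex.exp ((x : ℂ) + τ * Complex.I) * Complex.I) := by
    have := continuous_deriv_comp_circleMap hs0 hf (exp_mem_Ioo hs0 hx)
    simp only [circleMap_exp] at this
    fun_prop
  have hftc := intervalIntegral.integral_eq_sub_of_hasDerivAt (a := t) (b := t + η)
    (fun τ _ => hasDerivAt_comp_exp_vertical hs0 hf hx τ) (hcont.intervalIntegrable _ _)
  rw [hF _ (by simpa using hx), hF _ (by simpa using hx)]
  have e : (x : ℂ) + t * Complex.I + η * Complex.I = (x : ℂ) + ((t + η : ℝ) : ℂ) * Complex.I := by
    push_cast; ring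
  rw [e, ← hftc, intervalIntegral.integral_of_le (by linarith),
    ← MeasureTheory.integral_mul_const]
  refine (enorm_integral_le_lintegral_enorm _).trans (lintegral_mono fun τ => ?_)
  rw [circleMap_exp, ← ofReal_norm, ← ofReal_norm]
  refine ENNReal.ofReal_le_ofReal (le_of_eq ?_)
  rw [norm_mul, norm_mul, norm_mul, Complex.norm_I, mul_one, mul_assoc, Complex.norm_exp,
    Complex.norm_exp, ← Real.exp_add]
  simp

/-- Although `f'` need not extend continuously to the boundary, increments of `F` do. Along a
sequence of radii tending to `r`, the reverse Fatou lemma, dominated by the interior bound `M`,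
transfers the almost everywhere bound on the upper limit of `|f'|` to the boundary increments. -/
lemma norm_extension_sub_mul_exp_boundary_le (hs0 : 0 < s) (hs1 : s < 1)
    (hf : DifferentiableOn ℂ f (annulus s)) {M : ℝ} (hM : ∀ z ∈ annulus s, ‖deriv f z‖ ≤ M)
    (hFc : Continuous F)
    (hF : ∀ w : ℂ, w.re ∈ Ioo (-q0 s) 0 → F w = f (Complex.exp w)) {N : ℝ} (hN0 : 0 ≤ N)
    {r : ℝ} (hr : r ∈ Icc s 1)
    (hN : ∀ᵐ t : ℝ, bdryModulus s (deriv f) (circleMap 0 r t) ≤ ENNReal.ofReal N) (t : ℝ) {η : ℝ}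
    (hη : 0 ≤ η) :
    ‖(F (((Real.log r : ℝ) : ℂ) + t * Complex.I + η * Complex.I) -
        F (((Real.log r : ℝ) : ℂ) + t * Complex.I)) *
        Complex.exp (-(((Real.log r : ℝ) : ℂ) + t * Complex.I))‖ ≤ N * η := by
  have hr0 : 0 < r := hs0.trans_le hr.1
  have hmem : r ∈ closure (Ioo s 1) := by rw [closure_Ioo hs1.ne]; exact hr
  obtain ⟨ρ, hρmem, hρlim⟩ := mem_closure_iff_seq_limit.mp hmem
  have hxlim : Tendsto (fun n => Real.log (ρ n)) atTop (𝓝 (Real.log r)) := hρlim.log hr0.ne'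
  set D : ℝ → ℂ := fun x => (F ((x : ℂ) + t * Complex.I + η * Complex.I) -
    F ((x : ℂ) + t * Complex.I)) * Complex.exp (-((x : ℂ) + t * Complex.I)) with hD
  have hDc : Continuous D := by fun_prop
  have hDlim : Tendsto (fun n => ‖D (Real.log (ρ n))‖ₑ) atTop (𝓝 ‖D (Real.log r)‖ₑ) :=
    ((continuous_enorm.comp hDc).tendsto _).comp hxlim
  have key : ‖D (Real.log r)‖ₑ ≤ ENNReal.ofReal (N * η) := by
    rw [← hDlim.limsup_eq]
    have h1 : ∀ n, ‖D (Real.log (ρ n))‖ₑ ≤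
        ∫⁻ τ in Ioc t (t + η), ‖deriv f (circleMap 0 (ρ n) τ)‖ₑ := by
      intro n
      have := enorm_extension_sub_le_lintegral hs0 hf hF (log_mem_Ioo hs0 (hρmem n)) t hη
      rwa [Real.exp_log (hs0.trans (hρmem n).1)] at this
    refine (limsup_le_limsup (Eventually.of_forall h1)).trans ?_
    refine (limsup_lintegral_le (fun _ => ENNReal.ofReal M) (fun n => ?_) (fun n => ?_) ?_).trans ?_
    · exact (continuous_deriv_comp_circleMap hs0 hf (hρmem n)).enorm.measurable
    · refine Eventually.of_forall fun τ => ?_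
      beta_reduce
      rw [← ofReal_norm]
      exact ENNReal.ofReal_le_ofReal (hM _ (circleMap_mem_annulus hs0 (hρmem n) τ))
    · simp [ENNReal.mul_eq_top]
    · refine (lintegral_mono_ae (g := fun _ => ENNReal.ofReal N)
        ((ae_restrict_of_ae hN).mono fun τ hτ => ?_)).trans ?_
      · refine le_trans ?_ hτ
        rw [bdryModulus_circleMap (deriv f) hr0]
        have htend : Tendsto ρ atTop (𝓝[Ioo s 1] r) :=
          tendsto_nhdsWithin_iff.mpr ⟨hρlim, Eventually.of_forall hρmem⟩
        change limsup ((fun ρ : ℝ => ‖deriv f (circleMap 0 ρ τ)‖ₑ) ∘ ρ) atTop ≤ _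
        rw [limsup_comp]
        exact limsup_le_limsup_of_le htend (by isBoundedDefault) (by isBoundedDefault)
      · rw [lintegral_const, Measure.restrict_apply_univ, Real.volume_Ioc, add_sub_cancel_left,
          ENNReal.ofReal_mul hN0]
  rw [← ofReal_norm] at key
  exact (ENNReal.ofReal_le_ofReal_iff (by positivity)).mp key

/-- The function `(F(w + iη) - F(w)) e^{-w}` is analytic in the strip, continuous and bounded up to
its edges, and at most `Nη` on them, so the Phragmén–Lindelöf principle applies. This acts as a
maximum principle for `f'` without boundary continuity of `f'`. -/
lemma norm_extension_sub_le (hs0 : 0 < s) (hs1 : s < 1) (hf : MemHardySobolev 1 s f)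
    (hFc : Continuous F) (hF : ∀ w : ℂ, w.re ∈ Ioo (-q0 s) 0 → F w = f (Complex.exp w)) {N : ℝ}
    (hN0 : 0 ≤ N)
    (hN : ∀ r, r = s ∨ r = 1 →
      ∀ᵐ t : ℝ, bdryModulus s (deriv f) (circleMap 0 r t) ≤ ENNReal.ofReal N)
    {w : ℂ} (hw : w.re ∈ Icc (-q0 s) 0) {η : ℝ} (hη : 0 ≤ η) :
    ‖F (w + η * Complex.I) - F w‖ ≤ N * η * ‖Complex.exp w‖ := by
  obtain ⟨M, hM⟩ := hf.2 0 (by norm_num)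
  obtain ⟨M', hM'⟩ := hf.2 1 le_rfl
  simp only [iteratedDeriv_zero] at hM
  simp only [iteratedDeriv_one] at hM'
  have hq := q0_pos hs0 hs1
  have hFb := fun {w : ℂ} hw => norm_extension_le hs0 hs1 hFc hF hM (w := w) hw
  have hFd := differentiableOn_strip hs0 hf.1 hF
  set D : ℂ → ℂ := fun w => (F (w + η * Complex.I) - F w) * Complex.exp (-w) with hD
  have hbd : ∀ r, r = s ∨ r = 1 → ∀ z : ℂ, z.re = Real.log r → ‖D z‖ ≤ N * η := by
    intro r hr z hz
    have hr' : r ∈ Icc s 1 := by rcases hr with rfl | rfl <;> simp [hs1.le]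
    have := norm_extension_sub_mul_exp_boundary_le hs0 hs1 hf.1 hM' hFc hF hN0 hr' (hN r hr) z.im hη
    rw [← hz, Complex.re_add_im] at this
    exact this
  have hPL : ‖D w‖ ≤ N * η := by
    -- The function is bounded, so both growth parameters are taken to be `0`.
    refine PhragmenLindelof.vertical_strip (a := -q0 s) (b := 0) (f := D) ⟨?_, ?_⟩
      ⟨0, by rw [zero_sub, neg_neg]; positivity, 0, ?_⟩
      (fun z hz => hbd s (Or.inl rfl) z (by rw [hz, q0, neg_neg]))
      (fun z hz => hbd 1 (Or.inr rfl) z (by rw [hz, Real.log_one])) hw.1 hw.2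
    · refine DifferentiableOn.mul (DifferentiableOn.sub ?_ hFd)
        (Complex.differentiable_exp.comp differentiable_neg).differentiableOn
      exact hFd.comp (by fun_prop) fun z hz => by simpa using hz
    · exact Continuous.continuousOn (by fun_prop)
    · refine Asymptotics.IsBigO.of_bound ((M + M) * Real.exp (q0 s)) ?_
      refine Filter.eventually_inf_principal.mpr (Eventually.of_forall fun z hz => ?_)
      have hz' : z.re ∈ Icc (-q0 s) 0 := Ioo_subset_Icc_self hz
      simp only [zero_mul, Real.exp_zero, norm_one, mul_one]
      rw [hD, norm_mul, Complex.norm_exp]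
      have h1 := hFb hz'
      have h2 := hFb (w := z + η * Complex.I) (by simpa using hz')
      have h3 : ‖F (z + η * Complex.I) - F z‖ ≤ M + M := (norm_sub_le _ _).trans (add_le_add h2 h1)
      have h4 : Real.exp (-z).re ≤ Real.exp (q0 s) := by
        rw [Real.exp_le_exp, Complex.neg_re]; linarith [hz'.1]
      exact mul_le_mul h3 h4 (Real.exp_pos _).le ((norm_nonneg _).trans h3)
  rw [hD, norm_mul, Complex.exp_neg, norm_inv, ← div_eq_mul_inv,
    div_le_iff₀ (norm_pos_iff.mpr (Complex.exp_ne_zero w))] at hPL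
  exact hPL

/-- The increment bound makes `f` Lipschitz in the angle with constant `N |z|`, while the angular
derivative has modulus `|f'(z)| |z|`; the factor `|z|` cancels. -/
lemma norm_deriv_le_of_bdryModulus_le (hs0 : 0 < s) (hs1 : s < 1) (hf : MemHardySobolev 1 s f)
    (hFc : Continuous F) (hF : ∀ w : ℂ, w.re ∈ Ioo (-q0 s) 0 → F w = f (Complex.exp w)) {N : ℝ}
    (hN0 : 0 ≤ N)
    (hN : ∀ r, r = s ∨ r = 1 →
      ∀ᵐ t : ℝ, bdryModulus s (deriv f) (circleMap 0 r t) ≤ ENNReal.ofReal N)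
    {z : ℂ} (hz : z ∈ annulus s) : ‖deriv f z‖ ≤ N := by
  have hz0 : 0 < ‖z‖ := hs0.trans hz.1
  have hx : Real.log ‖z‖ ∈ Ioo (-q0 s) 0 := log_mem_Ioo hs0 hz
  have hexp : Complex.exp (((Real.log ‖z‖ : ℝ) : ℂ) + z.arg * Complex.I) = z := by
    rw [← circleMap_eq_exp hz0, circleMap_arg_eq]
  have hd := hasDerivAt_comp_exp_vertical hs0 hf.1 hx z.arg
  rw [hexp] at hd
  have hle : ∀ t t' : ℝ, t ≤ t' →
      ‖f (Complex.exp (((Real.log ‖z‖ : ℝ) : ℂ) + t' * Complex.I)) -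
        f (Complex.exp (((Real.log ‖z‖ : ℝ) : ℂ) + t * Complex.I))‖ ≤ N * ‖z‖ * (t' - t) := by
    intro t t' htt
    have h := norm_extension_sub_le hs0 hs1 hf hFc hF hN0 hN
      (w := ((Real.log ‖z‖ : ℝ) : ℂ) + t * Complex.I) (by simpa using Ioo_subset_Icc_self hx)
      (sub_nonneg.mpr htt)
    rw [hF _ (by simpa using hx), hF _ (by simpa using hx), Complex.norm_exp] at h
    have e : ((Real.log ‖z‖ : ℝ) : ℂ) + t * Complex.I + ((t' - t : ℝ) : ℂ) * Complex.I =
        ((Real.log ‖z‖ : ℝ) : ℂ) + t' * Complex.I := by push_cast; ring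
    rw [e] at h
    refine h.trans_eq ?_
    have : (((Real.log ‖z‖ : ℝ) : ℂ) + t * Complex.I).re = Real.log ‖z‖ := by simp
    rw [this, Real.exp_log hz0]
    ring
  have hlip := hd.le_of_lip' (C := N * ‖z‖) (by positivity) <| Eventually.of_forall fun t => by
    rcases le_total t z.arg with h | h
    · rw [norm_sub_rev, norm_sub_rev t, Real.norm_of_nonneg (by linarith)]
      exact hle _ _ h
    · rw [Real.norm_of_nonneg (by linarith)]
      exact hle _ _ h
  rw [norm_mul, norm_mul, Complex.norm_I, mul_one] at hlip
  exact le_of_mul_le_mul_right hlip hz0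

/-- The mean value inequality along a radius, followed by passage to the boundary endpoint. -/
lemma norm_extension_boundary_sub_le (hs0 : 0 < s) (hs1 : s < 1)
    (hf : DifferentiableOn ℂ f (annulus s)) (hFc : Continuous F)
    (hF : ∀ w : ℂ, w.re ∈ Ioo (-q0 s) 0 → F w = f (Complex.exp w)) {N : ℝ}
    (hN : ∀ z ∈ annulus s, ‖deriv f z‖ ≤ N) {r : ℝ} (hr : r ∈ Icc s 1) {ρ : ℝ} (hρ : ρ ∈ Ioo s 1)
    (t : ℝ) :
    ‖F (((Real.log r : ℝ) : ℂ) + t * Complex.I) - f (circleMap 0 ρ t)‖ ≤ N * |r - ρ| := by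
  have hr0 : 0 < r := hs0.trans_le hr.1
  have hne := nhdsWithin_Ioo_neBot hs1 hr
  have hint : ∀ ρ' ∈ Ioo s 1, ‖f (circleMap 0 ρ' t) - f (circleMap 0 ρ t)‖ ≤ N * ‖ρ' - ρ‖ := by
    intro ρ' hρ'
    refine (convex_Ioo s 1).norm_image_sub_le_of_norm_hasDerivWithin_le
      (f := fun ρ : ℝ => f (circleMap 0 ρ t))
      (f' := fun ρ : ℝ => deriv f (circleMap 0 ρ t) * Complex.exp (t * Complex.I)) (fun x hx => ?_)
      (fun x hx => ?_) hρ hρ'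
    · have hd : DifferentiableAt ℂ f (circleMap 0 x t) :=
        hf.differentiableAt ((isOpen_annulus s).mem_nhds (circleMap_mem_annulus hs0 hx t))
      have h1 : HasDerivAt (fun ρ : ℝ => circleMap 0 ρ t) (Complex.exp (t * Complex.I)) x := by
        simpa [circleMap] using
          (Complex.ofRealCLM.hasDerivAt (x := x)).mul_const (Complex.exp (t * Complex.I))
      exact (HasDerivAt.comp_of_eq x hd.hasDerivAt h1 rfl).hasDerivWithinAt
    · rw [norm_mul, Complex.norm_exp_ofReal_mul_I, mul_one]
      exact hN _ (circleMap_mem_annulus hs0 hx t)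
  have hlim : Tendsto (fun ρ' : ℝ => ‖F (((Real.log ρ' : ℝ) : ℂ) + t * Complex.I) -
      f (circleMap 0 ρ t)‖) (𝓝[Ioo s 1] r)
      (𝓝 ‖F (((Real.log r : ℝ) : ℂ) + t * Complex.I) - f (circleMap 0 ρ t)‖) := by
    refine Tendsto.mono_left ?_ nhdsWithin_le_nhds
    have h1 : ContinuousAt (fun ρ : ℝ => (((Real.log ρ : ℝ) : ℂ) + t * Complex.I)) r := by
      have := Real.continuousAt_log hr0.ne'
      fun_prop
    exact ((ContinuousAt.comp (f := fun ρ : ℝ => (((Real.log ρ : ℝ) : ℂ) + t * Complex.I))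
      hFc.continuousAt h1).sub continuousAt_const).norm
  have hlim2 : Tendsto (fun ρ' : ℝ => N * ‖ρ' - ρ‖) (𝓝[Ioo s 1] r) (𝓝 (N * ‖r - ρ‖)) :=
    (Continuous.tendsto (by fun_prop) r).mono_left nhdsWithin_le_nhds
  refine le_of_tendsto_of_tendsto hlim hlim2 ?_
  filter_upwards [self_mem_nhdsWithin] with ρ' hρ'
  rw [hF _ (by simpa using log_mem_Ioo hs0 hρ'), ← circleMap_eq_exp (hs0.trans hρ'.1)]
  exact hint ρ' hρ'

end Derivative

/-! ### The two-constants estimate on the annulus -/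

lemma lintegral_circMeasure {r : ℝ} {h : ℂ → ℝ≥0∞} (hh : Measurable h) :
    ENNReal.ofReal (2 * Real.pi) * ∫⁻ ζ, h ζ ∂(circMeasure r) =
      ∫⁻ t in Ioc 0 (2 * Real.pi), h (circleMap 0 r t) := by
  have hpos : ENNReal.ofReal (2 * Real.pi) ≠ 0 := by simp [Real.pi_pos]
  rw [circMeasure, lintegral_smul_measure, lintegral_map hh (continuous_circleMap 0 r).measurable,
    smul_eq_mul, ← mul_assoc, ENNReal.mul_inv_cancel hpos ENNReal.ofReal_ne_top, one_mul]

lemma circMeasure_univ (r : ℝ) : circMeasure r univ = 1 := by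
  have h := lintegral_circMeasure (r := r) (h := fun _ => 1) measurable_const
  have hpos : ENNReal.ofReal (2 * Real.pi) ≠ 0 := by simp [Real.pi_pos]
  rw [lintegral_one, lintegral_one, Measure.restrict_apply_univ, Real.volume_Ioc, sub_zero] at h
  exact (ENNReal.mul_eq_left hpos ENNReal.ofReal_ne_top).mp h

instance (r : ℝ) : IsProbabilityMeasure (circMeasure r) := ⟨circMeasure_univ r⟩

instance (s : ℝ) : IsFiniteMeasure (bdryMeasure s) := by
  unfold bdryMeasure; infer_instance

lemma IsBdryArc.measurableSet {s : ℝ} {I : Set ℂ} (hI : IsBdryArc s I) : MeasurableSet I := by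
  obtain ⟨-, U, hU, rfl⟩ := hI
  exact hU.measurableSet.inter ((measurableSet_circ s).union (measurableSet_circ 1))

lemma IsBdryArc.subset {s : ℝ} {I : Set ℂ} (hI : IsBdryArc s I) : I ⊆ bdry s := by
  obtain ⟨-, U, hU, rfl⟩ := hI
  exact inter_subset_right

/-- If the arc were null, the parameters avoiding `U` would be dense, contradicting that those
mapped into `U` form a nonempty open set. -/
lemma IsBdryArc.arcFraction_pos {s : ℝ} (hs0 : 0 < s) (hs1 : s < 1) {I : Set ℂ}
    (hI : IsBdryArc s I) : 0 < arcFraction s I := by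
  have hImeas := hI.measurableSet
  obtain ⟨⟨⟨ζ, hζ⟩, -⟩, U, hU, rfl⟩ := hI
  refine ENNReal.toReal_pos (fun h0 => ?_) (measure_ne_top _ _)
  obtain ⟨r, hr, hζr⟩ : ∃ r, (r = s ∨ r = 1) ∧ ζ ∈ circ r := by
    rcases hζ.2 with h | h
    · exact ⟨s, Or.inl rfl, h⟩
    · exact ⟨1, Or.inr rfl, h⟩
  have hr0 : 0 ≤ r := by rcases hr with rfl | rfl <;> linarith
  have hcirc : circMeasure r (U ∩ bdry s) = 0 := by
    have h0' : circMeasure s (U ∩ bdry s) + circMeasure 1 (U ∩ bdry s) = 0 := by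
      rw [bdryMeasure] at h0; simpa using h0
    rcases hr with rfl | rfl
    · exact (add_eq_zero.mp h0').1
    · exact (add_eq_zero.mp h0').2
  have hae : ∀ᵐ t : ℝ, circleMap 0 r t ∉ U := by
    refine ae_of_ae_restrict_Ioc_of_periodic (T := 2 * Real.pi) (by positivity)
      (fun t => by rw [periodic_circleMap 0 r t]) ?_
    have h1 : ∀ᵐ ζ ∂(circMeasure r), ζ ∉ U ∩ bdry s := measure_eq_zero_iff_ae_notMem.mp hcirc
    filter_upwards [ae_of_ae_circMeasure h1] with t ht htU
    exact ht ⟨htU, circ_subset_bdry hr (circleMap_mem_sphere 0 hr0 t)⟩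
  have hd : Dense {t : ℝ | circleMap 0 r t ∉ U} := Measure.dense_of_ae hae
  obtain ⟨t, ht1, ht2⟩ := hd.exists_mem_open (hU.preimage (continuous_circleMap 0 r))
    ⟨ζ.arg, by
      rw [mem_preimage, ← norm_of_mem_circ hζr, circleMap_arg_eq]; exact hζ.1⟩
  exact ht1 ht2

/-- Jensen's inequality for `-log`, via the tangent line at the mean: `log(k + δ) ≤ log(ε + δ) + (k
+ δ)/(ε + δ) - 1`, whose last two terms together integrate to zero. -/
lemma mul_log_div_le_integral_log_div {X : Type*} [MeasurableSpace X] {μ : Measure X}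
    [IsFiniteMeasure μ] {k : X → ℝ} (hk : Measurable k) {m δ : ℝ} (hδ : 0 < δ)
    (hk0 : ∀ᵐ x ∂μ, 0 ≤ k x) (hkm : ∀ᵐ x ∂μ, k x ≤ m) (hμ : 0 < μ.real univ)
    {ε : ℝ} (hε : ε = (μ.real univ)⁻¹ * ∫ x, k x ∂μ) :
    μ.real univ * Real.log ((m + δ) / (ε + δ)) ≤ ∫ x, Real.log ((m + δ) / (k x + δ)) ∂μ := by
  have hkint : Integrable k μ := by
    refine Integrable.of_bound hk.aestronglyMeasurable m ?_
    filter_upwards [hk0, hkm] with x h0 h1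
    rwa [Real.norm_of_nonneg h0]
  have hε0 : 0 ≤ ε := by
    rw [hε]; exact mul_nonneg (inv_nonneg.mpr hμ.le) (integral_nonneg_of_ae hk0)
  have hm : 0 ≤ m := by
    have : NeZero μ := ⟨by rintro rfl; simp at hμ⟩
    obtain ⟨x, h0, h1⟩ := (hk0.and hkm).exists
    exact h0.trans h1
  have hint : Integrable (fun x => Real.log ((m + δ) / (k x + δ))) μ := by
    refine Integrable.of_bound
      (Real.measurable_log.comp (measurable_const.div (hk.add_const δ))).aestronglyMeasurable
      (Real.log ((m + δ) / δ)) ?_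
    filter_upwards [hk0, hkm] with x h0 h1
    rw [Real.norm_of_nonneg (Real.log_nonneg ((one_le_div (by linarith)).mpr (by linarith)))]
    refine Real.log_le_log (by positivity) ?_
    gcongr
    linarith
  have i1 : Integrable (fun x => k x + δ) μ := hkint.add (integrable_const _)
  have i2 : Integrable (fun x => (ε + δ)⁻¹ * (k x + δ)) μ := i1.const_mul _
  have i3 : Integrable (fun x => 1 - (ε + δ)⁻¹ * (k x + δ)) μ := (integrable_const _).sub i2
  have hle : ∫ x, (Real.log ((m + δ) / (ε + δ)) + (1 - (ε + δ)⁻¹ * (k x + δ))) ∂μ ≤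
      ∫ x, Real.log ((m + δ) / (k x + δ)) ∂μ := by
    refine integral_mono_ae ?_ hint ?_
    · exact (integrable_const _).add i3
    · filter_upwards [hk0] with x h0
      have h1 : Real.log ((k x + δ) / (ε + δ)) ≤ (k x + δ) / (ε + δ) - 1 :=
        Real.log_le_sub_one_of_pos (by positivity)
      rw [Real.log_div (by positivity) (by positivity)] at h1 ⊢
      rw [Real.log_div (by positivity) (by positivity), inv_mul_eq_div]
      linarith
  refine le_trans (le_of_eq ?_) hle
  have hI : ∫ x, k x ∂μ = μ.real univ * ε := by
    rw [hε, ← mul_assoc, mul_inv_cancel₀ hμ.ne', one_mul]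
  rw [integral_add (integrable_const _) i3, integral_sub (integrable_const _) i2,
    integral_const_mul, integral_add hkint (integrable_const _), hI, integral_const, integral_const,
    integral_const, smul_eq_mul, smul_eq_mul, smul_eq_mul]
  field_simp
  ring

section TwoConstants

variable {s : ℝ} {f F : ℂ → ℂ}

lemma norm_extension_le_of_boundary (hs0 : 0 < s) (hs1 : s < 1)
    (hf : DifferentiableOn ℂ f (annulus s)) {M : ℝ} (hM : ∀ z ∈ annulus s, ‖f z‖ ≤ M)
    (hFc : Continuous F)
    (hF : ∀ w : ℂ, w.re ∈ Ioo (-q0 s) 0 → F w = f (Complex.exp w)) {m : ℝ}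
    (hm : ∀ r, r = s ∨ r = 1 → ∀ t : ℝ, ‖F (((Real.log r : ℝ) : ℂ) + t * Complex.I)‖ ≤ m)
    {w : ℂ} (hw : w.re ∈ Icc (-q0 s) 0) : ‖F w‖ ≤ m := by
  have hq := q0_pos hs0 hs1
  have hbd : ∀ r, r = s ∨ r = 1 → ∀ z : ℂ, z.re = Real.log r → ‖F z‖ ≤ m := by
    intro r hr z hz
    have := hm r hr z.im
    rwa [← hz, Complex.re_add_im] at this
  refine PhragmenLindelof.vertical_strip (a := -q0 s) (b := 0) (f := F)
    ⟨differentiableOn_strip hs0 hf hF, hFc.continuousOn⟩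
    ⟨0, by rw [zero_sub, neg_neg]; positivity, 0, ?_⟩
    (fun z hz => hbd s (Or.inl rfl) z (by rw [hz, q0, neg_neg]))
    (fun z hz => hbd 1 (Or.inr rfl) z (by rw [hz, Real.log_one])) hw.1 hw.2
  refine Asymptotics.IsBigO.of_bound M ?_
  refine Filter.eventually_inf_principal.mpr (Eventually.of_forall fun z hz => ?_)
  simp only [zero_mul, Real.exp_zero, norm_one, mul_one]
  exact norm_extension_le hs0 hs1 hFc hF hM (Ioo_subset_Icc_self hz)

/-- This supplies an evidently measurable representative, `ζ ↦ ‖F (log ζ)‖`, of the boundary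
modulus. -/
lemma bdryModulus_eq_ofReal (hs0 : 0 < s) (hs1 : s < 1) (hFc : Continuous F)
    (hF : ∀ w : ℂ, w.re ∈ Ioo (-q0 s) 0 → F w = f (Complex.exp w)) {ζ : ℂ} (hζ : ζ ∈ bdry s) :
    bdryModulus s f ζ = ENNReal.ofReal ‖F (Complex.log ζ)‖ := by
  have h := bdryModulus_eq_enorm hs0 hs1 hFc hF (norm_mem_Icc_of_mem_bdry hs1 hζ) ζ.arg
  rw [circleMap_arg_eq] at h
  rw [h, ofReal_norm]
  rfl

/-- The principal logarithm may differ from `log r + it` by a multiple of `2πi`; both values of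
`‖F‖` compute the same boundary modulus, so the branch does not matter. -/
lemma norm_extension_log_circleMap (hs0 : 0 < s) (hs1 : s < 1) (hFc : Continuous F)
    (hF : ∀ w : ℂ, w.re ∈ Ioo (-q0 s) 0 → F w = f (Complex.exp w)) {r : ℝ}
    (hr : r = s ∨ r = 1) (t : ℝ) :
    ‖F (Complex.log (circleMap 0 r t))‖ = ‖F (((Real.log r : ℝ) : ℂ) + t * Complex.I)‖ := by
  have hr' : r ∈ Icc s 1 := by rcases hr with rfl | rfl <;> simp [hs1.le]
  have h1 := bdryModulus_eq_ofReal hs0 hs1 hFc hF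
    (circ_subset_bdry hr (circleMap_mem_sphere 0 (hs0.le.trans hr'.1) t))
  rw [bdryModulus_eq_enorm hs0 hs1 hFc hF hr', ← ofReal_norm] at h1
  exact ((ENNReal.ofReal_eq_ofReal_iff (norm_nonneg _) (norm_nonneg _)).mp h1).symm

lemma l1Norm_eq (hs0 : 0 < s) (hs1 : s < 1) (hFc : Continuous F)
    (hF : ∀ w : ℂ, w.re ∈ Ioo (-q0 s) 0 → F w = f (Complex.exp w)) {I : Set ℂ}
    (hI : IsBdryArc s I) :
    l1Norm s I f = (((bdryMeasure s).restrict I).real univ)⁻¹ *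
      ∫ ζ in I, ‖F (Complex.log ζ)‖ ∂(bdryMeasure s) := by
  rw [l1Norm, arcFraction, measureReal_restrict_apply_univ, measureReal_def]
  congr 1
  rw [integral_eq_lintegral_of_nonneg_ae (Eventually.of_forall fun _ => norm_nonneg _)
    (show Measurable fun ζ => ‖F (Complex.log ζ)‖ from
      (hFc.measurable.comp Complex.measurable_log).norm).aestronglyMeasurable]
  congr 1
  exact setLIntegral_congr_fun hI.measurableSet fun ζ hζ =>
    bdryModulus_eq_ofReal hs0 hs1 hFc hF (hI.subset hζ)

lemma sin_mul_log_div_le (hs0 : 0 < s) (hs1 : s < 1) (hf : DifferentiableOn ℂ f (annulus s))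
    {M : ℝ} (hM : ∀ z ∈ annulus s, ‖f z‖ ≤ M) (hFc : Continuous F)
    (hF : ∀ w : ℂ, w.re ∈ Ioo (-q0 s) 0 → F w = f (Complex.exp w)) {m : ℝ}
    (hm : ∀ r, r = s ∨ r = 1 → ∀ t : ℝ, ‖F (((Real.log r : ℝ) : ℂ) + t * Complex.I)‖ ≤ m)
    {I : Set ℂ} (hI : IsBdryArc s I) {δ : ℝ} (hδ : 0 < δ) {ρ : ℝ} (hρ : ρ ∈ Ioo s 1) (t : ℝ)
    (hne : f (circleMap 0 ρ t) ≠ 0) :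
    Real.sin (Real.pi * -Real.log ρ / q0 s) * (2 * Real.pi * kernelConst s * arcFraction s I) *
        Real.log ((m + δ) / (l1Norm s I f + δ)) ≤
      Real.log ((m + δ) / ‖f (circleMap 0 ρ t)‖) := by
  have hpi := Real.pi_pos
  have hq := q0_pos hs0 hs1
  have hC := kernelConst_pos hs0 hs1
  have hlog := log_mem_Ioo hs0 hρ
  have hlogs : Real.log s = -q0 s := by rw [q0, neg_neg]
  -- This choice sends the centre of the disc to `log ρ + it`, since `-q₀ a / π = log ρ`.
  set a := Real.pi * -Real.log ρ / q0 s with ha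
  have ha0 : 0 < a := div_pos (mul_pos hpi (neg_pos.mpr hlog.2)) hq
  have ha1 : a < Real.pi := by
    rw [ha, div_lt_iff₀ hq]
    exact mul_lt_mul_of_pos_left (by linarith [hlog.1]) hpi
  have hsin := Real.sin_pos_of_pos_of_lt_pi ha0 ha1
  have hw0 : ((-(q0 s * a / Real.pi) : ℝ) : ℂ) + t * Complex.I =
      ((Real.log ρ : ℝ) : ℂ) + t * Complex.I := by
    congr 2
    rw [ha]
    field_simp
  have hval : F (((-(q0 s * a / Real.pi) : ℝ) : ℂ) + t * Complex.I) = f (circleMap 0 ρ t) := by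
    rw [hw0, hF _ (by simpa using hlog), circleMap_eq_exp (hs0.trans hρ.1)]
  have hper := fun {x : ℝ} hx => extension_periodic hs0 hs1 hFc hF (x := x) hx
  have hm0 : ∀ t : ℝ, ‖F (t * Complex.I)‖ ≤ m := fun t => by
    simpa using hm 1 (Or.inr rfl) t
  have hm1 : ∀ t : ℝ, ‖F (((-q0 s : ℝ) : ℂ) + t * Complex.I)‖ ≤ m := fun t => by
    have := hm s (Or.inl rfl) t
    rwa [hlogs] at this
  have hnorm : ‖f (circleMap 0 ρ t)‖ ≤ m := by
    rw [← hval, hw0]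
    exact norm_extension_le_of_boundary hs0 hs1 hf hM hFc hF hm
      (by simpa using Ioo_subset_Icc_self hlog)
  have hfpos : 0 < ‖f (circleMap 0 ρ t)‖ := norm_pos_iff.mpr hne
  have hRnn : 0 ≤ Real.log ((m + δ) / ‖f (circleMap 0 ρ t)‖) :=
    Real.log_nonneg ((one_le_div hfpos).mpr (by linarith))
  have hTC := kernelConst_mul_lintegral_le_log (θ := t) hs0 hs1 ha0 ha1 hδ hFc
    (differentiableOn_strip hs0 hf hF)
    (fun w hw => norm_extension_le hs0 hs1 hFc hF hM (Ioo_subset_Icc_self hw)) hm0 hm1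
    (by simpa using hper (x := 0) ⟨by linarith, le_rfl⟩)
    (hper (x := -q0 s) ⟨le_rfl, by linarith⟩) (by rw [hval]; exact hne)
  rw [hval] at hTC
  set k : ℂ → ℝ := fun ζ => ‖F (Complex.log ζ)‖ with hk
  have hkmeas : Measurable k := (hFc.measurable.comp Complex.measurable_log).norm
  have hψ : Measurable fun ζ => ENNReal.ofReal (Real.log ((m + δ) / (k ζ + δ))) := by fun_prop
  have hl : ENNReal.ofReal (2 * Real.pi) *
      ∫⁻ ζ, ENNReal.ofReal (Real.log ((m + δ) / (k ζ + δ))) ∂(bdryMeasure s) =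
      (∫⁻ t in Ioc 0 (2 * Real.pi),
            ENNReal.ofReal (Real.log ((m + δ) / (‖F (t * Complex.I)‖ + δ)))) +
          ∫⁻ t in Ioc 0 (2 * Real.pi), ENNReal.ofReal
            (Real.log ((m + δ) / (‖F (((-q0 s : ℝ) : ℂ) + t * Complex.I)‖ + δ))) := by
    rw [bdryMeasure, lintegral_add_measure, mul_add, lintegral_circMeasure hψ,
      lintegral_circMeasure hψ, add_comm]
    simp only [hk, norm_extension_log_circleMap hs0 hs1 hFc hF (Or.inl rfl),
      norm_extension_log_circleMap hs0 hs1 hFc hF (Or.inr rfl), hlogs, Real.log_one,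
      Complex.ofReal_zero, zero_add]
  rw [← hl] at hTC
  have hkI : ∀ᵐ ζ ∂((bdryMeasure s).restrict I), k ζ ≤ m := by
    filter_upwards [ae_restrict_mem hI.measurableSet] with ζ hζ
    refine norm_extension_le_of_boundary hs0 hs1 hf hM hFc hF hm ?_
    rw [Complex.log_re]
    exact log_mem_Icc hs0 (norm_mem_Icc_of_mem_bdry hs1 (hI.subset hζ))
  have hlam : ((bdryMeasure s).restrict I).real univ = arcFraction s I := by
    rw [measureReal_restrict_apply_univ]; rfl
  have hlam0 := hI.arcFraction_pos hs0 hs1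
  have hJ := mul_log_div_le_integral_log_div hkmeas hδ
    (Eventually.of_forall fun _ => norm_nonneg _) hkI (by rw [hlam]; exact hlam0)
    (l1Norm_eq hs0 hs1 hFc hF hI)
  rw [hlam] at hJ
  have hJ' : ENNReal.ofReal (arcFraction s I * Real.log ((m + δ) / (l1Norm s I f + δ))) ≤
      ∫⁻ ζ, ENNReal.ofReal (Real.log ((m + δ) / (k ζ + δ))) ∂(bdryMeasure s) := by
    refine (ENNReal.ofReal_le_ofReal hJ).trans ?_
    -- The integrand is nonnegative after `ENNReal.ofReal`, so the part of the boundary outside `I`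
    -- is discarded.
    refine le_trans ?_ (setLIntegral_le_lintegral I _)
    by_cases hint : Integrable (fun ζ => Real.log ((m + δ) / (k ζ + δ)))
        ((bdryMeasure s).restrict I)
    · rw [ofReal_integral_eq_lintegral_ofReal hint]
      filter_upwards [hkI] with ζ hζ
      have : 0 ≤ k ζ := norm_nonneg _
      exact Real.log_nonneg ((one_le_div (by positivity)).mpr (by linarith))
    · rw [integral_undef hint]; simp
  have hfin : ENNReal.ofReal ((Real.sin a * (2 * Real.pi * kernelConst s)) * (2 * Real.pi *
      (arcFraction s I * Real.log ((m + δ) / (l1Norm s I f + δ))))) ≤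
      ENNReal.ofReal (2 * Real.pi * Real.log ((m + δ) / ‖f (circleMap 0 ρ t)‖)) := by
    refine le_trans ?_ hTC
    rw [ENNReal.ofReal_mul (p := Real.sin a * (2 * Real.pi * kernelConst s)) (by positivity),
      ENNReal.ofReal_mul (p := 2 * Real.pi) (by positivity)]
    gcongr
  rw [ENNReal.ofReal_le_ofReal_iff (by positivity)] at hfin
  have : 2 * Real.pi * (Real.sin a * (2 * Real.pi * kernelConst s * arcFraction s I) *
        Real.log ((m + δ) / (l1Norm s I f + δ))) ≤
      2 * Real.pi * Real.log ((m + δ) / ‖f (circleMap 0 ρ t)‖) := by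
    refine le_trans (le_of_eq ?_) hfin
    ring
  exact le_of_mul_le_mul_left this (by positivity)

lemma l1Norm_nonneg (s : ℝ) (I : Set ℂ) (f : ℂ → ℂ) : 0 ≤ l1Norm s I f :=
  mul_nonneg (inv_nonneg.mpr ENNReal.toReal_nonneg) ENNReal.toReal_nonneg

lemma sin_pi_mul_neg_log_div_pos (hs0 : 0 < s) (hs1 : s < 1) {ρ : ℝ} (hρ : ρ ∈ Ioo s 1) :
    0 < Real.sin (Real.pi * -Real.log ρ / q0 s) := by
  have hpi := Real.pi_pos
  have hq := q0_pos hs0 hs1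
  have hlog := log_mem_Ioo hs0 hρ
  refine Real.sin_pos_of_pos_of_lt_pi (div_pos (mul_pos hpi (neg_pos.mpr hlog.2)) hq) ?_
  rw [div_lt_iff₀ hq]
  exact mul_lt_mul_of_pos_left (by linarith [hlog.1]) hpi

/-- Let `δ → 0⁺`. If the `L¹` mean vanished, the left side would tend to infinity while the right
side converges; this is the uniqueness statement that makes `log ε` meaningful. -/
lemma l1Norm_pos_and_log_norm_le (hs0 : 0 < s) (hs1 : s < 1)
    (hf : DifferentiableOn ℂ f (annulus s))
    {M : ℝ} (hM : ∀ z ∈ annulus s, ‖f z‖ ≤ M) (hFc : Continuous F)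
    (hF : ∀ w : ℂ, w.re ∈ Ioo (-q0 s) 0 → F w = f (Complex.exp w)) {m : ℝ} (hm0 : 0 < m)
    (hm : ∀ r, r = s ∨ r = 1 → ∀ t : ℝ, ‖F (((Real.log r : ℝ) : ℂ) + t * Complex.I)‖ ≤ m)
    {I : Set ℂ} (hI : IsBdryArc s I) {ρ : ℝ} (hρ : ρ ∈ Ioo s 1) (t : ℝ)
    (hne : f (circleMap 0 ρ t) ≠ 0) :
    0 < l1Norm s I f ∧
    Real.sin (Real.pi * -Real.log ρ / q0 s) * (2 * Real.pi * kernelConst s * arcFraction s I) *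
        Real.log (m / l1Norm s I f) ≤ Real.log (m / ‖f (circleMap 0 ρ t)‖) := by
  set Y := Real.sin (Real.pi * -Real.log ρ / q0 s) *
    (2 * Real.pi * kernelConst s * arcFraction s I) with hY
  have hY0 : 0 < Y := by
    have h1 := sin_pi_mul_neg_log_div_pos hs0 hs1 hρ
    have h2 := kernelConst_pos hs0 hs1
    have h3 := hI.arcFraction_pos hs0 hs1
    positivity
  have hfpos : 0 < ‖f (circleMap 0 ρ t)‖ := norm_pos_iff.mpr hne
  have hδlim : Tendsto (fun δ : ℝ => m + δ) (𝓝[>] 0) (𝓝 m) := by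
    have : Tendsto (fun δ : ℝ => m + δ) (𝓝 0) (𝓝 (m + 0)) :=
      Continuous.tendsto (by fun_prop) 0
    rw [add_zero] at this
    exact this.mono_left nhdsWithin_le_nhds
  have hev : ∀ᶠ δ : ℝ in 𝓝[>] 0, Y * Real.log ((m + δ) / (l1Norm s I f + δ)) ≤
      Real.log ((m + δ) / ‖f (circleMap 0 ρ t)‖) := by
    filter_upwards [self_mem_nhdsWithin] with δ hδ
    exact sin_mul_log_div_le hs0 hs1 hf hM hFc hF hm hI hδ hρ t hne
  have hR : Tendsto (fun δ => Real.log ((m + δ) / ‖f (circleMap 0 ρ t)‖)) (𝓝[>] 0)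
      (𝓝 (Real.log (m / ‖f (circleMap 0 ρ t)‖))) :=
    (hδlim.div_const _).log (by positivity)
  have hε : 0 < l1Norm s I f := by
    refine lt_of_le_of_ne (l1Norm_nonneg s I f) fun h0 => ?_
    rw [← h0] at hev
    simp only [zero_add] at hev
    have hL : Tendsto (fun δ : ℝ => Y * Real.log ((m + δ) / δ)) (𝓝[>] 0) atTop := by
      refine Tendsto.const_mul_atTop hY0 (Real.tendsto_log_atTop.comp ?_)
      exact (hδlim.pos_mul_atTop hm0 tendsto_inv_nhdsGT_zero).congr fun δ => by
        rw [div_eq_mul_inv]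
    exact not_tendsto_nhds_of_tendsto_atTop (tendsto_atTop_mono' _ hev hL) _ hR
  refine ⟨hε, le_of_tendsto_of_tendsto ?_ hR hev⟩
  have hεlim : Tendsto (fun δ : ℝ => l1Norm s I f + δ) (𝓝[>] 0) (𝓝 (l1Norm s I f)) := by
    have : Tendsto (fun δ : ℝ => l1Norm s I f + δ) (𝓝 0) (𝓝 (l1Norm s I f + 0)) :=
      Continuous.tendsto (by fun_prop) 0
    rw [add_zero] at this
    exact this.mono_left nhdsWithin_le_nhds
  exact ((hδlim.div hεlim hε.ne').log (by positivity)).const_mul Y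

/-- The logarithmic distances from `ρ` to the two circles dominate the Euclidean ones: `-log ρ ≥ 1 -
ρ` and `log(ρ/s) ≥ 1 - s/ρ ≥ ρ - s`. Jordan's inequality is applied to the smaller of them, using
the symmetry of the sine about `π/2`. -/
lemma two_div_q0_mul_le_sin (hs0 : 0 < s) (hs1 : s < 1) {ρ d : ℝ} (hρ : ρ ∈ Ioo s 1)
    (hd1 : d ≤ 1 - ρ) (hds : d ≤ ρ - s) :
    2 / q0 s * d ≤ Real.sin (Real.pi * -Real.log ρ / q0 s) := by
  have hpi := Real.pi_pos
  have hq := q0_pos hs0 hs1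
  have hlog := log_mem_Ioo hs0 hρ
  have hρ0 : 0 < ρ := hs0.trans hρ.1
  have h1 : d ≤ -Real.log ρ := by linarith [Real.log_le_sub_one_of_pos hρ0]
  have h2 : d ≤ q0 s + Real.log ρ := by
    have h := Real.log_le_sub_one_of_pos (div_pos hs0 hρ0)
    rw [Real.log_div hs0.ne' hρ0.ne'] at h
    have h' : 1 - s / ρ ≥ ρ - s := by
      rw [ge_iff_le, ← sub_nonneg, show 1 - s / ρ - (ρ - s) = (ρ - s) * (1 - ρ) / ρ by
        field_simp]
      exact div_nonneg (mul_nonneg (by linarith [hρ.1]) (by linarith [hρ.2])) hρ0.le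
    rw [q0]
    linarith
  have key : ∀ y, 0 ≤ y → y ≤ q0 s / 2 → 2 / q0 s * y ≤ Real.sin (Real.pi * y / q0 s) := by
    intro y hy0 hy1
    have := Real.mul_le_sin (x := Real.pi * y / q0 s) (by positivity) (by
      rw [div_le_div_iff₀ hq (by norm_num)]; nlinarith)
    refine le_trans (le_of_eq ?_) this
    field_simp
  rcases le_total (-Real.log ρ) (q0 s / 2) with h | h
  · refine le_trans ?_ (key _ (by linarith [hlog.2]) h)
    gcongr
  · have e : Real.sin (Real.pi * -Real.log ρ / q0 s) =
        Real.sin (Real.pi * (q0 s + Real.log ρ) / q0 s) := by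
      rw [← Real.sin_pi_sub]
      congr 1
      field_simp
      ring
    rw [e]
    refine le_trans ?_ (key _ (by linarith [hlog.1]) (by linarith))
    gcongr

lemma lambda0_pos (hs0 : 0 < s) (hs1 : s < 1) {I : Set ℂ} (hI : IsBdryArc s I) :
    0 < lambda0 s I := by
  have h1 := hI.arcFraction_pos hs0 hs1
  have h2 := kernelConst_pos hs0 hs1
  have h3 := q0_pos hs0 hs1
  exact lt_min one_pos (by positivity)

lemma norm_le_mul_exp (hs0 : 0 < s) (hs1 : s < 1) (hf : DifferentiableOn ℂ f (annulus s))
    {M : ℝ} (hM : ∀ z ∈ annulus s, ‖f z‖ ≤ M) (hFc : Continuous F)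
    (hF : ∀ w : ℂ, w.re ∈ Ioo (-q0 s) 0 → F w = f (Complex.exp w)) {m : ℝ} (hm0 : 0 < m)
    (hm : ∀ r, r = s ∨ r = 1 → ∀ t : ℝ, ‖F (((Real.log r : ℝ) : ℂ) + t * Complex.I)‖ ≤ m)
    {I : Set ℂ} (hI : IsBdryArc s I) (hεm : l1Norm s I f ≤ m) {ρ d : ℝ} (hρ : ρ ∈ Ioo s 1)
    (hd0 : 0 ≤ d) (hd1 : d ≤ 1 - ρ) (hds : d ≤ ρ - s) (t : ℝ) :
    ‖f (circleMap 0 ρ t)‖ ≤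
      m * Real.exp (-(6 * lambda0 s I * d * Real.log (m / l1Norm s I f))) := by
  by_cases hne : f (circleMap 0 ρ t) = 0
  · rw [hne, norm_zero]; positivity
  obtain ⟨hε, hle⟩ := l1Norm_pos_and_log_norm_le hs0 hs1 hf hM hFc hF hm0 hm hI hρ t hne
  have hfpos : 0 < ‖f (circleMap 0 ρ t)‖ := norm_pos_iff.mpr hne
  have hC := kernelConst_pos hs0 hs1
  have hlam := hI.arcFraction_pos hs0 hs1
  have hq := q0_pos hs0 hs1
  have hsin := two_div_q0_mul_le_sin hs0 hs1 hρ hd1 hds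
  have hlog : 0 ≤ Real.log (m / l1Norm s I f) := Real.log_nonneg ((one_le_div hε).mpr hεm)
  -- The factor `1 + 2s ≥ 1` is given away here, and `2π ≥ 6` below accounts for the constant `6`.
  have hl : lambda0 s I ≤ 2 * arcFraction s I * kernelConst s / q0 s := by
    refine (min_le_right _ _).trans ?_
    gcongr
    nlinarith
  have h6 : 6 * lambda0 s I * d ≤ Real.sin (Real.pi * -Real.log ρ / q0 s) *
      (2 * Real.pi * kernelConst s * arcFraction s I) := by
    calc 6 * lambda0 s I * d
        ≤ (2 * Real.pi) * (2 * arcFraction s I * kernelConst s / q0 s) * d := by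
          have := lambda0_pos hs0 hs1 hI
          have := Real.pi_gt_three
          gcongr
          linarith
      _ = 2 / q0 s * d * (2 * Real.pi * kernelConst s * arcFraction s I) := by
          field_simp
      _ ≤ _ := by gcongr
  have h7 : 6 * lambda0 s I * d * Real.log (m / l1Norm s I f) ≤
      Real.log (m / ‖f (circleMap 0 ρ t)‖) := (mul_le_mul_of_nonneg_right h6 hlog).trans hle
  rw [Real.log_div hm0.ne' hfpos.ne'] at h7
  rw [← Real.log_le_log_iff hfpos (by positivity), Real.log_mul hm0.ne' (Real.exp_ne_zero _),
    Real.log_exp]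
  linarith

end TwoConstants

/-! ### The logarithmic stability bound with constant `2/(1 - s)`. -/

lemma linfNorm_add_le_hardySobolevNorm (s : ℝ) (f : ℂ → ℂ) (j : Fin 2) :
    linfNorm s (circ s) (iteratedDeriv j f) + linfNorm s (circ 1) (iteratedDeriv j f) ≤
      hardySobolevNorm 1 s f :=
  le_ciSup (f := fun j : Fin (1 + 1) =>
    linfNorm s (circ s) (iteratedDeriv j f) + linfNorm s (circ 1) (iteratedDeriv j f))
    (Set.finite_range _).bddAbove j

/-- The stability estimate, with an explicit constant. -/
lemma linfNorm_add_mul_abs_log_le {s : ℝ} (hs0 : 0 < s) (hs1 : s < 1) {I : Set ℂ}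
    (hI : IsBdryArc s I) {f : ℂ → ℂ} (hf : f ∈ unitBall 1 s) (hf0 : ∃ z ∈ annulus s, f z ≠ 0) :
    0 < l1Norm s I f ∧
      linfNorm s (bdry s) f ≤ linfNorm s (circ s) f + linfNorm s (circ 1) f ∧
      (linfNorm s (circ s) f + linfNorm s (circ 1) f) *
        |lambda0 s I * Real.log (l1Norm s I f)| ≤ 2 / (1 - s) := by
  obtain ⟨hfm, hnorm⟩ := hf
  obtain ⟨M, hM⟩ := hfm.2 0 (by norm_num)
  obtain ⟨M', hM'⟩ := hfm.2 1 le_rfl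
  simp only [iteratedDeriv_zero] at hM
  simp only [iteratedDeriv_one] at hM'
  obtain ⟨F, hFc, hF⟩ := exists_continuous_eq_comp_exp hs0 hfm
  set A := linfNorm s (circ s) f with hA
  set B := linfNorm s (circ 1) f with hB
  have hA0 : 0 ≤ A := linfNorm_nonneg _ _ _
  have hB0 : 0 ≤ B := linfNorm_nonneg _ _ _
  have hAB : A + B ≤ 1 := by
    have := (linfNorm_add_le_hardySobolevNorm s f 0).trans hnorm
    simpa using this
  have hN : linfNorm s (circ s) (deriv f) + linfNorm s (circ 1) (deriv f) ≤ 1 := by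
    have := (linfNorm_add_le_hardySobolevNorm s f 1).trans hnorm
    simpa [iteratedDeriv_one] using this
  have hderiv : ∀ z ∈ annulus s, ‖deriv f z‖ ≤ 1 := fun z hz => by
    refine norm_deriv_le_of_bdryModulus_le hs0 hs1 hfm hFc hF zero_le_one (fun r hr => ?_) hz
    filter_upwards [ae_bdryModulus_circleMap_le hs0 hs1 hM' hr] with t ht
    refine ht.trans (ENNReal.ofReal_le_ofReal ?_)
    have h1 := linfNorm_nonneg s (circ s) (deriv f)
    have h2 := linfNorm_nonneg s (circ 1) (deriv f)
    rcases hr with rfl | rfl <;> linarith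
  set m := max A B with hmdef
  have hm : ∀ r, r = s ∨ r = 1 → ∀ t : ℝ,
      ‖F (((Real.log r : ℝ) : ℂ) + t * Complex.I)‖ ≤ m := by
    intro r hr t
    refine (norm_extension_boundary_le hs0 hs1 hFc hF hM hr t).trans ?_
    rcases hr with rfl | rfl
    · exact le_max_left _ _
    · exact le_max_right _ _
  have hFm : ∀ {w : ℂ}, w.re ∈ Icc (-q0 s) 0 → ‖F w‖ ≤ m := fun hw =>
    norm_extension_le_of_boundary hs0 hs1 hfm.1 hM hFc hF hm hw
  obtain ⟨z, hz, hfz⟩ := hf0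
  have hz0 : 0 < ‖z‖ := hs0.trans hz.1
  have hzm : ‖f z‖ ≤ m := by
    have h := hFm (w := ((Real.log ‖z‖ : ℝ) : ℂ) + z.arg * Complex.I)
      (by simpa using Ioo_subset_Icc_self (log_mem_Ioo hs0 hz))
    rwa [hF _ (by simpa using log_mem_Ioo hs0 hz), ← circleMap_eq_exp hz0, circleMap_arg_eq] at h
  have hm0 : 0 < m := (norm_pos_iff.mpr hfz).trans_le hzm
  have hε : 0 < l1Norm s I f :=
    (l1Norm_pos_and_log_norm_le hs0 hs1 hfm.1 hM hFc hF hm0 hm hI hz z.arg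
      (by rwa [circleMap_arg_eq])).1
  have hmod : ∀ ζ ∈ bdry s, bdryModulus s f ζ ≤ ENNReal.ofReal m := fun ζ hζ => by
    rw [bdryModulus_eq_ofReal hs0 hs1 hFc hF hζ]
    refine ENNReal.ofReal_le_ofReal (hFm ?_)
    rw [Complex.log_re]
    exact log_mem_Icc hs0 (norm_mem_Icc_of_mem_bdry hs1 hζ)
  have hmAB : m ≤ A + B := max_le (by linarith) (by linarith)
  have hεm : l1Norm s I f ≤ m := by
    have hlam := hI.arcFraction_pos hs0 hs1
    rw [l1Norm, inv_mul_le_iff₀ hlam, arcFraction]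
    refine ENNReal.toReal_le_of_le_ofReal (by positivity) ?_
    calc ∫⁻ ζ in I, bdryModulus s f ζ ∂(bdryMeasure s)
        ≤ ∫⁻ ζ in I, ENNReal.ofReal m ∂(bdryMeasure s) :=
          setLIntegral_mono_ae' hI.measurableSet
            (Eventually.of_forall fun ζ hζ => hmod ζ (hI.subset hζ))
      _ = ENNReal.ofReal ((bdryMeasure s I).toReal * m) := by
          rw [setLIntegral_const, mul_comm, ENNReal.ofReal_mul ENNReal.toReal_nonneg,
            ENNReal.ofReal_toReal (measure_ne_top _ _)]
  -- From each circle move inward by `d`: the point reached is at distance at least `d` from both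
  -- circles because `d ≤ (1 - s)/2`, and `|f'| ≤ 1` bounds the change by `d`.
  have hself : ∀ d, 0 < d → d ≤ (1 - s) / 2 →
      m ≤ m * Real.exp (-(6 * lambda0 s I * d * Real.log (m / l1Norm s I f))) + d := by
    intro d hd0 hd
    have hcirc : ∀ r ρ, (r = s ∨ r = 1) → ρ ∈ Ioo s 1 → d ≤ 1 - ρ → d ≤ ρ - s → |r - ρ| = d →
        linfNorm s (circ r) f ≤
          m * Real.exp (-(6 * lambda0 s I * d * Real.log (m / l1Norm s I f))) + d := by
      intro r ρ hr hρ h1 h2 hrρ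
      have hr' : r ∈ Icc s 1 := by rcases hr with rfl | rfl <;> simp [hs1.le]
      refine linfNorm_le_of_forall (measurableSet_circ r) (by positivity) fun ζ hζ => ?_
      rw [← circleMap_arg_eq (ζ := ζ), norm_of_mem_circ hζ,
        bdryModulus_eq_enorm hs0 hs1 hFc hF hr', ← ofReal_norm]
      refine ENNReal.ofReal_le_ofReal ?_
      have h3 := norm_extension_boundary_sub_le hs0 hs1 hfm.1 hFc hF hderiv hr' hρ ζ.arg
      have h4 := norm_le_mul_exp hs0 hs1 hfm.1 hM hFc hF hm0 hm hI hεm hρ hd0.le h1 h2 ζ.arg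
      rw [hrρ, one_mul] at h3
      have h5 := norm_le_norm_sub_add (F (((Real.log r : ℝ) : ℂ) + ζ.arg * Complex.I))
        (f (circleMap 0 ρ ζ.arg))
      linarith
    refine max_le ?_ ?_
    · refine hcirc s (s + d) (Or.inl rfl) ⟨by linarith, by linarith⟩ (by linarith) (by linarith) ?_
      rw [sub_add_cancel_left, abs_neg, abs_of_pos hd0]
    · refine hcirc 1 (1 - d) (Or.inr rfl) ⟨by linarith, by linarith⟩ (by linarith) (by linarith) ?_
      rw [sub_sub_cancel, abs_of_pos hd0]
  refine ⟨hε, (linfNorm_le_of_forall ((measurableSet_circ s).union (measurableSet_circ 1)) hm0.le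
    hmod).trans hmAB, ?_⟩
  have hfinal := two_mul_mul_abs_log_le (ℓ := 1 - s) (by linarith) (by linarith)
    (lambda0_pos hs0 hs1 hI).le (min_le_left _ _) hm0 (hmAB.trans hAB) hε hεm hself
  -- The sum of the two circle norms is at most `2m`.
  refine le_trans ?_ hfinal
  gcongr
  linarith [le_max_left A B, le_max_right A B]

/-! ### The Hardy–Landau–Littlewood constant -/

lemma ae_norm_le_supNormOn {a b : ℝ} {g : ℝ → ℂ} (hg : MemLp g ⊤ (volume.restrict (Ioo a b))) :
    ∀ᵐ x ∂(volume.restrict (Ioo a b)), ‖g x‖ ≤ supNormOn a b g := by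
  have h := ae_le_eLpNormEssSup (f := g) (μ := volume.restrict (Ioo a b))
  filter_upwards [h] with x hx
  have hfin := hg.2.ne
  rw [supNormOn]
  rw [eLpNorm_exponent_top] at hfin ⊢
  rw [← ofReal_norm] at hx
  exact (ENNReal.ofReal_le_iff_le_toReal hfin).mp hx

lemma supNormOn_le {a b : ℝ} {g : ℝ → ℂ} {C : ℝ} (hC : 0 ≤ C)
    (h : ∀ᵐ x ∂(volume.restrict (Ioo a b)), ‖g x‖ ≤ C) : supNormOn a b g ≤ C := by
  refine ENNReal.toReal_le_of_le_ofReal hC ?_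
  rw [eLpNorm_exponent_top]
  exact eLpNormEssSup_le_of_ae_bound h

lemma supNormOn_nonneg (a b : ℝ) (g : ℝ → ℂ) : 0 ≤ supNormOn a b g := ENNReal.toReal_nonneg

lemma norm_setIntegral_smul_le {a b : ℝ} {g : ℝ → ℂ} {φ : ℝ → ℝ} {C : ℝ}
    (hg : ∀ᵐ x ∂(volume.restrict (Ioo a b)), ‖g x‖ ≤ C) (hC : 0 ≤ C) (hφ : Continuous φ)
    (hφc : HasCompactSupport φ) : ‖∫ x in Ioo a b, φ x • g x‖ ≤ C * ∫ x, |φ x| := by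
  have hint : Integrable fun x => |φ x| := (hφ.integrable_of_hasCompactSupport hφc).abs
  calc ‖∫ x in Ioo a b, φ x • g x‖ ≤ ∫ x in Ioo a b, C * |φ x| := by
        refine norm_integral_le_of_norm_le (hint.restrict.const_mul C) ?_
        filter_upwards [hg] with x hx
        rw [norm_smul, mul_comm, Real.norm_eq_abs]
        gcongr
    _ = C * ∫ x in Ioo a b, |φ x| := integral_const_mul _ _
    _ ≤ C * ∫ x, |φ x| := mul_le_mul_of_nonneg_left
        (setIntegral_le_integral hint (Eventually.of_forall fun _ => abs_nonneg _)) hC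

lemma intervalIntegral_mem_Icc_of_mean_one {φ : ℝ → ℝ} (hφ : Continuous φ)
    (hφc : HasCompactSupport φ) (h0 : ∀ x, 0 ≤ φ x) (h1 : ∫ x, φ x = 1) {p x : ℝ} (hx : p ≤ x) :
    ∫ y in p..x, φ y ∈ Icc (0 : ℝ) 1 := by
  rw [intervalIntegral.integral_of_le hx]
  refine ⟨integral_nonneg h0, ?_⟩
  rw [← h1]
  exact setIntegral_le_integral (hφ.integrable_of_hasCompactSupport hφc) (Eventually.of_forall h0)

lemma hasCompactSupport_of_eq_zero {φ : ℝ → ℝ} {p q : ℝ} (h : ∀ x ∉ Icc p q, φ x = 0) :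
    HasCompactSupport φ :=
  HasCompactSupport.intro isCompact_Icc h

lemma tsupport_subset_Icc {φ : ℝ → ℝ} {p q : ℝ} (h : ∀ x ∉ Icc p q, φ x = 0) :
    tsupport φ ⊆ Icc p q :=
  closure_minimal (fun x hx => by_contra fun hn => hx (h x hn)) isClosed_Icc

lemma intervalIntegral_eq_integral_of_eq_zero {φ : ℝ → ℝ} {p q x : ℝ}
    (h : ∀ y ∉ Icc p q, φ y = 0) (hx : q ≤ x) (hpq : p ≤ q) : ∫ y in p..x, φ y = ∫ y, φ y := by
  rw [intervalIntegral.integral_of_le (hpq.trans hx), ← integral_Icc_eq_integral_Ioc]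
  refine setIntegral_eq_integral_of_forall_compl_eq_zero fun y hy => h y fun hy' => hy ?_
  exact ⟨hy'.1, hy'.2.trans hx⟩

/-- Comparison of two averages of the first derivative of a Sobolev jet of order two. -/
lemma norm_setIntegral_smul_jet_le {a b p q : ℝ} (hap : a < p) (hpq : p ≤ q) (hqb : q < b)
    {G : ℕ → ℝ → ℂ} (hG : IsSobolevJet a b 2 G) {ψ η : ℝ → ℝ} (hψ : ContDiff ℝ (⊤ : ℕ∞) ψ)
    (hη : ContDiff ℝ (⊤ : ℕ∞) η) (hψs : ∀ x ∉ Icc p q, ψ x = 0) (hηs : ∀ x ∉ Icc p q, η x = 0)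
    (hψ0 : ∀ x, 0 ≤ ψ x) (hη0 : ∀ x, 0 ≤ η x) (hψ1 : ∫ x, ψ x = 1) (hη1 : ∫ x, η x = 1) :
    ‖∫ x in Ioo a b, ψ x • G 1 x‖ ≤
      supNormOn a b (G 0) * (∫ x, |deriv η x|) + supNormOn a b (G 2) * (q - p) := by
  have hsub : Icc p q ⊆ Ioo a b := fun x hx => ⟨hap.trans_le hx.1, hx.2.trans_lt hqb⟩
  have hψc := hasCompactSupport_of_eq_zero hψs
  have hηc := hasCompactSupport_of_eq_zero hηs
  set u : ℝ → ℝ := fun x => ψ x - η x with hu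
  have huc : Continuous u := hψ.continuous.sub hη.continuous
  have hus : ∀ x ∉ Icc p q, u x = 0 := fun x hx => by simp [hu, hψs x hx, hηs x hx]
  -- As `ψ` and `η` have equal mass, `Φ` is supported in `[p, q]` and is a valid test function; as
  -- both primitives lie in `[0, 1]`, `|Φ| ≤ 1`. Then `∫ ψ g' = -∫ Φ g'' - ∫ η' g`.
  set Φ : ℝ → ℝ := fun x => ∫ y in p..x, u y with hΦ
  have hΦd : ∀ x, HasDerivAt Φ (u x) x := fun x =>
    (huc.integral_hasStrictDerivAt p x).hasDerivAt
  have hΦ' : deriv Φ = u := funext fun x => (hΦd x).deriv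
  have hΦsm : ContDiff ℝ (⊤ : ℕ∞) Φ := by
    rw [contDiff_infty_iff_deriv, hΦ']
    exact ⟨fun x => (hΦd x).differentiableAt, hψ.sub hη⟩
  have hψint : Integrable ψ := hψ.continuous.integrable_of_hasCompactSupport hψc
  have hηint : Integrable η := hη.continuous.integrable_of_hasCompactSupport hηc
  have hu0 : ∫ x, u x = 0 := by
    rw [hu, integral_sub hψint hηint, hψ1, hη1, sub_self]
  have hΦs : ∀ x ∉ Icc p q, Φ x = 0 := by
    intro x hx
    rcases lt_or_ge x p with h | h
    · rw [hΦ]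
      refine intervalIntegral.integral_zero_ae ?_
      filter_upwards [compl_mem_ae_iff.mpr (measure_singleton p)] with y hy hy'
      refine hus y fun hy'' => hy ?_
      rw [uIoc_of_ge h.le] at hy'
      exact le_antisymm hy'.2 hy''.1
    · have hqx : q ≤ x := by
        by_contra hcon
        exact hx ⟨h, (not_le.mp hcon).le⟩
      rw [hΦ]
      beta_reduce
      rw [intervalIntegral_eq_integral_of_eq_zero hus hqx hpq, hu0]
  have hΦc := hasCompactSupport_of_eq_zero hΦs
  have hΦle : ∀ x, |Φ x| ≤ (Icc p q).indicator 1 x := by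
    intro x
    by_cases hx : x ∈ Icc p q
    · rw [indicator_of_mem hx, Pi.one_apply]
      have e : Φ x = (∫ y in p..x, ψ y) - ∫ y in p..x, η y :=
        intervalIntegral.integral_sub (hψ.continuous.intervalIntegrable _ _)
          (hη.continuous.intervalIntegrable _ _)
      have h1 := intervalIntegral_mem_Icc_of_mean_one hψ.continuous hψc hψ0 hψ1 hx.1
      have h2 := intervalIntegral_mem_Icc_of_mean_one hη.continuous hηc hη0 hη1 hx.1
      rw [e, abs_le]
      constructor <;> linarith [h1.1, h1.2, h2.1, h2.2]
    · rw [hΦs x hx, abs_zero, indicator_of_notMem hx]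
  have hΦint : ∫ x, |Φ x| ≤ q - p := by
    have hi : Integrable ((Icc p q).indicator (1 : ℝ → ℝ)) :=
      (integrable_indicator_iff measurableSet_Icc).mpr
        (integrableOn_const (C := (1 : ℝ)) (by simp))
    refine (integral_mono (hΦsm.continuous.integrable_of_hasCompactSupport hΦc).abs hi
      hΦle).trans_eq ?_
    rw [integral_indicator_one measurableSet_Icc, measureReal_def, Real.volume_Icc,
      ENNReal.toReal_ofReal (by linarith)]
  have w0 := hG.2 0 (by norm_num) η hη hηc ((tsupport_subset_Icc hηs).trans hsub)
  have w1 := hG.2 1 (by norm_num) Φ hΦsm hΦc ((tsupport_subset_Icc hΦs).trans hsub)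
  rw [zero_add] at w0
  rw [hΦ', one_add_one_eq_two] at w1
  have hG1 := hG.1 1 (by norm_num)
  have hmul : ∀ φ : ℝ → ℝ, Continuous φ → HasCompactSupport φ →
      IntegrableOn (fun x => φ x • G 1 x) (Ioo a b) := by
    intro φ hφ hφc
    refine Integrable.smul_of_top_left (hφ.integrable_of_hasCompactSupport hφc).restrict hG1
  have hsplit : ∫ x in Ioo a b, ψ x • G 1 x =
      (∫ x in Ioo a b, u x • G 1 x) + ∫ x in Ioo a b, η x • G 1 x := by
    rw [← integral_add (hmul u huc (hasCompactSupport_of_eq_zero hus)) (hmul η hη.continuous hηc)]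
    refine integral_congr_ae (Eventually.of_forall fun x => ?_)
    simp [hu, sub_smul]
  have e0 : ∫ x in Ioo a b, η x • G 1 x = -∫ x in Ioo a b, deriv η x • G 0 x := by rw [w0, neg_neg]
  rw [hsplit, w1, e0]
  have b0 := norm_setIntegral_smul_le (ae_norm_le_supNormOn (hG.1 0 (by norm_num)))
    (supNormOn_nonneg a b _) (hη.continuous_deriv (by simp)) hηc.deriv
  have b2 := norm_setIntegral_smul_le (ae_norm_le_supNormOn (hG.1 2 le_rfl))
    (supNormOn_nonneg a b _) hΦsm.continuous hΦc
  refine (norm_add_le _ _).trans ?_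
  rw [norm_neg, norm_neg, add_comm]
  refine add_le_add b0 (b2.trans ?_)
  have := supNormOn_nonneg a b (G 2)
  gcongr

/-- A smooth probability density supported in `[-1, 1]`. -/
noncomputable def unitBump : ℝ → ℝ :=
  (⟨1 / 2, 1, by norm_num, by norm_num⟩ : ContDiffBump (0 : ℝ)).normed volume

lemma contDiff_unitBump : ContDiff ℝ (⊤ : ℕ∞) unitBump := ContDiffBump.contDiff_normed _

lemma unitBump_nonneg (x : ℝ) : 0 ≤ unitBump x := ContDiffBump.nonneg_normed _ x

lemma integral_unitBump : ∫ x, unitBump x = 1 := ContDiffBump.integral_normed _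

lemma unitBump_eq_zero {x : ℝ} (hx : 1 ≤ |x|) : unitBump x = 0 := by
  by_contra h
  have : x ∈ Function.support unitBump := h
  rw [unitBump, ContDiffBump.support_normed_eq] at this
  simp at this
  linarith

lemma integral_abs_deriv_scaled_unitBump (c : ℝ) {h : ℝ} (hh : 0 < h) :
    ∫ x, |deriv (fun x => h⁻¹ * unitBump ((x - c) / h)) x| = (∫ x, |deriv unitBump x|) / h := by
  have hd : ∀ x, deriv (fun x => h⁻¹ * unitBump ((x - c) / h)) x =
      h⁻¹ * (deriv unitBump ((x - c) / h) * h⁻¹) := by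
    intro x
    have h1 : HasDerivAt (fun x : ℝ => (x - c) / h) h⁻¹ x := by
      simpa using ((hasDerivAt_id' x).sub_const c).div_const h
    have h2 : HasDerivAt unitBump (deriv unitBump ((x - c) / h)) ((x - c) / h) :=
      (contDiff_unitBump.differentiable (by simp) _).hasDerivAt
    exact ((HasDerivAt.comp x h2 h1).const_mul _).deriv
  simp only [hd, abs_mul, abs_of_pos (inv_pos.mpr hh)]
  rw [integral_const_mul, integral_mul_const,
    integral_sub_right_eq_self (fun x => |deriv unitBump (x / h)|) c,
    Measure.integral_comp_div (fun x => |deriv unitBump x|) h, abs_of_pos hh, smul_eq_mul]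
  field_simp

/-- Landau's inequality at scale `h`. A narrow mollifier at `x` recovers `g'(x)` almost everywhere
by Lebesgue differentiation; it is compared with a bump of width `h`, on which the derivative can be
moved at cost `1/h`. The comparison window of length `4h` is placed on the side of `x` where the
interval has more room, which `h ≤ (b - a)/8` permits. -/
lemma supNormOn_one_le {a b h : ℝ} (hh : 0 < h) (hhl : h ≤ (b - a) / 8) {G : ℕ → ℝ → ℂ}
    (hG : IsSobolevJet a b 2 G) :
    supNormOn a b (G 1) ≤
      supNormOn a b (G 0) * ((∫ x, |deriv unitBump x|) / h) + supNormOn a b (G 2) * (4 * h) := by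
  have hn0 := supNormOn_nonneg a b (G 0)
  have hn2 := supNormOn_nonneg a b (G 2)
  refine supNormOn_le (by positivity) ?_
  set φ : ℕ → ContDiffBump (0 : ℝ) := fun n =>
    ⟨1 / (n + 1) / 2, 1 / (n + 1), by positivity, half_lt_self (by positivity)⟩ with hφ
  have hrOut : Tendsto (fun n => (φ n).rOut) atTop (𝓝 0) := tendsto_one_div_add_atTop_nhds_zero_nat
  have hG1 := hG.1 1 (by norm_num)
  have hloc : LocallyIntegrable ((Ioo a b).indicator (G 1)) := by
    refine Integrable.locallyIntegrable ?_
    rw [integrable_indicator_iff measurableSet_Ioo]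
    exact hG1.integrable le_top
  have hae := ContDiffBump.ae_convolution_tendsto_right_of_locallyIntegrable (φ := φ) (l := atTop)
    (K := 2) hrOut (Eventually.of_forall fun n => by
      simp only [hφ]; exact le_of_eq (by ring)) hloc
  rw [ae_restrict_iff' measurableSet_Ioo]
  filter_upwards [hae] with x hx hxm
  rw [indicator_of_mem hxm] at hx
  refine le_of_tendsto hx.norm ?_
  have hsmall : ∀ᶠ n in atTop, (φ n).rOut < min h (min (x - a) (b - x)) :=
    hrOut.eventually (gt_mem_nhds (lt_min hh (lt_min (by linarith [hxm.1]) (by linarith [hxm.2]))))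
  filter_upwards [hsmall] with n hn
  obtain ⟨hn1, hn'⟩ := lt_min_iff.mp hn
  obtain ⟨hn2, hn3⟩ := lt_min_iff.mp hn'
  have hrpos : 0 < (φ n).rOut := (φ n).rOut_pos
  set ψ : ℝ → ℝ := fun t => (φ n).normed volume (x - t) with hψ
  have hconv : convolution ((φ n).normed volume) ((Ioo a b).indicator (G 1))
      (ContinuousLinearMap.lsmul ℝ ℝ) volume x = ∫ t in Ioo a b, ψ t • G 1 t := by
    rw [convolution_eq_swap, ← integral_indicator measurableSet_Ioo]
    congr 1
    ext t
    by_cases ht : t ∈ Ioo a b <;> simp [ht, hψ]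
  rw [hconv]
  have hψsm : ContDiff ℝ (⊤ : ℕ∞) ψ :=
    (ContDiffBump.contDiff_normed (φ n)).comp (contDiff_const.sub contDiff_id)
  have hψs : ∀ t, (φ n).rOut ≤ |x - t| → ψ t = 0 := by
    intro t ht
    by_contra hne
    have : x - t ∈ Function.support ((φ n).normed volume) := hne
    rw [ContDiffBump.support_normed_eq, mem_ball_zero_iff, Real.norm_eq_abs] at this
    linarith
  have hψ1 : ∫ t, ψ t = 1 := by
    rw [hψ, integral_sub_left_eq_self (fun t => (φ n).normed volume t) volume x]
    exact ContDiffBump.integral_normed _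
  have key : ∀ c p : ℝ, a < p → p + 4 * h < b → (∀ t ∉ Icc p (p + 4 * h), (φ n).rOut ≤ |x - t|) →
      p ≤ c - h → c + h ≤ p + 4 * h → ‖∫ t in Ioo a b, ψ t • G 1 t‖ ≤
        supNormOn a b (G 0) * ((∫ x, |deriv unitBump x|) / h) +
          supNormOn a b (G 2) * (4 * h) := by
    intro c p hp hpb hout hc1 hc2
    have hη1 : ∫ t, h⁻¹ * unitBump ((t - c) / h) = 1 := by
      rw [integral_const_mul, integral_sub_right_eq_self (fun t => unitBump (t / h)) c,
        Measure.integral_comp_div unitBump h, integral_unitBump, abs_of_pos hh, smul_eq_mul, mul_one,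
        inv_mul_cancel₀ hh.ne']
    have hmain := norm_setIntegral_smul_jet_le hp (by linarith) hpb hG hψsm
      (η := fun t => h⁻¹ * unitBump ((t - c) / h))
      (contDiff_const.mul (contDiff_unitBump.comp ((contDiff_id.sub contDiff_const).div_const h)))
      (fun t ht => hψs t (hout t ht)) (fun t ht => ?_)
      (fun t => ContDiffBump.nonneg_normed _ _)
      (fun t => mul_nonneg (inv_nonneg.mpr hh.le) (unitBump_nonneg _)) hψ1 hη1
    · rw [integral_abs_deriv_scaled_unitBump c hh, add_sub_cancel_left] at hmain
      exact hmain
    · rw [unitBump_eq_zero, mul_zero]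
      rw [abs_div, abs_of_pos hh, one_le_div hh, le_abs]
      by_contra hcon
      push Not at hcon
      exact ht ⟨by linarith [hcon.1, hcon.2], by linarith [hcon.1, hcon.2]⟩
  rcases le_total x ((a + b) / 2) with hmid | hmid
  · refine key (x + 2 * h) (x - (φ n).rOut) (by linarith) (by linarith) (fun t ht => ?_)
      (by linarith) (by linarith)
    by_contra hcon
    push Not at hcon
    rw [abs_lt] at hcon
    exact ht ⟨by linarith [hcon.1, hcon.2], by linarith [hcon.1, hcon.2]⟩
  · refine key (x - 2 * h) (x + (φ n).rOut - 4 * h) (by linarith) (by linarith) (fun t ht => ?_)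
      (by linarith) (by linarith)
    by_contra hcon
    push Not at hcon
    rw [abs_lt] at hcon
    exact ht ⟨by linarith [hcon.1, hcon.2], by linarith [hcon.1, hcon.2]⟩

lemma supNormOn_le_sobolevNorm (a b : ℝ) (G : ℕ → ℝ → ℂ) (i : Fin 3) :
    supNormOn a b (G i) ≤ sobolevNorm a b 2 G :=
  le_ciSup (f := fun i : Fin (2 + 1) => supNormOn a b (G i)) (Set.finite_range _).bddAbove i

lemma rpow_exponents (x y C : ℝ) :
    C * x ^ (1 / ((2 : ℕ) : ℝ)) * y ^ (1 - 1 / ((2 : ℕ) : ℝ)) = C * √x * √y := by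
  rw [Real.sqrt_eq_rpow, Real.sqrt_eq_rpow]
  norm_num

/-- The Hardy–Landau–Littlewood inequality for `W^{2,∞}(a, b)`. -/
lemma exists_hardyLandauLittlewood {a b : ℝ} (hab : a < b) :
    ∃ C : ℝ, 0 ≤ C ∧ ∀ G : ℕ → ℝ → ℂ, IsSobolevJet a b 2 G →
      supNormOn a b (G 1) ≤
        C * sobolevNorm a b 2 G ^ (1 / ((2 : ℕ) : ℝ)) *
          supNormOn a b (G 0) ^ (1 - 1 / ((2 : ℕ) : ℝ)) := by
  set ℓ := b - a with hℓ
  have hℓ0 : 0 < ℓ := sub_pos.mpr hab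
  set K := ∫ x, |deriv unitBump x| with hK
  have hK0 : 0 ≤ K := integral_nonneg fun _ => abs_nonneg _
  refine ⟨8 * K / ℓ + ℓ / 2, by positivity, fun G hG => ?_⟩
  rw [rpow_exponents]
  set A := sobolevNorm a b 2 G with hA
  set A0 := supNormOn a b (G 0) with hA0
  have h00 : 0 ≤ A0 := supNormOn_nonneg _ _ _
  have h0A : A0 ≤ A := supNormOn_le_sobolevNorm a b G 0
  have h2A : supNormOn a b (G 2) ≤ A := supNormOn_le_sobolevNorm a b G 2
  have h20 : 0 ≤ supNormOn a b (G 2) := supNormOn_nonneg _ _ _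
  rcases h00.eq_or_lt with h | h
  -- When `g` vanishes there is nothing to balance, and the scale is sent to `0` instead.
  · rw [← h, Real.sqrt_zero, mul_zero]
    refine le_of_forall_pos_le_add fun ε hε => ?_
    set k := min (ℓ / 8) (ε / (4 * (A + 1))) with hk
    have hA1 : 0 ≤ A := h00.trans h0A
    have hk0 : 0 < k := lt_min (by positivity) (by positivity)
    have := supNormOn_one_le hk0 (min_le_left _ _) hG
    rw [← hA0, ← h, zero_mul, zero_add] at this
    rw [zero_add]
    refine this.trans ?_
    have hk1 : k ≤ ε / (4 * (A + 1)) := min_le_right _ _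
    rw [le_div_iff₀ (by positivity)] at hk1
    nlinarith
  · have hApos : 0 < A := h.trans_le h0A
    have hs0 := Real.sqrt_pos.mpr h
    have hsA := Real.sqrt_pos.mpr hApos
    have hq0 := Real.sq_sqrt h00
    have hqA := Real.sq_sqrt hApos.le
    have hle : √A0 ≤ √A := Real.sqrt_le_sqrt h0A
    -- This scale makes both terms multiples of `√A · √A0`; it is admissible because `A0 ≤ A`.
    set k := ℓ / 8 * (√A0 / √A) with hk
    have hk0 : 0 < k := by positivity
    have hk1 : k ≤ ℓ / 8 := by
      rw [hk]
      exact mul_le_of_le_one_right (by positivity) ((div_le_one hsA).mpr hle)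
    refine (supNormOn_one_le hk0 hk1 hG).trans ?_
    have e1 : A0 * (K / k) = 8 * K / ℓ * (√A * √A0) := by
      rw [hk]
      nth_rewrite 1 [← hq0]
      field_simp
    have e2 : A * (4 * k) = ℓ / 2 * (√A * √A0) := by
      rw [hk]
      nth_rewrite 1 [← hqA]
      field_simp
      ring
    calc A0 * (K / k) + supNormOn a b (G 2) * (4 * k) ≤ A0 * (K / k) + A * (4 * k) := by gcongr
      _ = (8 * K / ℓ + ℓ / 2) * √A * √A0 := by rw [e1, e2]; ring

/-- The jet of the affine function vanishing at the midpoint of `(a, b)`. -/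
noncomputable def affineJet (a b : ℝ) : ℕ → ℝ → ℂ
  | 0 => fun x => ((x - (a + b) / 2 : ℝ) : ℂ)
  | 1 => fun _ => 1
  | _ => fun _ => 0

lemma affineJet_zero_norm_le {a b x : ℝ} (hx : x ∈ Ioo a b) :
    ‖affineJet a b 0 x‖ ≤ (b - a) / 2 := by
  rw [affineJet, Complex.norm_real, Real.norm_eq_abs, abs_le]
  constructor <;> linarith [hx.1, hx.2]

lemma setIntegral_deriv_smul_eq {a b : ℝ} {φ : ℝ → ℝ} (hφ : ContDiff ℝ (⊤ : ℕ∞) φ)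
    (hφc : HasCompactSupport φ) (hs : tsupport φ ⊆ Ioo a b) {g g' : ℝ → ℂ}
    (hg : ∀ x, HasDerivAt g (g' x) x) (hg' : Continuous g') :
    ∫ x in Ioo a b, deriv φ x • g x = -∫ x in Ioo a b, φ x • g' x := by
  have hgc : Continuous g := continuous_iff_continuousAt.mpr fun x => (hg x).continuousAt
  have hφ' : Continuous (deriv φ) := hφ.continuous_deriv (by simp)
  have ext : ∀ u : ℝ → ℝ, (∀ x ∉ tsupport φ, u x = 0) → ∀ k : ℝ → ℂ,
      ∫ x in Ioo a b, u x • k x = ∫ x, u x • k x := fun u hu k =>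
    setIntegral_eq_integral_of_forall_compl_eq_zero fun x hx => by
      rw [hu x fun h => hx (hs h), zero_smul]
  rw [ext _ (fun x hx => image_eq_zero_of_notMem_tsupport fun h => hx (tsupport_deriv_subset h)),
    ext _ (fun x hx => image_eq_zero_of_notMem_tsupport hx)]
  have i1 : Integrable fun x => φ x • g' x :=
    (hφ.continuous.smul hg').integrable_of_hasCompactSupport hφc.smul_right
  have i2 : Integrable fun x => deriv φ x • g x :=
    (hφ'.smul hgc).integrable_of_hasCompactSupport hφc.deriv.smul_right
  have i3 : Integrable fun x => φ x • g x :=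
    (hφ.continuous.smul hgc).integrable_of_hasCompactSupport hφc.smul_right
  have h := integral_eq_zero_of_hasDerivAt_of_integrable
    (fun x => ((hφ.differentiable (by simp) x).hasDerivAt.smul (hg x))) (i1.add i2) i3
  rw [integral_add i1 i2] at h
  exact eq_neg_of_add_eq_zero_right h

lemma isSobolevJet_affineJet (a b : ℝ) : IsSobolevJet a b 2 (affineJet a b) := by
  constructor
  · intro i hi
    interval_cases i
    · refine MemLp.of_bound (C := (b - a) / 2) ?_ ?_
      · exact (Complex.continuous_ofReal.comp
          (continuous_id.sub continuous_const)).aestronglyMeasurable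
      · filter_upwards [ae_restrict_mem measurableSet_Ioo] with x hx
        exact affineJet_zero_norm_le hx
    · exact memLp_const 1
    · exact memLp_const 0
  · intro i hi φ hφ hφc hs
    interval_cases i
    · refine setIntegral_deriv_smul_eq hφ hφc hs (fun x => ?_) continuous_const
      have := (Complex.ofRealCLM.hasDerivAt (x := x)).sub_const (((a + b) / 2 : ℝ) : ℂ)
      simpa [affineJet] using this
    · exact setIntegral_deriv_smul_eq hφ hφc hs (fun x => hasDerivAt_const x (1 : ℂ))
        continuous_const

/-- For `g(x) = x - (1 + s)/2` one has `g' = 1`, `‖g‖ ≤ (1 - s)/2` and Sobolev norm at most `1`, so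
every admissible `C` satisfies `1 ≤ C √((1 - s)/2)`. -/
lemma two_div_le_hllConst_sq {s : ℝ} (hs0 : 0 < s) (hs1 : s < 1) :
    2 / (1 - s) ≤ hllConst s 1 2 ^ 2 := by
  have h1s : 0 < 1 - s := sub_pos.mpr hs1
  have hsq : √(2 / (1 - s)) ≤ hllConst s 1 2 := by
    -- Nonemptiness of the admissible set is essential: the real infimum of the empty set is `0`.
    refine le_csInf (exists_hardyLandauLittlewood hs1) ?_
    rintro C ⟨hC0, hC⟩
    have h := hC _ (isSobolevJet_affineJet s 1)
    rw [rpow_exponents] at h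
    have e1 : supNormOn s 1 (affineJet s 1 1) = 1 := by
      rw [supNormOn, affineJet, eLpNorm_exponent_top, eLpNormEssSup_const]
      · simp
      · rw [ne_eq, Measure.restrict_eq_zero, Real.volume_Ioo]
        simpa using hs1
    have e0 : supNormOn s 1 (affineJet s 1 0) ≤ (1 - s) / 2 := by
      refine supNormOn_le (by positivity) ?_
      filter_upwards [ae_restrict_mem measurableSet_Ioo] with x hx
      exact affineJet_zero_norm_le hx
    have e2 : supNormOn s 1 (affineJet s 1 2) ≤ 0 :=
      supNormOn_le le_rfl (Eventually.of_forall fun x => by simp [affineJet])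
    have e3 : sobolevNorm s 1 2 (affineJet s 1) ≤ 1 := by
      refine ciSup_le fun i => ?_
      fin_cases i
      · exact e0.trans (by linarith)
      · exact e1.le
      · exact e2.trans zero_le_one
    rw [e1] at h
    have h2 : 1 ≤ C * √((1 - s) / 2) := by
      refine h.trans ?_
      calc C * √(sobolevNorm s 1 2 (affineJet s 1)) * √(supNormOn s 1 (affineJet s 1 0))
          ≤ C * √1 * √((1 - s) / 2) := by gcongr
        _ = C * √((1 - s) / 2) := by rw [Real.sqrt_one, mul_one]
    rw [← inv_div, Real.sqrt_inv]
    rw [inv_eq_one_div, div_le_iff₀ (Real.sqrt_pos.mpr (by positivity))]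
    exact h2
  calc 2 / (1 - s) = √(2 / (1 - s)) ^ 2 := (Real.sq_sqrt (by positivity)).symm
    _ ≤ hllConst s 1 2 ^ 2 := by gcongr

/-! ### Functions with constant modulus on the boundary circles -/

lemma bdryModulus_of_continuousAt {s : ℝ} (hs0 : 0 < s) (hs1 : s < 1) {g : ℂ → ℂ} {ζ : ℂ}
    (hζ : ζ ∈ bdry s) (hg : ContinuousAt g ζ) : bdryModulus s g ζ = ENNReal.ofReal ‖g ζ‖ := by
  have hζ' := norm_mem_Icc_of_mem_bdry hs1 hζ
  have := nhdsWithin_Ioo_neBot hs1 hζ'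
  rw [← circleMap_arg_eq (ζ := ζ)] at hg
  have h : bdryModulus s g (circleMap 0 ‖ζ‖ ζ.arg) =
      ENNReal.ofReal ‖g (circleMap 0 ‖ζ‖ ζ.arg)‖ := by
    rw [bdryModulus_circleMap g (hs0.trans_le hζ'.1), ofReal_norm]
    refine Tendsto.limsup_eq ?_
    refine Tendsto.mono_left ?_ nhdsWithin_le_nhds
    have hc : Continuous fun ρ : ℝ => circleMap 0 ρ ζ.arg := by unfold circleMap; fun_prop
    have h1 : ContinuousAt (fun ρ : ℝ => g (circleMap 0 ρ ζ.arg)) ‖ζ‖ :=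
      ContinuousAt.comp (f := fun ρ : ℝ => circleMap 0 ρ ζ.arg) hg hc.continuousAt
    exact h1.enorm
  rwa [circleMap_arg_eq] at h

lemma circMeasure_circ {r : ℝ} (hr : 0 ≤ r) : circMeasure r (circ r) = 1 := by
  rw [← circMeasure_univ r]
  exact measure_eq_measure_of_null_sdiff (subset_univ _)
    (measure_mono_null (fun z hz => hz.2) (ae_circMeasure_mem hr))

lemma bdryMeasure_circ_ne_zero {s r : ℝ} (hs0 : 0 < s) (hr : r = s ∨ r = 1) :
    bdryMeasure s (circ r) ≠ 0 := by
  rw [bdryMeasure, Measure.add_apply]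
  rcases hr with rfl | rfl
  · rw [circMeasure_circ hs0.le]; simp
  · rw [circMeasure_circ zero_le_one]; simp

lemma linfNorm_circ_eq {s r v : ℝ} (hs0 : 0 < s) (hr : r = s ∨ r = 1) {g : ℂ → ℂ} (hv : 0 ≤ v)
    (h : ∀ ζ ∈ circ r, bdryModulus s g ζ = ENNReal.ofReal v) : linfNorm s (circ r) g = v := by
  rw [linfNorm, essSup_congr_ae (g := fun _ => ENNReal.ofReal v), essSup_const,
    ENNReal.toReal_ofReal hv]
  · rw [ne_eq, Measure.restrict_eq_zero]
    exact bdryMeasure_circ_ne_zero hs0 hr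
  · filter_upwards [ae_restrict_mem (measurableSet_circ r)] with ζ hζ using h ζ hζ

lemma l1Norm_circ_eq {s r v : ℝ} (hs0 : 0 < s) (hr : r = s ∨ r = 1) {g : ℂ → ℂ} (hv : 0 ≤ v)
    (h : ∀ ζ ∈ circ r, bdryModulus s g ζ = ENNReal.ofReal v) : l1Norm s (circ r) g = v := by
  have hpos : 0 < (bdryMeasure s (circ r)).toReal :=
    ENNReal.toReal_pos (bdryMeasure_circ_ne_zero hs0 hr) (measure_ne_top _ _)
  rw [l1Norm, arcFraction, setLIntegral_congr_fun (measurableSet_circ r) h, setLIntegral_const,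
    ENNReal.toReal_mul, ENNReal.toReal_ofReal hv, inv_mul_eq_div, mul_div_assoc,
    div_self hpos.ne', mul_one]

lemma linfNorm_bdry_eq {s v v' : ℝ} (hs0 : 0 < s) (hv' : 0 ≤ v') (hvv : v' ≤ v) {g : ℂ → ℂ}
    (h : ∀ ζ ∈ circ s, bdryModulus s g ζ = ENNReal.ofReal v)
    (h' : ∀ ζ ∈ circ 1, bdryModulus s g ζ = ENNReal.ofReal v') : linfNorm s (bdry s) g = v := by
  have hv := hv'.trans hvv
  have hle : ∀ ζ ∈ bdry s, bdryModulus s g ζ ≤ ENNReal.ofReal v := by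
    rintro ζ (hζ | hζ)
    · exact (h ζ hζ).le
    · exact (h' ζ hζ).le.trans (ENNReal.ofReal_le_ofReal hvv)
  have hmeas : MeasurableSet (bdry s) := (measurableSet_circ s).union (measurableSet_circ 1)
  refine le_antisymm (linfNorm_le_of_forall hmeas hv hle) ?_
  rw [← linfNorm_circ_eq hs0 (Or.inl rfl) hv h]
  refine ENNReal.toReal_mono (ne_top_of_le_ne_top (b := ENNReal.ofReal v) ENNReal.ofReal_ne_top ?_)
    (essSup_mono_measure
      (Measure.restrict_mono (circ_subset_bdry (Or.inl rfl)) le_rfl).absolutelyContinuous)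
  refine essSup_le_of_ae_le _ ?_
  filter_upwards [ae_restrict_mem hmeas] with ζ hζ using hle ζ hζ

/-! ### Negative powers -/

section NegativePowers

variable {s : ℝ} (n : ℕ) (c : ℝ)

lemma hasDerivAt_inv_pow_div {w : ℂ} (hw : w ≠ 0) :
    HasDerivAt (fun w : ℂ => (w ^ n)⁻¹ / (c : ℂ)) (-(n * (w ^ (n + 1))⁻¹) / (c : ℂ)) w := by
  have h := ((hasDerivAt_pow n w).inv (pow_ne_zero n hw)).div_const (c : ℂ)
  refine h.congr_deriv ?_
  congr 1
  rcases n with _ | n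
  · simp
  · rw [Nat.add_sub_cancel]
    field_simp
    ring

lemma norm_inv_pow_div (hc : 0 < c) (w : ℂ) :
    ‖(w ^ n)⁻¹ / (c : ℂ)‖ = (‖w‖ ^ n)⁻¹ / c := by
  rw [norm_div, norm_inv, norm_pow, Complex.norm_real, Real.norm_of_nonneg hc.le]

lemma norm_deriv_inv_pow_div (hc : 0 < c) {w : ℂ} (hw : w ≠ 0) :
    ‖deriv (fun w : ℂ => (w ^ n)⁻¹ / (c : ℂ)) w‖ = n * (‖w‖ ^ (n + 1))⁻¹ / c := by
  rw [(hasDerivAt_inv_pow_div n c hw).deriv, norm_div, norm_neg, norm_mul, norm_inv, norm_pow,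
    Complex.norm_real, Real.norm_of_nonneg hc.le, Complex.norm_natCast]

lemma continuousAt_deriv_inv_pow_div {w : ℂ} (hw : w ≠ 0) :
    ContinuousAt (deriv fun w : ℂ => (w ^ n)⁻¹ / (c : ℂ)) w := by
  have h : (fun w : ℂ => -(n * (w ^ (n + 1))⁻¹) / (c : ℂ)) =ᶠ[𝓝 w]
      deriv fun w : ℂ => (w ^ n)⁻¹ / (c : ℂ) := by
    filter_upwards [isOpen_ne.mem_nhds hw] with z hz
    exact (hasDerivAt_inv_pow_div n c hz).deriv.symm
  refine ContinuousAt.congr ?_ h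
  exact (continuousAt_const.mul
    ((continuousAt_id.pow (n + 1)).inv₀ (pow_ne_zero _ hw))).neg.div_const _

lemma ne_zero_of_mem_bdry (hs0 : 0 < s) (hs1 : s < 1) {ζ : ℂ} (hζ : ζ ∈ bdry s) : ζ ≠ 0 :=
  norm_pos_iff.mp (hs0.trans_le (norm_mem_Icc_of_mem_bdry hs1 hζ).1)

lemma bdryModulus_inv_pow_div (hs0 : 0 < s) (hs1 : s < 1) (hc : 0 < c) {r : ℝ}
    (hr : r = s ∨ r = 1) : ∀ ζ ∈ circ r,
      bdryModulus s (fun w : ℂ => (w ^ n)⁻¹ / (c : ℂ)) ζ = ENNReal.ofReal ((r ^ n)⁻¹ / c) := by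
  intro ζ hζ
  have hb := circ_subset_bdry hr hζ
  rw [bdryModulus_of_continuousAt hs0 hs1 hb
    (hasDerivAt_inv_pow_div n c (ne_zero_of_mem_bdry hs0 hs1 hb)).continuousAt,
    norm_inv_pow_div n c hc, norm_of_mem_circ hζ]

lemma bdryModulus_deriv_inv_pow_div (hs0 : 0 < s) (hs1 : s < 1) (hc : 0 < c) {r : ℝ}
    (hr : r = s ∨ r = 1) : ∀ ζ ∈ circ r,
      bdryModulus s (deriv fun w : ℂ => (w ^ n)⁻¹ / (c : ℂ)) ζ =
        ENNReal.ofReal (n * (r ^ (n + 1))⁻¹ / c) := by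
  intro ζ hζ
  have hb := circ_subset_bdry hr hζ
  have hζ0 := ne_zero_of_mem_bdry hs0 hs1 hb
  rw [bdryModulus_of_continuousAt hs0 hs1 hb (continuousAt_deriv_inv_pow_div n c hζ0),
    norm_deriv_inv_pow_div n c hc hζ0, norm_of_mem_circ hζ]

lemma memHardySobolev_inv_pow_div (hs0 : 0 < s) (hc : 0 < c) :
    MemHardySobolev 1 s fun w : ℂ => (w ^ n)⁻¹ / (c : ℂ) := by
  have hz0 : ∀ z ∈ annulus s, z ≠ 0 := fun z hz => norm_pos_iff.mp (hs0.trans hz.1)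
  refine ⟨fun z hz =>
    (hasDerivAt_inv_pow_div n c (hz0 z hz)).differentiableAt.differentiableWithinAt, fun j hj => ?_⟩
  interval_cases j
  · refine ⟨(s ^ n)⁻¹ / c, fun z hz => ?_⟩
    rw [iteratedDeriv_zero, norm_inv_pow_div n c hc]
    have := hz.1
    gcongr
  · refine ⟨n * (s ^ (n + 1))⁻¹ / c, fun z hz => ?_⟩
    rw [iteratedDeriv_one, norm_deriv_inv_pow_div n c hc (hz0 z hz)]
    have := hz.1
    gcongr

/-- The first-order term attains the maximum, since `n ≥ 1` and `s < 1`. Keeping `c` free covers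
both the norm of `z⁻ⁿ` (`c = 1`) and the normalized function. -/
lemma hardySobolevNorm_inv_pow_div (hs0 : 0 < s) (hs1 : s < 1) (hc : 0 < c) (hn : 1 ≤ n) :
    hardySobolevNorm 1 s (fun w : ℂ => (w ^ n)⁻¹ / (c : ℂ)) = n * ((s ^ (n + 1))⁻¹ + 1) / c := by
  have e0 : linfNorm s (circ s) (iteratedDeriv 0 fun w : ℂ => (w ^ n)⁻¹ / (c : ℂ)) +
      linfNorm s (circ 1) (iteratedDeriv 0 fun w : ℂ => (w ^ n)⁻¹ / (c : ℂ)) =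
      ((s ^ n)⁻¹ + 1) / c := by
    rw [iteratedDeriv_zero,
      linfNorm_circ_eq hs0 (Or.inl rfl) (by positivity)
        (bdryModulus_inv_pow_div n c hs0 hs1 hc (Or.inl rfl)),
      linfNorm_circ_eq hs0 (Or.inr rfl) (by positivity)
        (bdryModulus_inv_pow_div n c hs0 hs1 hc (Or.inr rfl)), one_pow, inv_one, add_div]
  have e1 : linfNorm s (circ s) (iteratedDeriv 1 fun w : ℂ => (w ^ n)⁻¹ / (c : ℂ)) +
      linfNorm s (circ 1) (iteratedDeriv 1 fun w : ℂ => (w ^ n)⁻¹ / (c : ℂ)) =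
      n * ((s ^ (n + 1))⁻¹ + 1) / c := by
    rw [iteratedDeriv_one,
      linfNorm_circ_eq hs0 (Or.inl rfl) (by positivity)
        (bdryModulus_deriv_inv_pow_div n c hs0 hs1 hc (Or.inl rfl)),
      linfNorm_circ_eq hs0 (Or.inr rfl) (by positivity)
        (bdryModulus_deriv_inv_pow_div n c hs0 hs1 hc (Or.inr rfl)), one_pow, inv_one]
    ring
  refine le_antisymm (ciSup_le fun j => ?_) ?_
  · fin_cases j
    · refine e0.le.trans ?_
      gcongr
      have h1 : (s ^ n)⁻¹ ≤ (s ^ (n + 1))⁻¹ :=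
        inv_anti₀ (by positivity) (pow_le_pow_of_le_one hs0.le hs1.le (Nat.le_succ n))
      have h2 : (1 : ℝ) ≤ n := by exact_mod_cast hn
      have h3 : 0 < (s ^ (n + 1))⁻¹ := by positivity
      nlinarith
    · exact e1.le
  · rw [← e1]
    exact linfNorm_add_le_hardySobolevNorm s _ 1

end NegativePowers

/-! ### The limit -/

/-- The prefactor is `s / (n (1 + s^{n+1}))` and the logarithm is `log n + (n+1)(-log s) + log(1 +
s^{n+1})`; after division by `n` only the middle term survives. -/
lemma tendsto_inv_pow_div_mul_log {s : ℝ} (hs0 : 0 < s) (hs1 : s < 1) :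
    Tendsto (fun n : ℕ => (s ^ n)⁻¹ / (n * ((s ^ (n + 1))⁻¹ + 1)) *
      Real.log (n * ((s ^ (n + 1))⁻¹ + 1))) atTop (𝓝 (s * |Real.log s|)) := by
  have hpow : Tendsto (fun n : ℕ => s ^ (n + 1)) atTop (𝓝 0) :=
    (tendsto_add_atTop_iff_nat 1).mpr (tendsto_pow_atTop_nhds_zero_of_lt_one hs0.le hs1)
  have hinv : Tendsto (fun n : ℕ => ((n : ℝ))⁻¹) atTop (𝓝 0) := tendsto_inv_atTop_nhds_zero_nat
  have hlogn : Tendsto (fun n : ℕ => Real.log n * (n : ℝ)⁻¹) atTop (𝓝 0) := by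
    have := (Real.isLittleO_log_id_atTop.tendsto_div_nhds_zero).comp tendsto_natCast_atTop_atTop
    exact this.congr fun n => by simp [div_eq_mul_inv]
  have hlog1 : Tendsto (fun n : ℕ => Real.log (1 + s ^ (n + 1))) atTop (𝓝 0) := by
    have := (hpow.const_add 1).log (by norm_num)
    simpa using this
  have hmain : Tendsto (fun n : ℕ => s / (1 + s ^ (n + 1)) *
      (Real.log n * (n : ℝ)⁻¹ + (1 + (n : ℝ)⁻¹) * (-Real.log s) +
        Real.log (1 + s ^ (n + 1)) * (n : ℝ)⁻¹)) atTop
      (𝓝 (s / (1 + 0) * (0 + (1 + 0) * (-Real.log s) + 0 * 0))) :=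
    (tendsto_const_nhds.div (hpow.const_add 1) (by norm_num)).mul
      ((hlogn.add ((hinv.const_add 1).mul_const _)).add (hlog1.mul hinv))
  have e : s / (1 + 0) * (0 + (1 + 0) * (-Real.log s) + 0 * 0) = s * |Real.log s| := by
    rw [abs_of_neg (Real.log_neg hs0 hs1)]; ring
  rw [e] at hmain
  refine hmain.congr' ?_
  filter_upwards [eventually_ge_atTop 1] with n hn
  have hn0 : (0 : ℝ) < n := by exact_mod_cast hn
  have h1 : (s ^ (n + 1))⁻¹ + 1 = (s ^ (n + 1))⁻¹ * (1 + s ^ (n + 1)) := by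
    field_simp
  rw [h1, Real.log_mul hn0.ne' (by positivity), Real.log_mul (by positivity) (by positivity),
    Real.log_inv, Real.log_pow]
  push_cast
  field_simp
  ring

end AnnulusHardy

/-! ### The stability theorem and the example of negative powers. -/

theorem theorem3p5 (s : ℝ) (hs0 : 0 < s) (hs1 : s < 1) :
    (∀ I : Set ℂ, AnnulusHardy.IsBdryArc s I →
      ∀ f ∈ AnnulusHardy.unitBall 1 s, (∃ z ∈ AnnulusHardy.annulus s, f z ≠ 0) →
        AnnulusHardy.l1Norm s I f <
          Real.exp (-(AnnulusHardy.q0 s /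
            (AnnulusHardy.arcFraction s I * AnnulusHardy.kernelConst s))) →
        AnnulusHardy.linfNorm s (AnnulusHardy.bdry s) f ≤ AnnulusHardy.logBound s I f ∧
        AnnulusHardy.linfNorm s (AnnulusHardy.circ s) f +
            AnnulusHardy.linfNorm s (AnnulusHardy.circ 1) f ≤ AnnulusHardy.logBound s I f) ∧
    (∃ f : ℕ → ℂ → ℂ,
      (∀ n z, f n z = (z ^ n)⁻¹ /
        (AnnulusHardy.hardySobolevNorm 1 s (fun w : ℂ => (w ^ n)⁻¹) : ℂ)) ∧
      (∀ n, 1 ≤ n → f n ∈ AnnulusHardy.unitBall 1 s) ∧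
      (∃ L : ℝ, s * |Real.log s| ≤ L ∧
        Filter.Tendsto
          (fun n => AnnulusHardy.linfNorm s (AnnulusHardy.bdry s) (f n) *
            |Real.log (AnnulusHardy.l1Norm s (AnnulusHardy.circ 1) (f n))|)
          Filter.atTop (nhds L)) ∧
      (∃ L : ℝ, s * |Real.log s| ≤ L ∧
        Filter.Tendsto
          (fun n => (AnnulusHardy.linfNorm s (AnnulusHardy.circ s) (f n) +
              AnnulusHardy.linfNorm s (AnnulusHardy.circ 1) (f n)) *
            |Real.log (AnnulusHardy.l1Norm s (AnnulusHardy.circ 1) (f n))|)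
          Filter.atTop (nhds L))) := by
  open AnnulusHardy Filter in
  refine ⟨fun I hI f hf hf0 hsmall => ?_, ?_⟩
  · obtain ⟨hε, hle, hmain⟩ := linfNorm_add_mul_abs_log_le hs0 hs1 hI hf hf0
    -- Only this consequence of the smallness assumption is needed: it makes the logarithm nonzero,
    -- so division by its modulus is legitimate.
    have hε1 : l1Norm s I f < 1 := by
      refine hsmall.trans_le (Real.exp_le_one_iff.mpr (neg_nonpos.mpr ?_))
      have h1 := hI.arcFraction_pos hs0 hs1
      have h2 := kernelConst_pos hs0 hs1
      have h3 := q0_pos hs0 hs1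
      positivity
    have hpos : 0 < |lambda0 s I * Real.log (l1Norm s I f)| :=
      abs_pos.mpr (mul_ne_zero (lambda0_pos hs0 hs1 hI).ne' (Real.log_neg hε hε1).ne)
    have hC := two_div_le_hllConst_sq hs0 hs1
    have hexp : 1 / (2 * Real.exp 1) ≤ 1 / 2 :=
      one_div_le_one_div_of_le (by norm_num) (by linarith [Real.one_le_exp (zero_le_one' ℝ)])
    have hexp0 : 0 < 1 / (2 * Real.exp 1) := by positivity
    -- Since `0 < 1 - 1/(2e) < 1`, this division only enlarges the constant.
    have hfac : hllConst s 1 2 ^ 2 ≤ hllConst s 1 2 ^ 2 / (1 - 1 / (2 * Real.exp 1)) := by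
      rw [le_div_iff₀ (by linarith)]
      nlinarith [sq_nonneg (hllConst s 1 2)]
    have hsum : linfNorm s (circ s) f + linfNorm s (circ 1) f ≤ logBound s I f := by
      rw [logBound, le_div_iff₀ hpos]
      exact hmain.trans (hC.trans hfac)
    exact ⟨hle.trans hsum, hsum⟩
  · set c : ℕ → ℝ := fun n => hardySobolevNorm 1 s (fun w : ℂ => (w ^ n)⁻¹) with hc
    have hcn : ∀ n : ℕ, 1 ≤ n → c n = n * ((s ^ (n + 1))⁻¹ + 1) := by
      intro n hn
      have h := hardySobolevNorm_inv_pow_div n 1 hs0 hs1 one_pos hn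
      simpa using h
    have hc1 : ∀ n : ℕ, 1 ≤ n → 1 ≤ c n := by
      intro n hn
      rw [hcn n hn]
      have h1 : (1 : ℝ) ≤ n := by exact_mod_cast hn
      have h2 : 0 < (s ^ (n + 1))⁻¹ := by positivity
      nlinarith
    have hpt : ∀ n : ℕ, 1 ≤ n → ∀ r, r = s ∨ r = 1 → ∀ ζ ∈ circ r,
        bdryModulus s (fun z => (z ^ n)⁻¹ / (c n : ℂ)) ζ = ENNReal.ofReal ((r ^ n)⁻¹ / c n) :=
      fun n hn r hr =>
        bdryModulus_inv_pow_div n (c n) hs0 hs1 (one_pos.trans_le (hc1 n hn)) hr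
    have hlog : ∀ n : ℕ, 1 ≤ n →
        |Real.log (l1Norm s (circ 1) (fun z => (z ^ n)⁻¹ / (c n : ℂ)))| =
          Real.log (n * ((s ^ (n + 1))⁻¹ + 1)) := by
      intro n hn
      have h1 := hc1 n hn
      rw [l1Norm_circ_eq hs0 (Or.inr rfl) (by positivity) (hpt n hn 1 (Or.inr rfl)), one_pow,
        inv_one, one_div, Real.log_inv, abs_neg, abs_of_nonneg (Real.log_nonneg h1), hcn n hn]
    have hlim := tendsto_inv_pow_div_mul_log hs0 hs1
    refine ⟨fun n z => (z ^ n)⁻¹ / (c n : ℂ), fun _ _ => rfl, fun n hn => ?_,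
      ⟨_, le_rfl, hlim.congr' ?_⟩, ⟨s * |Real.log s|, le_rfl, ?_⟩⟩
    · have h1 := one_pos.trans_le (hc1 n hn)
      refine ⟨memHardySobolev_inv_pow_div n (c n) hs0 h1, ?_⟩
      rw [hardySobolevNorm_inv_pow_div n (c n) hs0 hs1 h1 hn, ← hcn n hn, div_self h1.ne']
    · filter_upwards [eventually_ge_atTop 1] with n hn
      have h1 := one_pos.trans_le (hc1 n hn)
      rw [hlog n hn, linfNorm_bdry_eq hs0 (by positivity) ?_ (hpt n hn s (Or.inl rfl))
        (hpt n hn 1 (Or.inr rfl)), hcn n hn]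
      gcongr
    -- The circle norms are `s^{-n}/c_n` and `1/c_n`, so the sum is `1 + sⁿ` times the essential
    -- supremum and the limit is unchanged.
    · have hpow : Tendsto (fun n : ℕ => 1 + s ^ n) atTop (nhds (1 + 0)) :=
        (tendsto_pow_atTop_nhds_zero_of_lt_one hs0.le hs1).const_add 1
      have h2 := hpow.mul hlim
      rw [add_zero, one_mul] at h2
      refine h2.congr' ?_
      filter_upwards [eventually_ge_atTop 1] with n hn
      have h1 := one_pos.trans_le (hc1 n hn)
      rw [hlog n hn, linfNorm_circ_eq hs0 (Or.inl rfl) (by positivity) (hpt n hn s (Or.inl rfl)),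
        linfNorm_circ_eq hs0 (Or.inr rfl) (by positivity) (hpt n hn 1 (Or.inr rfl)), ← hcn n hn,
        one_pow, inv_one]
      field_simp
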